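/- Let $\mathbb K$ be a field and let $M$ be a graded $\Sigma_*$-module over $\mathbb K$ with $M(0)=0$ and every $M(n)$ finite-dimensional, with a chosen homogeneous basis $B^M$. Let $P=F(M)/(R)$ be a quadratic operad, where $R\subset F_{(2)}(M)$ consists of homogeneous elements, and weights count generators. *Monomials.* $F(M)(r)$ has the basis $B^{F(M)}(r)$ of monomials: reduced $r$-trees (every vertex has at least one entry) in canonical planar form (the entries of each vertex are ordered by the smallest leaf above them), with vertices labelled in $B^M$. For an internal edge $e$ of the tree $\tau$ of a monomial $\alpha$, let $\alpha_{|\tau_e}$ be the restriction of $\alpha$ to the two-vertex subtree generated by $e$, whose leaves are labelled by the smallest leaves above them and then renumbered preserving their order. For $\alpha$ with $m$ entries and $\beta$ with $n$ entries, a pointed shuffle of $\alpha\circ_i\beta$ is a permutation $w\in\Sigma_{m+n-1}$ such that, in $w.\alpha\circ_i\beta$, the entries of $\alpha$ and those of $\beta$ keep their orders and the smallest entry coming from $\beta$ is $i$. Fix for every $r$ a partial order on $B^{F(M)}(r)$ such that $\alpha\le\alpha'$ and $\beta\le\beta'$ imply $w.\alpha\circ_i\beta\le w.\alpha'\circ_i\beta'$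 for all $i$ and all pointed shuffles $w$. (Composites of monomials along pointed shuffles are monomials, up to Koszul signs, which are disregarded in these comparisons.) *PBW basis.* Assume that $P$ has a PBW basis $B^P$ for this order, that is, a set $B^P\subset B^{F(M)}$ that contains $1$ and the corollas labelled in $B^M$, represents a $\mathbb K$-basis of $P$, and satisfies: (i) for $\alpha,\beta\in B^P$ and $w$ a pointed shuffle, either $w.\alpha\circ_i\beta\in B^P$, or all $\gamma\in B^P$ that appear in the decomposition $w.\alpha\circ_i\beta\equiv\sum_\gamma c_\gamma\gamma$ in $P$ satisfy $\gamma>w.\alpha\circ_i\beta$; (ii) a monomial $\alpha$ on a tree $\tau$ is in $B^P$ if and only if $\alpha_{|\tau_e}\in B^P$ for every internal edge $e$ of $\tau$. An internal edge $e$ of $\lambda\in B^{F(M)}$ is called admissible if $\lambda_{|\tau_e}\in B^P$; let $\mathrm{Adm}_\lambda$ be the set of admissible edges of $\lambda$. *Koszul construction.* Let $B(P)=F^c(\Sigma\tilde P)$ be the reduced bar construction, with its differential $\delta$ given by the partial composition products of $P$; let $B_d(P)_{(s)}$ be its part spanned by treewise tensors with $d$ vertices and total weight $s$. Let $K(P)_{(s)}(r)=\ker\bigl(\delta:B_s(P)_{(s)}(r)\to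 B_{s-1}(P)_{(s)}(r)\bigr)\subset F^c_{(s)}(\Sigma M)(r)$, and let $K(P)^\#_{(s)}(r)$ be its linear dual, a quotient of $F_{(s)}(\Sigma^{-1}M^\#)(r)$. For a monomial $\lambda$ with $s$ vertices and $r$ entries, let $\lambda^\#\in F_{(s)}(\Sigma^{-1}M^\#)(r)$ be the dual monomial, that is, the coordinate form of $\lambda$ on $F^c_{(s)}(\Sigma M)(r)$. **Lemma.** For all $s$ and $r$, the classes of the $\lambda^\#$, where $\lambda$ ranges over the monomials with $s$ vertices and $r$ entries such that $\mathrm{Adm}_\lambda=\emptyset$, form a $\mathbb K$-basis of $K(P)^\#_{(s)}(r)$. The condition $\mathrm{Adm}_\lambda=\emptyset$ means that $\lambda_{|\tau_e}\notin B^P$ for every internal edge $e$ of $\lambda$. -/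

import Mathlib

open scoped BigOperators

namespace OperadPBW

universe u v w

/-! ## Trees -/

/-- Planar rooted trees with leaves labelled by natural numbers and with every vertex with `n`
entries labelled by an element of `X n`. The entries of an `r`-tree are numbered `0, …, r - 1`. -/
inductive OTree (X : ℕ → Type w) : Type w
  | leaf (i : ℕ) : OTree X
  | node (n : ℕ) (x : X n) (c : Fin n → OTree X) : OTree X

namespace OTree

variable {X : ℕ → Type w}

/-- The leaf labels, from left to right. -/
def leaves : OTree X → List ℕ
  | leaf i => [i]
  | node _ _ c => (List.ofFn fun k => (c k).leaves).flatten

/-- The smallest leaf label. -/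
def minLeaf (t : OTree X) : ℕ := t.leaves.min?.getD 0

/-- The sum of `f` over all vertices. -/
def vertexSum {A : Type*} [AddCommMonoid A] (f : ∀ n, X n → A) : OTree X → A
  | leaf _ => 0
  | node n x c => f n x + ∑ k, (c k).vertexSum f

/-- The number of vertices. -/
def numVertices (t : OTree X) : ℕ := t.vertexSum fun _ _ => 1

/-- The canonical planar form of a reduced tree: every vertex has an entry, and the entries of every
vertex are placed in increasing order of the smallest leaf linked to them. -/
def IsCanonical : OTree X → Prop
  | leaf _ => True
  | node n _ c => 0 < n ∧ StrictMono (fun k => (c k).minLeaf) ∧ ∀ k, (c k).IsCanonical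

/-- `t` is a reduced `r`-tree, in its canonical planar form, with leaves `0, …, r - 1`. Every
isomorphism class of reduced vertex-labelled `r`-trees contains exactly one of these. -/
def IsReduced (r : ℕ) (t : OTree X) : Prop :=
  t.IsCanonical ∧ t.leaves.Perm (List.range r)

/-- Replace every leaf `i` by the tree `g i`. -/
def bind (g : ℕ → OTree X) : OTree X → OTree X
  | leaf i => g i
  | node n x c => node n x fun k => (c k).bind g

/-- Renumber the leaves. -/
def relabel (f : ℕ → ℕ) (t : OTree X) : OTree X := t.bind fun i => leaf (f i)

/-- The corolla with leaves `0, …, n - 1`. -/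
def corolla (n : ℕ) (x : X n) : OTree X := node n x fun k => leaf k

/-- The grafting `α ∘ᵢ β`, for `β` a tree with `n` entries: the entries of `β` become
`i, …, i + n - 1` and the entries of `α` beyond `i` are shifted by `n - 1`. -/
def graft (n i : ℕ) (α β : OTree X) : OTree X :=
  α.bind fun j => if j < i then leaf j else if j = i then β.relabel (· + i) else leaf (j + n - 1)

/-- Let `c` be the entries of a vertex, and let `d` be the entries of the vertex at the end of its
entry `j`. The entries of the subtree formed by these two vertices are the `c k` with `k ≠ j`,
together with the `d l`; this is the number of those whose smallest leaf is smaller than `a`. It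
is the order-preserving renumbering of the entries of the subtree by `0, 1, …`. -/
def subtreeRank {n m : ℕ} (c : Fin n → OTree X) (j : Fin n) (d : Fin m → OTree X) (a : ℕ) : ℕ :=
  (Finset.univ.filter fun k : Fin n => k ≠ j ∧ (c k).minLeaf < a).card +
    (Finset.univ.filter fun l : Fin m => (d l).minLeaf < a).card

/-- The internal edges of a tree. `here j` is the edge from the root vertex to the vertex at the
end of its entry `j`; `there j e` is the edge `e` of the subtree above the entry `j`. -/
inductive Edge : OTree X → Type w
  | here {n : ℕ} {x : X n} {c : Fin n → OTree X} (j : Fin n) {m : ℕ} {y : X m}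
      {d : Fin m → OTree X} (h : c j = node m y d) : Edge (node n x c)
  | there {n : ℕ} {x : X n} {c : Fin n → OTree X} (j : Fin n) (e : Edge (c j)) :
      Edge (node n x c)

/-- The restriction of a treewise tensor to the subtree generated by an internal edge. A leaf of the
subtree is labelled by the smallest leaf above it, and these labels are then renumbered by
`0, 1, …` preserving their order. -/
def Edge.restrict : {t : OTree X} → Edge t → OTree X
  | _, @Edge.here _ n x c j m y d _ =>
      node n x fun k =>
        if k = j then node m y fun l => leaf (subtreeRank c j d (d l).minLeaf)
        else leaf (subtreeRank c j d (c k).minLeaf)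
  | _, Edge.there _ e => e.restrict

end OTree

open OTree

/-- The function on labels induced by a permutation of `{0, …, r - 1}`. -/
def permFun {r : ℕ} (p : Equiv.Perm (Fin r)) (i : ℕ) : ℕ :=
  if h : i < r then p ⟨i, h⟩ else i

/-- `p` is a pointed shuffle for `α ∘ᵢ β`, where `α` has `m` entries and `β` has `n` entries: it
keeps the order of the entries of `β`, it keeps the order of the entries of `α` (with the entry `i`
represented by the smallest entry of `β`), and the smallest entry of `β` is still `i`. -/
def IsPointedShuffle (m n i : ℕ) (p : Equiv.Perm (Fin (m + n - 1))) : Prop :=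
  permFun p i = i ∧
  StrictMonoOn (permFun p) (Set.Ico i (i + n)) ∧
  StrictMonoOn (permFun p) (Set.Iic i ∪ Set.Ico (i + n) (m + n - 1))

/-! ## Graded `Σ_*`-modules and the free operad -/

/-- A graded `Σ_*`-module over `𝕜`: graded modules `M(n)` with a left action of the symmetric
group by maps of degree `0`. -/
structure SigmaModule (𝕜 : Type u) [Field 𝕜] where
  carrier : ℕ → Type v
  [addCommGroup : ∀ n, AddCommGroup (carrier n)]
  [module : ∀ n, Module 𝕜 (carrier n)]
  piece : ∀ n, ℤ → Submodule 𝕜 (carrier n)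
  isInternal : ∀ n, DirectSum.IsInternal (piece n)
  action : ∀ n, Representation 𝕜 (Equiv.Perm (Fin n)) (carrier n)
  action_mem : ∀ n (p : Equiv.Perm (Fin n)) (d : ℤ), ∀ x ∈ piece n d, action n p x ∈ piece n d

attribute [instance] SigmaModule.addCommGroup SigmaModule.module

/-- A `𝕜`-basis of a graded `Σ_*`-module, formed by homogeneous elements. -/
structure HomogeneousBasis {𝕜 : Type u} [Field 𝕜] (M : SigmaModule.{u, v} 𝕜) where
  ι : ℕ → Type w
  basis : ∀ n, Module.Basis (ι n) 𝕜 (M.carrier n)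
  deg : ∀ n, ι n → ℤ
  basis_mem : ∀ n b, basis n b ∈ M.piece n (deg n b)

/-- The sign `(-1) ^ k` in `𝕜`. -/
def sgn (𝕜 : Type u) [Field 𝕜] (k : ℤ) : 𝕜 := ((k.negOnePow : ℤ) : 𝕜)

/-- The exponent of the Koszul sign of `x₀ ⊗ x₁ ⊗ ⋯ ↦ x_{σ 0} ⊗ x_{σ 1} ⊗ ⋯`, where `x_k` has
degree `d k`. -/
def koszulExponent {n : ℕ} (σ : Equiv.Perm (Fin n)) (d : Fin n → ℤ) : ℤ :=
  ∑ a, ∑ b, if a < b ∧ σ b < σ a then d (σ a) * d (σ b) else 0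

noncomputable section

variable {𝕜 : Type u} [Field 𝕜] {M : SigmaModule.{u, v} 𝕜} (B : HomogeneousBasis.{u, v, w} M)

/-- Trees with vertices labelled by basis elements of `M`. The tree `t` stands for the treewise
tensor `⨂ m_v` in which the factors are written in the following order: the label of the root, then
the labels of the vertices above the entries of the root, from left to right. -/
abbrev BTree : Type w := OTree B.ι

namespace BTree

/-- The internal degree of a treewise tensor. -/
def deg (t : BTree B) : ℤ := t.vertexSum B.deg

/-- The total degree of the vertices that come after the leaf `i`, in the order of the factors. -/
def degAfter (i : ℕ) : BTree B → ℤ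
  | leaf _ => 0
  | node _ _ c => ∑ k, if i ∈ (c k).leaves then degAfter i (c k)
      else if ∃ k' < k, i ∈ (c k').leaves then deg B (c k) else 0

end BTree

/-- An element of the `𝕜`-module spanned by the trees with vertices labelled in the basis
of `M`. -/
abbrev BTensor : Type (max u w) := BTree B →₀ 𝕜

/-- The underlying module `F(M)(r)` of the free operad: it is spanned by the treewise tensors on
the canonical planar forms of reduced `r`-trees with vertices labelled in the basis of `M`. -/
def freeOperad (r : ℕ) : Submodule 𝕜 (BTensor B) :=
  Finsupp.supported 𝕜 𝕜 {t : BTree B | t.IsReduced r}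

/-- The part `F_{(s)}(M)(r)` of weight `s`. -/
def freeOperadWeight (s r : ℕ) : Submodule 𝕜 (BTensor B) :=
  Finsupp.supported 𝕜 𝕜 {t : BTree B | t.IsReduced r ∧ t.numVertices = s}

/-- The treewise tensor with `x` at the root, and with the treewise tensors `z k` above the entries
of the root. -/
def nodeTensor (n : ℕ) (x : M.carrier n) (z : Fin n → BTensor B) : BTensor B :=
  ∑ b ∈ ((B.basis n).repr x).support, ∑ t ∈ Fintype.piFinset fun k => (z k).support,
    Finsupp.single (node n b t) ((B.basis n).repr x b * ∏ k, z k (t k))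

/-- Renumber the leaves of a treewise tensor by `f`, and write the result on canonical planar trees.
At a vertex with label `x` and entries `c 0, c 1, …`, sort the entries as `c (σ 0), c (σ 1), …`; the
treewise tensor with `x` and the entries `c` is the one with `σ⁻¹ x` and the entries `c ∘ σ`, up to
the Koszul sign of the permutation of the factors. -/
def renumberTree (f : ℕ → ℕ) : BTree B → BTensor B
  | leaf i => Finsupp.single (leaf (f i)) 1
  | node n b c =>
      let σ : Equiv.Perm (Fin n) := Tuple.sort fun k => ((c k).relabel f).minLeaf
      sgn 𝕜 (koszulExponent σ fun k => BTree.deg B (c k)) •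
        nodeTensor B n (M.action n σ⁻¹ (B.basis n b)) fun k => renumberTree f (c (σ k))

/-- The action of the symmetric group on `F(M)(r)`. -/
def symAction {r : ℕ} (p : Equiv.Perm (Fin r)) (x : BTensor B) : BTensor B :=
  x.sum fun t a => a • renumberTree B (permFun p) t

/-- The partial composition product `x ∘ᵢ y` of the free operad, for `y` with `n` entries. The
sign comes from moving `β` to its place among the factors of `α`. -/
def partialComp (n i : ℕ) (x y : BTensor B) : BTensor B :=
  x.sum fun α a => y.sum fun β b =>
    Finsupp.single (graft n i α β) (sgn 𝕜 (BTree.deg B β * BTree.degAfter B i α) * (a * b))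

/-- Membership in the operadic ideal `(R)` of `F(M)` generated by `R`: the smallest family of
submodules that contains `R` and is stable under the symmetric groups and under partial composition
products, on either side, with elements of `F(M)`. -/
inductive InIdeal (R : ℕ → Set (BTensor B)) : ℕ → BTensor B → Prop
  | of {r : ℕ} {x : BTensor B} : x ∈ R r → InIdeal R r x
  | zero (r : ℕ) : InIdeal R r 0
  | add {r : ℕ} {x y : BTensor B} : InIdeal R r x → InIdeal R r y → InIdeal R r (x + y)
  | smul {r : ℕ} (a : 𝕜) {x : BTensor B} : InIdeal R r x → InIdeal R r (a • x)
  | act {r : ℕ} (p : Equiv.Perm (Fin r)) {x : BTensor B} :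
      InIdeal R r x → InIdeal R r (symAction B p x)
  | comp_left {m n i : ℕ} {x y : BTensor B} : i < m → InIdeal R m x → y ∈ freeOperad B n →
      InIdeal R (m + n - 1) (partialComp B n i x y)
  | comp_right {m n i : ℕ} {x y : BTensor B} : i < m → x ∈ freeOperad B m → InIdeal R n y →
      InIdeal R (m + n - 1) (partialComp B n i x y)

/-- The operadic ideal `(R)(r)`. -/
def operadIdeal (R : ℕ → Set (BTensor B)) (r : ℕ) : Submodule 𝕜 (BTensor B) where
  carrier := {x | InIdeal B R r x}
  add_mem' := InIdeal.add
  zero_mem' := InIdeal.zero r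
  smul_mem' a _ := InIdeal.smul a

/-- `R` consists of homogeneous elements of weight `2`, that is, `R` presents a graded quadratic
operad. -/
def IsQuadratic (R : ℕ → Set (BTensor B)) : Prop :=
  ∀ r, ∀ x ∈ R r, x ∈ freeOperadWeight B 2 r ∧ ∃ d : ℤ, ∀ t ∈ x.support, BTree.deg B t = d

/-- The quadratic operad `P = F(M)/(R)`, in arity `r`: the classes modulo `(R)(r)` of the elements
of `F(M)(r)`. -/
def quotientOperad (R : ℕ → Set (BTensor B)) (r : ℕ) :
    Submodule 𝕜 (BTensor B ⧸ operadIdeal B R r) :=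
  (freeOperad B r).map (operadIdeal B R r).mkQ

/-- The element of `P(r)` represented by a monomial. -/
def monomialClass (R : ℕ → Set (BTensor B)) {r : ℕ} (t : BTree B) (ht : t.IsReduced r) :
    quotientOperad B R r :=
  ⟨(operadIdeal B R r).mkQ (Finsupp.single t 1),
    Submodule.mem_map_of_mem (Finsupp.single_mem_supported 𝕜 1 ht)⟩

/-! ## Poincaré–Birkhoff–Witt bases -/

/-- For every `r`, `le` is a (partial) order on the monomial basis of `F(M)(r)`, and these orders are
compatible with the composition products `w.α ∘ᵢ β` along pointed shuffles `w`. -/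
structure IsMonomialOrder (le : BTree B → BTree B → Prop) : Prop where
  refl : ∀ (r : ℕ) (α : BTree B), α.IsReduced r → le α α
  trans : ∀ (r : ℕ) (α β γ : BTree B), α.IsReduced r → β.IsReduced r → γ.IsReduced r →
    le α β → le β γ → le α γ
  antisymm : ∀ (r : ℕ) (α β : BTree B), α.IsReduced r → β.IsReduced r →
    le α β → le β α → α = β
  compat : ∀ (m n i : ℕ) (α α' β β' : BTree B), i < m → α.IsReduced m → α'.IsReduced m →
    β.IsReduced n → β'.IsReduced n → le α α' → le β β' →
    ∀ p : Equiv.Perm (Fin (m + n - 1)), IsPointedShuffle m n i p →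
      le ((graft n i α β).relabel (permFun p)) ((graft n i α' β').relabel (permFun p))

/-- `S` is a PBW basis of the operad `P = F(M)/(R)`, for the order `le` on monomials. For monomials
`α`, `β` and a pointed shuffle `w`, the composite `w.α ∘ᵢ β` is, up to a Koszul sign, the monomial on
the grafted and relabelled tree, which is again in canonical planar form. -/
structure IsPBWBasis (R : ℕ → Set (BTensor B)) (le : BTree B → BTree B → Prop)
    (S : Set (BTree B)) : Prop where
  monomial : ∀ α ∈ S, ∃ r, α.IsReduced r
  one_mem : leaf 0 ∈ S
  generator_mem : ∀ (n : ℕ) (b : B.ι n), corolla n b ∈ S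
  linearIndependent : ∀ r : ℕ, LinearIndependent 𝕜
    fun t : {t : BTree B // t ∈ S ∧ t.IsReduced r} => monomialClass B R t.1 t.2.2
  span_eq_top : ∀ r : ℕ, Submodule.span 𝕜 (Set.range
    fun t : {t : BTree B // t ∈ S ∧ t.IsReduced r} => monomialClass B R t.1 t.2.2) = ⊤
  /-- A composite of basis monomials is a basis monomial or a combination of larger ones. -/
  comp : ∀ (m n i : ℕ) (α β : BTree B), i < m → α ∈ S → α.IsReduced m → β ∈ S → β.IsReduced n →
    ∀ p : Equiv.Perm (Fin (m + n - 1)), IsPointedShuffle m n i p →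
      (graft n i α β).relabel (permFun p) ∈ S ∨
      ∃ x : BTensor B,
        (∀ γ ∈ x.support, γ ∈ S ∧ γ.IsReduced (m + n - 1) ∧
          le ((graft n i α β).relabel (permFun p)) γ ∧
          (graft n i α β).relabel (permFun p) ≠ γ) ∧
        Finsupp.single ((graft n i α β).relabel (permFun p)) 1 - x ∈
          operadIdeal B R (m + n - 1)
  /-- Membership is detected on the subtrees generated by internal edges. -/
  mem_iff : ∀ (r : ℕ) (α : BTree B), α.IsReduced r → (α ∈ S ↔ ∀ e : Edge α, e.restrict ∈ S)

/-- The set `Adm_α` of the admissible edges of the monomial `α`. -/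
def admissibleEdges (S : Set (BTree B)) (α : BTree B) : Set (Edge α) :=
  {e | e.restrict ∈ S}

/-! ## The bar construction and the Koszul construction -/

/-- Trees with vertices labelled by monomials of `F(M)`. The tree `T` stands for the treewise tensor
`⨂ Σ x_v` of suspended monomials, with the factors in the same order as before. -/
abbrev BarTree : Type w := OTree fun _ : ℕ => BTree B

/-- Every vertex with `n` entries is labelled by a monomial with `n` entries, different from the
unit `1`. -/
def LabelsOK : BarTree B → Prop
  | leaf _ => True
  | node n x c => x.IsReduced n ∧ 0 < x.numVertices ∧ ∀ k, LabelsOK (c k)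

/-- The basis of treewise tensors of the reduced bar construction
`B(F(M))(r) = F^c(Σ F(M)~)(r)`. -/
def IsBarMonomial (r : ℕ) (T : BarTree B) : Prop := T.IsReduced r ∧ LabelsOK B T

/-- The sum of the weights of the labels. -/
def barWeight (T : BarTree B) : ℕ := T.vertexSum fun _ x => x.numVertices

/-- The total degree of a treewise tensor of suspended monomials. -/
def suspendedDeg (T : BarTree B) : ℤ := T.vertexSum fun _ x => BTree.deg B x + 1

/-- An element of the `𝕜`-module spanned by the trees labelled by monomials of `F(M)`. -/
abbrev BarTensor : Type (max u w) := BarTree B →₀ 𝕜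

/-- The entries of the vertex obtained by contracting the edge between a vertex with entries `c` and
the vertex with entries `d` at the end of its entry `j`, before they are sorted. -/
def mergedEntries {n m : ℕ} (c : Fin n → BarTree B) (j : Fin n) (d : Fin m → BarTree B) :
    List (BarTree B) :=
  (List.ofFn c).take j ++ List.ofFn d ++ (List.ofFn c).drop (j + 1)

/-- The permutation that sorts these entries by their smallest leaves. -/
def mergedSort {n m : ℕ} (c : Fin n → BarTree B) (j : Fin n) (d : Fin m → BarTree B) :
    Equiv.Perm (Fin (mergedEntries B c j d).length) :=
  Tuple.sort fun k => ((mergedEntries B c j d).get k).minLeaf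

/-- The contraction of the edge from a root vertex, labelled by `x`, to the vertex at the end of its
entry `j`, labelled by `y`. The new label is the composite of `x` and `y` at the entry `j`, along the
pointed shuffle given by the positions of the entries. -/
def contractTree {n m : ℕ} (x : BTree B) (c : Fin n → BarTree B) (j : Fin n) (y : BTree B)
    (d : Fin m → BarTree B) : BarTree B :=
  node (mergedEntries B c j d).length
    (x.bind fun i =>
      if h : i < n then
        if (⟨i, h⟩ : Fin n) = j then
          y.relabel fun l =>
            if h' : l < m then subtreeRank c j d (d ⟨l, h'⟩).minLeaf else l
        else leaf (subtreeRank c j d (c ⟨i, h⟩).minLeaf)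
      else leaf i)
    fun k => (mergedEntries B c j d).get (mergedSort B c j d k)

/-- The exponent of the sign of this contraction. Its terms come from: moving `Σy` to the
right of `Σx`; the product `Σx ⊗ Σy ↦ (-1)^{|x|} Σ(x ∘ y)`; the composite `x ∘ y` of monomials;
the sorting of the entries. -/
def contractExponent {n m : ℕ} (x : BTree B) (c : Fin n → BarTree B) (j : Fin n) (y : BTree B)
    (d : Fin m → BarTree B) : ℤ :=
  (BTree.deg B y + 1) * (∑ k ∈ Finset.univ.filter (· < j), suspendedDeg B (c k)) +
    BTree.deg B x +
    BTree.deg B y * BTree.degAfter B j x +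
    koszulExponent (mergedSort B c j d) fun k => suspendedDeg B ((mergedEntries B c j d).get k)

/-- The contraction of the edge from a root vertex to the vertex at the end of its entry `j`, with
its sign; it is `0` if this entry is a leaf. -/
def contractRoot {n : ℕ} (x : BTree B) (c : Fin n → BarTree B) (j : Fin n) : BarTensor B :=
  match c j with
  | leaf _ => 0
  | node _ y d => Finsupp.single (contractTree B x c j y d) (sgn 𝕜 (contractExponent B x c j y d))

/-- The differential `δ` of `B(F(M))` on a treewise tensor: the signed sum of the contractions of
all internal edges, given by the partial composition products. It is the coderivation, of degree
`-1`, defined by the partial composition products. -/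
def barDiffTree : BarTree B → BarTensor B
  | leaf _ => 0
  | node n x c =>
      ∑ j, contractRoot B x c j +
      ∑ j, sgn 𝕜 (BTree.deg B x + 1 +
          ∑ k ∈ Finset.univ.filter (· < j), suspendedDeg B (c k)) •
        Finsupp.mapDomain (fun T => node n x (Function.update c j T)) (barDiffTree (c j))

/-- The differential `δ` of `B(F(M))`. -/
def barDiff : BarTensor B →ₗ[𝕜] BarTensor B :=
  Finsupp.lsum 𝕜 fun T => LinearMap.toSpanSingleton 𝕜 (BarTensor B) (barDiffTree B T)

/-- The treewise tensors in which one vertex, with `n` entries, is labelled by an element of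
`(R)(n)`, and the other vertices are labelled by monomials. -/
inductive IsBarRelation (R : ℕ → Set (BTensor B)) : BarTensor B → Prop
  | root (n : ℕ) (x : BTensor B) (c : Fin n → BarTree B) : x ∈ operadIdeal B R n →
      IsBarRelation R (Finsupp.mapDomain (fun t : BTree B => (node n t c : BarTree B)) x)
  | above (n : ℕ) (y : BTree B) (c : Fin n → BarTree B) (j : Fin n) (z : BarTensor B) :
      IsBarRelation R z →
      IsBarRelation R (Finsupp.mapDomain (fun T => node n y (Function.update c j T)) z)

/-- The kernel of the projection `B(F(M))(r) → B(P)(r)`, for `P = F(M)/(R)`. -/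
def barRelations (R : ℕ → Set (BTensor B)) (r : ℕ) : Submodule 𝕜 (BarTensor B) :=
  Submodule.span 𝕜 {z | IsBarRelation B R z ∧
    z ∈ Finsupp.supported 𝕜 𝕜 {T : BarTree B | IsBarMonomial B r T}}

/-- The part `B_d(F(M))_{(s)}(r)`: trees with `d` vertices, of total weight `s`. -/
def barChains (d s r : ℕ) : Submodule 𝕜 (BarTensor B) :=
  Finsupp.supported 𝕜 𝕜 {T : BarTree B | IsBarMonomial B r T ∧ T.numVertices = d ∧ barWeight B T = s}

/-- The Koszul construction `K(P)_{(s)}(r) = ker (δ : B_s(P)_{(s)}(r) → B_{s-1}(P)_{(s)}(r))`. The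
tensors in `B_s(F(M))_{(s)}` have all their labels in `F_{(1)}(M) = M = P_{(1)}`, so that
`B_s(P)_{(s)} = B_s(F(M))_{(s)} = F^c_{(s)}(ΣM)`; the value of `δ` is taken in `B(P)`. -/
def koszulConstruction (R : ℕ → Set (BTensor B)) (s r : ℕ) : Submodule 𝕜 (BarTensor B) :=
  barChains B s s r ⊓ LinearMap.ker ((barRelations B R r).mkQ ∘ₗ barDiff B)

/-- The treewise tensor of `F^c(ΣM)` with the same tree and the same labels as `t`, seen in
`B(F(M))`. -/
def toBar : BTree B → BarTree B
  | leaf i => leaf i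
  | node n b c => node n (corolla n b) fun k => toBar (c k)

/-- The class in `K(P)^#_{(s)}(r)` of the dual `λ^#` of a monomial `λ`: the coordinate form of the
treewise tensor `λ` of `F^c(ΣM)`, restricted to `K(P)_{(s)}(r)`. -/
def dualMonomial (R : ℕ → Set (BTensor B)) (s r : ℕ) (t : BTree B) :
    Module.Dual 𝕜 (koszulConstruction B R s r) :=
  Finsupp.lapply (toBar B t) ∘ₗ (koszulConstruction B R s r).subtype

end

end OperadPBW

/-! For a monomial `λ` and a set `E` of internal edges, let `λ/E` be the treewise tensor obtained by
contracting the edges of `E`. Every treewise tensor of `B(F(M))` has this form, up to sign, with `λ`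
given by `expand`; the edges in `E` are those internal to the labels. By condition (ii) the labels
of `λ/E` all lie in `S` exactly when `E ⊆ Adm_λ` (`allLabels_iff`). These tensors give coordinates
on `B(P)`, the functionals `coefficient`. By condition (i), contracting one more edge of such a
`λ/E` gives either `λ/(E ∪ {e})`, when `e` is admissible, or, modulo relations, a combination of
`μ/E'` with `μ > λ` (`exists_reduction`). So `δ` is triangular for the order on underlying
monomials. Its diagonal part at `λ` adds one edge of `Adm_λ` to `E`, with signs, which is an acyclic
complex unless `Adm_λ` is empty. Hence `K(P)`, the kernel of `δ` on the `λ/∅`, has one dimension for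
each `λ` with no admissible edge.

No spectral sequence is used: finiteness of the set of monomials allows minimal elements to be
chosen. The map `koszulCoordinates`, from `K(P)` to the coordinates on the monomials without
admissible edge, is shown to be bijective; the dual basis of the basis it defines consists of the
classes `λ^#`.

Injectivity (`eq_zero_of_coefficient`): let `λ` be minimal in the support of `z`, with an admissible
edge `p`. By triangularity only `λ` contributes to the coefficient of `λ/p` in `δz`, and it does so
with a sign. So that coefficient is not zero, and `δz` is not a relation.

Surjectivity (`barDiff_mem_of_coefficient`): choose an admissible edge `p(λ)` for each `λ` that has
one. By the injectivity argument, a linear system solved in finite dimension adjusts the coordinates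
on these `λ` so that the coefficients of `δz` on all `λ/p(λ)` vanish. Then `δz` vanishes in `B(P)`:
if `λ/q` occurs in its normal form with `λ` minimal, then `q ≠ p(λ)`, and the coefficient of
`λ/{p(λ), q}` in `δδz` would be nonzero. This uses `δδ = 0` in `B(F(M))` (`barDiff_barDiffTree`) and
the stability of the relations under `δ` (`barDiff_mem_treeRelations`).

The bookkeeping rests on `markedWord`: a treewise tensor is encoded by the preorder word of its
expansion, with a mark on each vertex that is not the root of a label. Contracting an edge is
marking one vertex, so contractions commute visibly. After the twist by `orderExponent`, which
reorders the factors according to this word, the sign of a contraction is the degree of the prefix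
before the vertex plus one. Marking removes a suspension, whence the anticommutation. -/

namespace OperadPBW

/-! ### Trees as prefix-free words; substitution and renumbering of leaves. -/

section
namespace OTree

variable {X : ℕ → Type w}

/-- The vertices and the leaves of a tree, in preorder. -/
def word : OTree X → List ((Σ n, X n) ⊕ ℕ)
  | leaf i => [.inr i]
  | node n x c => .inl ⟨n, x⟩ :: (List.ofFn fun k => (c k).word).flatten

/-- The leaves of a word, in order. -/
def wordLeaves {α : Type*} (l : List (α ⊕ ℕ)) : List ℕ := l.filterMap Sum.getRight?

@[simp] lemma wordLeaves_nil {α : Type*} : wordLeaves ([] : List (α ⊕ ℕ)) = [] := rfl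
@[simp] lemma wordLeaves_inl {α : Type*} (a : α) (l : List (α ⊕ ℕ)) :
    wordLeaves (.inl a :: l) = wordLeaves l := rfl
@[simp] lemma wordLeaves_inr {α : Type*} (i : ℕ) (l : List (α ⊕ ℕ)) :
    wordLeaves (.inr i :: l) = i :: wordLeaves l := rfl
@[simp] lemma wordLeaves_append {α : Type*} (l l' : List (α ⊕ ℕ)) :
    wordLeaves (l ++ l') = wordLeaves l ++ wordLeaves l' := List.filterMap_append
lemma wordLeaves_flatten {α : Type*} (L : List (List (α ⊕ ℕ))) :
    wordLeaves L.flatten = (L.map wordLeaves).flatten := by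
  induction L with
  | nil => rfl
  | cons a L ih => simp [ih]

lemma mem_wordLeaves {α : Type*} {l : List (α ⊕ ℕ)} {i : ℕ} :
    i ∈ wordLeaves l ↔ Sum.inr i ∈ l := by
  induction l with
  | nil => simp
  | cons a l ih => rcases a with a | a <;> simp [ih]

lemma wordLeaves_word (t : OTree X) : wordLeaves t.word = t.leaves := by
  induction t with
  | leaf i => simp [word, leaves]
  | node n x c ih => simp [word, leaves, wordLeaves_flatten, Function.comp_def, ih, List.map_ofFn]

lemma vertexSum_eq {A : Type*} [AddCommMonoid A] (f : ∀ n, X n → A) (t : OTree X) :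
    t.vertexSum f = (t.word.map (Sum.elim (fun v => f v.1 v.2) fun _ => 0)).sum := by
  induction t with
  | leaf i => simp [word, vertexSum]
  | node n x c ih =>
    simp [word, vertexSum, List.map_flatten, List.sum_flatten, List.map_ofFn, Function.comp_def,
      ih, List.sum_ofFn]

/-- If each block can be split off the front of a list in only one way, so can a concatenation of
blocks; `P k` records what is learnt about the block `k`. This serves for plain words and for marked
words. -/
lemma flatten_ofFn_parse {β : Type*} {n : ℕ} (e e' : Fin n → List β) (P : Fin n → Prop)
    (h : ∀ k l l', e k ++ l = e' k ++ l' → P k ∧ l = l') {l l' : List β}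
    (hl : (List.ofFn e).flatten ++ l = (List.ofFn e').flatten ++ l') : (∀ k, P k) ∧ l = l' := by
  induction n with
  | zero => exact ⟨fun k => k.elim0, by simpa using hl⟩
  | succ n ih =>
    simp only [List.ofFn_succ, List.flatten_cons, List.append_assoc] at hl
    obtain ⟨h0, h1⟩ := h 0 _ _ hl
    obtain ⟨h2, h3⟩ := ih _ _ (fun k => P k.succ) (fun k => h k.succ) h1
    exact ⟨Fin.cases h0 h2, h3⟩

/-- The arity stored with each vertex tells where its subtree ends, so words form a prefix code. The
remainders `l`, `l'` let the induction parse the entries of a vertex one after the other. -/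
lemma word_append_inj (t t' : OTree X) (l l' : List ((Σ n, X n) ⊕ ℕ))
    (h : t.word ++ l = t'.word ++ l') : t = t' ∧ l = l' := by
  induction t generalizing t' l l' with
  | leaf i =>
    cases t' with
    | leaf j => simpa [word] using h
    | node n x c => simp [word] at h
  | node n x c ih =>
    cases t' with
    | leaf j => simp [word] at h
    | node m y d =>
      simp only [word, List.cons_append, List.cons.injEq, Sum.inl.injEq, Sigma.mk.injEq] at h
      obtain ⟨⟨rfl, h1⟩, h2⟩ := h
      obtain rfl := eq_of_heq h1
      obtain ⟨h3, h4⟩ := flatten_ofFn_parse _ _ (fun k => c k = d k)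
        (fun k l l' hk => ih k _ _ _ hk) h2
      exact ⟨by rw [funext h3], h4⟩

lemma word_injective : Function.Injective (word : OTree X → _) := fun t t' h =>
  (word_append_inj t t' [] [] (by simpa using h)).1

lemma word_bind (g : ℕ → OTree X) (t : OTree X) :
    (t.bind g).word = t.word.flatMap (Sum.elim (fun v => [.inl v]) fun i => (g i).word) := by
  induction t with
  | leaf i => simp [word, bind]
  | node n x c ih =>
    simp only [word, bind, ih, List.map_cons, List.flatten_cons, Sum.elim_inl, List.cons_append,
      List.nil_append, List.flatMap_def, List.map_flatten, List.flatten_flatten, List.map_ofFn,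
      Function.comp_def]

lemma leaves_bind (g : ℕ → OTree X) (t : OTree X) :
    (t.bind g).leaves = t.leaves.flatMap fun i => (g i).leaves := by
  induction t with
  | leaf i => simp [leaves, bind]
  | node n x c ih =>
    simp only [leaves, bind, ih, List.flatMap_def, List.map_flatten, List.flatten_flatten,
      List.map_ofFn, Function.comp_def]

lemma bind_bind (g h : ℕ → OTree X) (t : OTree X) :
    (t.bind g).bind h = t.bind fun i => (g i).bind h := by
  induction t with
  | leaf i => rfl
  | node n x c ih => simp only [bind, ih]

lemma mem_leaves_node {n : ℕ} {x : X n} {c : Fin n → OTree X} {i : ℕ} :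
    i ∈ (node n x c).leaves ↔ ∃ k, i ∈ (c k).leaves := by
  simp [leaves, List.mem_ofFn]

lemma mem_leaves_bind {g : ℕ → OTree X} {t : OTree X} {i : ℕ} :
    i ∈ (t.bind g).leaves ↔ ∃ k ∈ t.leaves, i ∈ (g k).leaves := by
  simp [leaves_bind]

lemma bind_congr {g h : ℕ → OTree X} {t : OTree X} (H : ∀ i ∈ t.leaves, g i = h i) :
    t.bind g = t.bind h := by
  induction t with
  | leaf i => exact H i (by simp [leaves])
  | node n x c ih =>
    simp only [bind]
    congr 1
    funext k
    exact ih k fun i hi => H i (mem_leaves_node.2 ⟨k, hi⟩)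

lemma bind_eq_iff {g h : ℕ → OTree X} {t : OTree X} :
    t.bind g = t.bind h ↔ ∀ i ∈ t.leaves, g i = h i := by
  refine ⟨fun H => ?_, bind_congr⟩
  induction t with
  | leaf i => simpa [leaves, bind] using H
  | node n x c ih =>
    intro i hi
    obtain ⟨k, hk⟩ := mem_leaves_node.1 hi
    simp only [bind, node.injEq, heq_eq_eq, true_and] at H
    exact ih k (congrFun H k) i hk

lemma bind_leaf (t : OTree X) : t.bind leaf = t := by
  induction t with
  | leaf i => rfl
  | node n x c ih => simp only [bind, ih]

lemma relabel_bind (f : ℕ → ℕ) (g : ℕ → OTree X) (t : OTree X) :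
    (t.relabel f).bind g = t.bind fun i => g (f i) := by
  simp only [relabel, bind_bind, bind]

lemma relabel_relabel (f g : ℕ → ℕ) (t : OTree X) :
    (t.relabel f).relabel g = t.relabel fun i => g (f i) := by
  simp only [relabel, bind_bind, bind]

lemma leaves_relabel (f : ℕ → ℕ) (t : OTree X) : (t.relabel f).leaves = t.leaves.map f := by
  simp only [relabel, leaves_bind, leaves, List.flatMap_def]
  induction t.leaves <;> simp_all

lemma relabel_congr {f g : ℕ → ℕ} {t : OTree X} (H : ∀ i ∈ t.leaves, f i = g i) :
    t.relabel f = t.relabel g := bind_congr fun i hi => by rw [H i hi]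

lemma relabel_id {f : ℕ → ℕ} {t : OTree X} (H : ∀ i ∈ t.leaves, f i = i) :
    t.relabel f = t := by
  conv_rhs => rw [← bind_leaf t]
  exact bind_congr fun i hi => by rw [H i hi]

@[simp] lemma relabel_leaf (f : ℕ → ℕ) (i : ℕ) : (leaf i : OTree X).relabel f = leaf (f i) := rfl

lemma relabel_node (f : ℕ → ℕ) {n : ℕ} (x : X n) (c : Fin n → OTree X) :
    (node n x c).relabel f = node n x fun k => (c k).relabel f := rfl

lemma vertexSum_bind {A : Type*} [AddCommMonoid A] (f : ∀ n, X n → A) (g : ℕ → OTree X)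
    (t : OTree X) :
    (t.bind g).vertexSum f = t.vertexSum f + (t.leaves.map fun i => (g i).vertexSum f).sum := by
  induction t with
  | leaf i => simp [bind, vertexSum, leaves]
  | node n x c ih =>
    simp only [bind, vertexSum, ih, leaves, List.map_flatten, List.sum_flatten, List.map_ofFn,
      Function.comp_def, List.sum_ofFn, Finset.sum_add_distrib, add_assoc]

@[simp] lemma vertexSum_relabel {A : Type*} [AddCommMonoid A] (f : ∀ n, X n → A) (g : ℕ → ℕ)
    (t : OTree X) : (t.relabel g).vertexSum f = t.vertexSum f := by
  simp [relabel, vertexSum_bind, vertexSum]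

/-- Nonemptiness excludes the default value `0` of `minLeaf`. -/
lemma minLeaf_eq_iff {t : OTree X} (h : t.leaves ≠ []) {a : ℕ} :
    t.minLeaf = a ↔ a ∈ t.leaves ∧ ∀ b ∈ t.leaves, a ≤ b := by
  rw [← List.min?_eq_some_iff, minLeaf]
  cases h' : t.leaves.min? with
  | none => simp [h] at h'
  | some b => simp

lemma minLeaf_mem {t : OTree X} (h : t.leaves ≠ []) : t.minLeaf ∈ t.leaves :=
  ((minLeaf_eq_iff h).1 rfl).1

lemma minLeaf_le {t : OTree X} {b : ℕ} (h : b ∈ t.leaves) : t.minLeaf ≤ b :=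
  ((minLeaf_eq_iff (List.ne_nil_of_mem h)).1 rfl).2 b h

@[simp] lemma minLeaf_leaf (i : ℕ) : (leaf i : OTree X).minLeaf = i := by
  rw [minLeaf_eq_iff] <;> simp [leaves]

lemma minLeaf_eq_of_perm {Y : ℕ → Type*} {t : OTree X} {t' : OTree Y}
    (h : t.leaves.Perm t'.leaves) : t.minLeaf = t'.minLeaf := by
  by_cases h0 : t.leaves = []
  · rw [h0] at h
    simp [minLeaf, h0, h.symm.eq_nil]
  · have h1 : t'.leaves ≠ [] := fun h' => h0 (by rw [h'] at h; exact h.eq_nil)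
    rw [minLeaf_eq_iff h0]
    exact ⟨h.mem_iff.2 (minLeaf_mem h1), fun b hb => minLeaf_le (h.mem_iff.1 hb)⟩

lemma IsCanonical.leaves_ne_nil {t : OTree X} (h : t.IsCanonical) : t.leaves ≠ [] := by
  induction t with
  | leaf i => simp [leaves]
  | node n x c ih =>
    intro h0
    have := ih ⟨0, h.1⟩ (h.2.2 _)
    obtain ⟨a, ha⟩ := List.exists_mem_of_ne_nil _ this
    have : a ∈ (node n x c).leaves := mem_leaves_node.2 ⟨_, ha⟩
    simp [h0] at this

lemma minLeaf_bind {t : OTree X} (ht : t.leaves ≠ []) {g : ℕ → OTree X}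
    (hg : ∀ i ∈ t.leaves, (g i).leaves ≠ [])
    (hm : MonotoneOn (fun i => (g i).minLeaf) {i | i ∈ t.leaves}) :
    (t.bind g).minLeaf = (g t.minLeaf).minLeaf := by
  have h1 := minLeaf_mem ht
  have h2 : (t.bind g).leaves ≠ [] := by
    have := minLeaf_mem (hg _ h1)
    exact List.ne_nil_of_mem (mem_leaves_bind.2 ⟨_, h1, this⟩)
  rw [minLeaf_eq_iff h2]
  refine ⟨mem_leaves_bind.2 ⟨_, h1, minLeaf_mem (hg _ h1)⟩, fun b hb => ?_⟩
  obtain ⟨k, hk, hb⟩ := mem_leaves_bind.1 hb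
  exact (hm h1 hk (minLeaf_le hk)).trans (minLeaf_le hb)

/-- The smallest leaf of a substituted entry comes from the smallest leaf of that entry, so
increasing smallest leaves of the `g i` preserve the order of the entries at every vertex. -/
lemma IsCanonical.bind {t : OTree X} (ht : t.IsCanonical) {g : ℕ → OTree X}
    (hg : ∀ i ∈ t.leaves, (g i).IsCanonical)
    (hm : StrictMonoOn (fun i => (g i).minLeaf) {i | i ∈ t.leaves}) : (t.bind g).IsCanonical := by
  induction t with
  | leaf i => exact hg i (by simp [leaves])
  | node n x c ih =>
    have hk : ∀ k, ∀ i ∈ (c k).leaves, i ∈ (node n x c).leaves := fun k i hi =>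
      mem_leaves_node.2 ⟨k, hi⟩
    refine ⟨ht.1, fun k k' hkk' => ?_, fun k => ih k (ht.2.2 k) (fun i hi => hg i (hk k i hi))
      (hm.mono (hk k))⟩
    have h1 : ∀ k, ((c k).bind g).minLeaf = (g (c k).minLeaf).minLeaf := fun k =>
      minLeaf_bind (ht.2.2 k).leaves_ne_nil (fun i hi => (hg i (hk k i hi)).leaves_ne_nil)
        ((hm.mono (hk k)).monotoneOn)
    dsimp only
    rw [h1, h1]
    exact hm (hk _ _ (minLeaf_mem (ht.2.2 k).leaves_ne_nil))
      (hk _ _ (minLeaf_mem (ht.2.2 k').leaves_ne_nil)) (ht.2.1 hkk')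

lemma IsCanonical.relabel {t : OTree X} (ht : t.IsCanonical) {f : ℕ → ℕ}
    (hm : StrictMonoOn f {i | i ∈ t.leaves}) : (t.relabel f).IsCanonical :=
  IsCanonical.bind ht (fun _ _ => trivial) (by simpa using hm)

lemma minLeaf_relabel {t : OTree X} (ht : t.leaves ≠ []) {f : ℕ → ℕ}
    (hm : MonotoneOn f {i | i ∈ t.leaves}) : (t.relabel f).minLeaf = f t.minLeaf := by
  rw [OTree.relabel, minLeaf_bind ht (by simp [leaves]) (by simpa using hm), minLeaf_leaf]

lemma IsReduced.mem_leaves {r : ℕ} {t : OTree X} (h : t.IsReduced r) {i : ℕ} :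
    i ∈ t.leaves ↔ i < r := by
  rw [h.2.mem_iff, List.mem_range]

lemma IsReduced.setOf_leaves {r : ℕ} {t : OTree X} (h : t.IsReduced r) :
    {i | i ∈ t.leaves} = Set.Iio r := by
  ext; simp [h.mem_leaves]

lemma IsReduced.nodup {r : ℕ} {t : OTree X} (h : t.IsReduced r) : t.leaves.Nodup :=
  h.2.nodup_iff.2 List.nodup_range

lemma IsReduced.pos {r : ℕ} {t : OTree X} (h : t.IsReduced r) : 0 < r := by
  have := h.mem_leaves.1 (minLeaf_mem h.1.leaves_ne_nil)
  omega

lemma IsReduced.minLeaf {r : ℕ} {t : OTree X} (h : t.IsReduced r) : t.minLeaf = 0 := by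
  rw [minLeaf_eq_iff h.1.leaves_ne_nil]
  exact ⟨h.mem_leaves.2 h.pos, fun _ _ => Nat.zero_le _⟩

lemma nodup_leaves_node {n : ℕ} {x : X n} {c : Fin n → OTree X} (h : (node n x c).leaves.Nodup) :
    (∀ k, (c k).leaves.Nodup) ∧
      ∀ k k' i, i ∈ (c k).leaves → i ∈ (c k').leaves → k = k' := by
  simp only [leaves, List.nodup_flatten, List.mem_ofFn, List.pairwise_ofFn] at h
  refine ⟨fun k => h.1 _ ⟨k, rfl⟩, fun k k' i hi hi' => ?_⟩
  rcases lt_trichotomy k k' with hlt | rfl | hlt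
  · exact (h.2 hlt hi hi').elim
  · rfl
  · exact (h.2 hlt hi' hi).elim

/-- The leaves of an element of a list of trees are determined, up to order, by those of the list. -/
lemma leaves_node_perm {n m : ℕ} {x : X n} {y : X m} {c : Fin n → OTree X} {d : Fin m → OTree X}
    (h : (List.ofFn c).Perm (List.ofFn d)) : (node n x c).leaves.Perm (node m y d).leaves := by
  have h1 : ∀ (n : ℕ) (x : X n) (c : Fin n → OTree X),
      (node n x c).leaves = (List.ofFn c).flatMap leaves := fun n x c => by
    simp [leaves, List.flatMap_def, List.map_ofFn, Function.comp_def]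
  rw [h1, h1]
  exact h.flatMap_right _

end OTree

end

/-! ### Pointed shuffles and composition of reduced trees. -/

section
open OTree

lemma perm_range_of_nodup {l : List ℕ} {n : ℕ} (h : l.Nodup) (hl : ∀ i ∈ l, i < n)
    (hn : l.length = n) : l.Perm (List.range n) := by
  refine List.perm_of_nodup_nodup_toFinset_eq h List.nodup_range ?_
  refine Finset.eq_of_subset_of_card_le (fun i hi => ?_) ?_
  · simpa using hl i (by simpa using hi)
  · rw [List.toFinset_card_of_nodup h, List.toFinset_card_of_nodup List.nodup_range, hn,
      List.length_range]

lemma permFun_of_lt {r : ℕ} (p : Equiv.Perm (Fin r)) {i : ℕ} (h : i < r) :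
    permFun p i = p ⟨i, h⟩ := by simp [permFun, h]

lemma permFun_lt {r : ℕ} (p : Equiv.Perm (Fin r)) {i : ℕ} (h : i < r) : permFun p i < r := by
  rw [permFun_of_lt p h]; exact Fin.is_lt _

lemma permFun_injOn {r : ℕ} (p : Equiv.Perm (Fin r)) : Set.InjOn (permFun p) (Set.Iio r) := by
  intro a ha b hb h
  rw [permFun_of_lt p ha, permFun_of_lt p hb] at h
  exact Fin.mk.inj_iff.1 (p.injective (Fin.ext h))

/-- A function with finitely many values can be sorted. -/
lemma exists_sorting {N : ℕ} (F : ℕ → ℕ) (hF : Set.InjOn F (Set.Iio N)) :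
    ∃ (p : Equiv.Perm (Fin N)) (h : ℕ → ℕ), StrictMonoOn h (Set.Iio N) ∧
      (∀ q < N, h (permFun p q) = F q) ∧
      (∀ a < N, ∀ b < N, F a < F b ↔ permFun p a < permFun p b) ∧
      ∀ j < N, (∀ q < N, F q < F j ↔ q < j) → permFun p j = j := by
  set F' : Fin N → ℕ := fun q => F q with hF'
  set σ := Tuple.sort F'
  have hσ : StrictMono (F' ∘ σ) := (Tuple.monotone_sort F').strictMono_of_injective
    (Function.Injective.comp (fun a b hab => Fin.ext (hF a.2 b.2 hab)) σ.injective)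
  have key : ∀ a b : Fin N, F a < F b ↔ σ⁻¹ a < σ⁻¹ b := fun a b => by
    rw [← hσ.lt_iff_lt]; simp [hF']
  refine ⟨σ⁻¹, fun q => if h : q < N then F' (σ ⟨q, h⟩) else 0, ?_, ?_, ?_, ?_⟩
  · intro a ha b hb hab
    simp only [Set.mem_Iio] at ha hb
    simp only [ha, hb, dite_true]
    exact hσ (show (⟨a, ha⟩ : Fin N) < ⟨b, hb⟩ from hab)
  · intro q hq
    rw [permFun_of_lt _ hq]
    simp [hF']
  · intro a ha b hb
    rw [permFun_of_lt _ ha, permFun_of_lt _ hb, ← Fin.lt_def, ← key]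
  · intro j hj H
    rw [permFun_of_lt _ hj]
    -- The image of `j` is the number of positions with smaller value, and by `H` these are the
    -- positions before `j`.
    have h1 : (Finset.Iio (σ⁻¹ ⟨j, hj⟩)).map σ.toEmbedding = Finset.Iio ⟨j, hj⟩ := by
      ext q
      have := key q ⟨j, hj⟩
      simp only [Finset.mem_map_equiv, Finset.mem_Iio]
      rw [Fin.lt_def (a := q), ← H q q.2, this]
      rfl
    have h2 := congrArg Finset.card h1
    simpa using h2

/-- The positions of the entries in a composite determine a pointed shuffle. -/
lemma exists_pointedShuffle {m n j : ℕ} (hj : j < m) (hn : 0 < n) (f g : ℕ → ℕ)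
    (hf : StrictMonoOn f (Set.Iio m)) (hg : StrictMonoOn g (Set.Iio n)) (hfg : f j = g 0)
    (hd : ∀ i < m, i ≠ j → ∀ l < n, f i ≠ g l) :
    ∃ (p : Equiv.Perm (Fin (m + n - 1))) (h : ℕ → ℕ), IsPointedShuffle m n j p ∧
      StrictMonoOn h (Set.Iio (m + n - 1)) ∧ (∀ q < j, h (permFun p q) = f q) ∧
      (∀ l < n, h (permFun p (l + j)) = g l) ∧
      ∀ i < m, j < i → h (permFun p (i + n - 1)) = f i := by
  -- `F` lists the final labels of the entries of the composite in their unshuffled order: entries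
  -- of `α` up to `j`, then those of `β`, then those of `α` shifted by `n - 1`. Sorting `F` gives
  -- `p`, and `h` is the sorted list of labels.
  set F : ℕ → ℕ := fun q => if q < j then f q else if q < j + n then g (q - j) else f (q + 1 - n)
    with hF
  have F1 : ∀ q < j, F q = f q := fun q hq => by simp [hF, hq]
  have F2 : ∀ q, j ≤ q → q < j + n → F q = g (q - j) := fun q hq hq' => by
    simp [hF, not_lt.2 hq, hq']
  have F3 : ∀ q, j + n ≤ q → F q = f (q + 1 - n) := fun q hq => by
    simp [hF, not_lt.2 hq, show ¬ q < j by omega]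
  have hFj : F j = f j := by rw [F2 j le_rfl (by omega), hfg]; simp
  have m1 : StrictMonoOn F (Set.Ico j (j + n)) := by
    intro a ha b hb hab
    simp only [Set.mem_Ico] at ha hb
    rw [F2 a ha.1 ha.2, F2 b hb.1 hb.2]
    exact hg (by simp; omega) (by simp; omega) (by omega)
  have e2 : ∀ q ∈ Set.Iic j ∪ Set.Ico (j + n) (m + n - 1),
      F q = f (if q ≤ j then q else q + 1 - n) := by
    intro q hq
    simp only [Set.mem_union, Set.mem_Iic, Set.mem_Ico] at hq
    rcases hq with hq | hq
    · rcases hq.lt_or_eq with h | rfl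
      · simp [F1 q h, h.le]
      · simp [hFj]
    · simp [F3 q hq.1, show ¬ q ≤ j by omega]
  have m2 : StrictMonoOn F (Set.Iic j ∪ Set.Ico (j + n) (m + n - 1)) := by
    intro a ha b hb hab
    rw [e2 a ha, e2 b hb]
    simp only [Set.mem_union, Set.mem_Iic, Set.mem_Ico] at ha hb
    refine hf ?_ ?_ ?_
    · simp only [Set.mem_Iio]; split_ifs <;> omega
    · simp only [Set.mem_Iio]; split_ifs <;> omega
    · split_ifs <;> omega
  have hcase : ∀ q < m + n - 1, q ∈ Set.Ico j (j + n) ∨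
      q ∈ Set.Iic j ∪ Set.Ico (j + n) (m + n - 1) := by
    intro q hq
    simp only [Set.mem_union, Set.mem_Iic, Set.mem_Ico]
    omega
  -- The two blocks overlap in the position `j` only, where the smallest entry of `β` stands for the
  -- entry `j` of `α`.
  have hcross : ∀ a ∈ Set.Ico j (j + n), ∀ b ∈ Set.Iic j ∪ Set.Ico (j + n) (m + n - 1),
      F a = F b → a = b := by
    intro a ha b hb hab
    by_cases hbj : b = j
    · subst hbj
      exact m1.injOn ha ⟨le_rfl, by omega⟩ hab
    · exfalso
      rw [e2 b hb, F2 a ha.1 ha.2] at hab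
      simp only [Set.mem_union, Set.mem_Iic, Set.mem_Ico] at ha hb
      refine hd (if b ≤ j then b else b + 1 - n) ?_ ?_ _ ?_ hab.symm
      · split_ifs <;> omega
      · split_ifs <;> omega
      · omega
  have hinj : Set.InjOn F (Set.Iio (m + n - 1)) := by
    intro a ha b hb hab
    rcases hcase a ha with h1 | h1 <;> rcases hcase b hb with h2 | h2
    · exact m1.injOn h1 h2 hab
    · exact hcross a h1 b h2 hab
    · exact (hcross b h2 a h1 hab.symm).symm
    · exact m2.injOn h1 h2 hab
  obtain ⟨p, h, hh, hp, hlt, hfix⟩ := exists_sorting F hinj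
  refine ⟨p, h, ⟨hfix j (by omega) fun q hq => ?_, ?_, ?_⟩, hh, ?_, ?_, ?_⟩
  · rcases hcase q hq with h1 | h1
    · have := m1.le_iff_le (a := j) ⟨le_rfl, by omega⟩ h1
      simp only [Set.mem_Ico] at h1
      rw [← not_le, ← not_le, this]
    · have := m2.lt_iff_lt h1 (b := j) (by simp)
      rw [this]
  · intro a ha b hb hab
    have hab' := m1 ha hb hab
    simp only [Set.mem_Ico] at ha hb
    exact (hlt a (by omega) b (by omega)).1 hab'
  · intro a ha b hb hab
    have hab' := m2 ha hb hab
    simp only [Set.mem_union, Set.mem_Iic, Set.mem_Ico] at ha hb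
    exact (hlt a (by omega) b (by omega)).1 hab'
  · intro q hq
    rw [hp q (by omega), F1 q hq]
  · intro l hl
    rw [hp _ (by omega), F2 _ (by omega) (by omega)]
    simp
  · intro i hi hij
    rw [hp _ (by omega), F3 _ (by omega)]
    congr 1; omega

namespace OTree

variable {X : ℕ → Type w}

lemma graft_relabel (n j : ℕ) (x y : OTree X) (φ : ℕ → ℕ) :
    (graft n j x y).relabel φ = x.bind fun i => if i < j then leaf (φ i) else
      if i = j then y.relabel fun l => φ (l + j) else leaf (φ (i + n - 1)) := by
  simp only [graft, OTree.relabel, bind_bind]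
  congr 1
  funext i
  split_ifs <;> simp [bind, bind_bind]

/-- The composite with leaves labelled by `f` and `g`. -/
lemma graft_relabel_relabel {m n j : ℕ} {x y : OTree X} (hx : ∀ i ∈ x.leaves, i < m)
    (hy : ∀ l ∈ y.leaves, l < n) {f g h : ℕ → ℕ} {p : Equiv.Perm (Fin (m + n - 1))}
    (h1 : ∀ q < j, h (permFun p q) = f q)
    (h2 : ∀ l < n, h (permFun p (l + j)) = g l)
    (h3 : ∀ i < m, j < i → h (permFun p (i + n - 1)) = f i) :
    ((graft n j x y).relabel (permFun p)).relabel h =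
      x.bind fun i => if i = j then y.relabel g else leaf (f i) := by
  rw [relabel_relabel, graft_relabel]
  refine bind_congr fun i hi => ?_
  rcases lt_trichotomy i j with hij | rfl | hij
  · simp [hij, hij.ne, h1 i hij]
  · simp only [lt_irrefl, if_false, if_true]
    exact relabel_congr fun l hl => h2 l (hy l hl)
  · simp [not_lt.2 hij.le, hij.ne', h3 i (hx i hi) hij]

/-- Only the leaf `j` is replaced by something other than a single leaf. The `+ 1` avoids truncated
subtraction. -/
lemma length_leaves_bind_ite {j : ℕ} {x y : OTree X} (hx : x.leaves.Nodup) (hj : j ∈ x.leaves)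
    (g : ℕ → OTree X) (hg : ∀ i, (g i).leaves.length = if i = j then y.leaves.length else 1) :
    (x.bind g).leaves.length + 1 = x.leaves.length + y.leaves.length := by
  rw [leaves_bind, List.length_flatMap]
  have : ∀ l : List ℕ, l.Nodup → (l.map fun i => (g i).leaves.length).sum +
      (if j ∈ l then 1 else 0) = l.length + (if j ∈ l then y.leaves.length else 0) := by
    intro l hl
    induction l with
    | nil => simp
    | cons a l ih =>
      have := ih hl.of_cons
      have ha := (List.nodup_cons.1 hl).1
      simp only [List.map_cons, List.sum_cons, hg, List.length_cons, List.mem_cons]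
      simp only [hg] at this
      by_cases haj : j = a
      · subst haj
        simp [ha] at this ⊢
        omega
      · simp [haj, Ne.symm haj] at this ⊢
        omega
  have := this _ hx
  simp only [hj, if_true] at this
  exact this

/-- The three conditions on a pointed shuffle are what canonical form needs: order is kept inside
`y`, and order is kept at the vertices of `x`, where `y` is seen only through its smallest leaf,
that is, through the entry `j`. -/
lemma IsReduced.graft_relabel {m n j : ℕ} {x y : OTree X} (hj : j < m) (hx : x.IsReduced m)
    (hy : y.IsReduced n) {p : Equiv.Perm (Fin (m + n - 1))} (hp : IsPointedShuffle m n j p) :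
    ((graft n j x y).relabel (permFun p)).IsReduced (m + n - 1) := by
  have hn := hy.pos
  rw [OTree.graft_relabel]
  set g : ℕ → OTree X := fun i => if i < j then leaf (permFun p i) else
      if i = j then y.relabel fun l => permFun p (l + j) else leaf (permFun p (i + n - 1)) with hg
  have hmono : StrictMonoOn (fun l => permFun p (l + j)) {i | i ∈ y.leaves} := by
    rw [hy.setOf_leaves]
    intro a ha b hb hab
    simp only [Set.mem_Iio] at ha hb
    exact hp.2.1 ⟨by omega, by omega⟩ ⟨by omega, by omega⟩ (by omega)
  have hmin : ∀ i, (g i).minLeaf = permFun p (if i ≤ j then i else i + n - 1) := by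
    intro i
    rcases lt_trichotomy i j with hij | rfl | hij
    · simp [hg, hij, hij.le]
    · simp only [hg, lt_irrefl, if_false, if_true]
      rw [minLeaf_relabel hy.1.leaves_ne_nil hmono.monotoneOn, hy.minLeaf]
      simp
    · simp [hg, not_lt.2 hij.le, hij.ne', not_le.2 hij]
  have hinj := permFun_injOn p
  refine ⟨hx.1.bind (fun i hi => ?_) ?_, perm_range_of_nodup ?_ ?_ ?_⟩
  · simp only [hg]
    split_ifs
    · trivial
    · exact hy.1.relabel hmono
    · trivial
  · rw [hx.setOf_leaves]
    intro a ha b hb hab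
    simp only [Set.mem_Iio] at ha hb
    simp only [hmin]
    refine hp.2.2 ?_ ?_ ?_
    · simp only [Set.mem_union, Set.mem_Iic, Set.mem_Ico]; split_ifs <;> omega
    · simp only [Set.mem_union, Set.mem_Iic, Set.mem_Ico]; split_ifs <;> omega
    · split_ifs <;> omega
  · rw [leaves_bind, List.nodup_flatMap]
    refine ⟨fun i hi => ?_, ?_⟩
    · simp only [hg]
      split_ifs
      · simp [leaves]
      · rw [leaves_relabel]
        exact List.Nodup.map_on (fun a ha b hb hab => hmono.injOn ha hb hab) hy.nodup
      · simp [leaves]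
    · refine List.Pairwise.imp_of_mem ?_ hx.nodup
      intro a b ha hb hab
      -- A leaf `q` of the composite determines its position `q'` before the shuffle, and `q'`
      -- determines the leaf `i` of `x` above which `q` lies.
      have key : ∀ i ∈ x.leaves, ∀ q ∈ (g i).leaves, ∃ q', q = permFun p q' ∧ q' < m + n - 1 ∧
          i = if q' < j then q' else if q' < j + n then j else q' + 1 - n := by
        intro i hi q hq
        have hi' := hx.mem_leaves.1 hi
        rcases lt_trichotomy i j with hij | rfl | hij
        · simp only [hg, hij, if_true, leaves, List.mem_singleton] at hq
          exact ⟨i, hq, by omega, by simp [hij]⟩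
        · simp only [hg, lt_irrefl, if_false, if_true, leaves_relabel, List.mem_map] at hq
          obtain ⟨l, hl, rfl⟩ := hq
          have := hy.mem_leaves.1 hl
          exact ⟨l + i, rfl, by omega, by split_ifs <;> omega⟩
        · simp only [hg, not_lt.2 hij.le, hij.ne', if_false, leaves, List.mem_singleton] at hq
          exact ⟨i + n - 1, hq, by omega, by split_ifs <;> omega⟩
      intro q hqa hqb
      obtain ⟨q1, e1, l1, i1⟩ := key a ha q hqa
      obtain ⟨q2, e2, l2, i2⟩ := key b hb q hqb
      have : q1 = q2 := hinj l1 l2 (by rw [← e1, ← e2])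
      subst this
      exact hab (i1.trans i2.symm)
  · intro q hq
    obtain ⟨i, hi, hq⟩ := mem_leaves_bind.1 hq
    have hi' := hx.mem_leaves.1 hi
    simp only [hg] at hq
    split_ifs at hq
    · simp only [leaves, List.mem_singleton] at hq
      subst hq; exact permFun_lt p (by omega)
    · rw [leaves_relabel, List.mem_map] at hq
      obtain ⟨l, hl, rfl⟩ := hq
      have := hy.mem_leaves.1 hl
      exact permFun_lt p (by omega)
    · simp only [leaves, List.mem_singleton] at hq
      subst hq; exact permFun_lt p (by omega)
  · have := length_leaves_bind_ite (y := y) hx.nodup (hx.mem_leaves.2 hj) g (by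
      intro i
      simp only [hg]
      rcases lt_trichotomy i j with hij | rfl | hij
      · simp [hij, hij.ne, leaves]
      · simp [leaves_relabel]
      · simp [not_lt.2 hij.le, hij.ne', leaves])
    have h1 := hx.2.length_eq
    have h2 := hy.2.length_eq
    simp only [List.length_range] at h1 h2
    omega

lemma relabel_injOn {t t' : OTree X} {h : ℕ → ℕ} {s : Set ℕ} (hh : Set.InjOn h s)
    (ht : ∀ i ∈ t.leaves, i ∈ s) (ht' : ∀ i ∈ t'.leaves, i ∈ s)
    (H : t.relabel h = t'.relabel h) : t = t' := by
  have key : ∀ t : OTree X, (∀ i ∈ t.leaves, i ∈ s) →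
      (t.relabel h).relabel (Function.invFunOn h s) = t := fun t ht => by
    rw [relabel_relabel]
    exact relabel_id fun i hi => hh.leftInvOn_invFunOn (ht i hi)
  rw [← key t ht, ← key t' ht', H]

/-- Two increasing labellings with the same set of values agree. So a tree has at most one
standardization. -/
lemma IsReduced.relabel_unique {N : ℕ} {t t' : OTree X} (ht : t.IsReduced N) (ht' : t'.IsReduced N)
    {h h' : ℕ → ℕ} (hh : StrictMonoOn h (Set.Iio N)) (hh' : StrictMonoOn h' (Set.Iio N))
    (H : t.relabel h = t'.relabel h') : (∀ i < N, h i = h' i) ∧ t = t' := by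
  have key : (fun i : Fin N => h i) = fun i : Fin N => h' i := by
    refine (StrictMono.range_inj (f := fun i : Fin N => h i) (g := fun i : Fin N => h' i)
      (fun a b hab => hh a.2 b.2 hab) (fun a b hab => hh' a.2 b.2 hab)).1 ?_
    have h1 : ∀ (t : OTree X) (h : ℕ → ℕ), t.IsReduced N →
        Set.range (fun i : Fin N => h i) = {i | i ∈ (t.relabel h).leaves} := by
      intro t h ht
      ext i
      simp only [Set.mem_range, leaves_relabel, List.mem_map, Set.mem_ofPred_eq, ht.mem_leaves]
      exact ⟨fun ⟨a, ha⟩ => ⟨a, a.2, ha⟩, fun ⟨a, ha, e⟩ => ⟨⟨a, ha⟩, e⟩⟩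
    rw [h1 t h ht, h1 t' h' ht', H]
  have key' : ∀ i < N, h i = h' i := fun i hi => congrFun key ⟨i, hi⟩
  refine ⟨key', relabel_injOn hh.injOn (fun i hi => ht.mem_leaves.1 hi)
    (fun i hi => ht'.mem_leaves.1 hi) ?_⟩
  rw [H]
  exact relabel_congr fun i hi => (key' i (ht'.mem_leaves.1 hi)).symm

/-- Each leaf is renumbered by its rank `ρ` among the leaves; `f` is the inverse of `ρ`. -/
lemma IsCanonical.exists_reduced {t : OTree X} (ht : t.IsCanonical) (hn : t.leaves.Nodup) :
    ∃ (n : ℕ) (a : OTree X) (f : ℕ → ℕ), a.IsReduced n ∧ StrictMonoOn f (Set.Iio n) ∧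
      t = a.relabel f := by
  set s := t.leaves.toFinset
  set ρ : ℕ → ℕ := fun i => (s.filter (· < i)).card with hρ
  have hρm : StrictMonoOn ρ {i | i ∈ t.leaves} := by
    intro a ha b hb hab
    refine Finset.card_lt_card (Finset.ssubset_iff.2 ⟨a, by simp, fun i hi => ?_⟩)
    simp only [Finset.mem_insert, Finset.mem_filter] at hi ⊢
    rcases hi with rfl | hi
    · exact ⟨by simpa [s] using ha, hab⟩
    · exact ⟨hi.1, hi.2.trans hab⟩
  have hlt : ∀ i ∈ t.leaves, ρ i < t.leaves.length := by
    intro i hi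
    rw [← List.toFinset_card_of_nodup hn]
    refine Finset.card_lt_card (Finset.ssubset_iff.2 ⟨i, by simp, fun k hk => ?_⟩)
    simp only [Finset.mem_insert, Finset.mem_filter] at hk
    rcases hk with rfl | hk
    · simpa using hi
    · exact hk.1
  have hred : (t.relabel ρ).IsReduced t.leaves.length := by
    refine ⟨ht.relabel hρm, perm_range_of_nodup ?_ ?_ ?_⟩
    · rw [leaves_relabel]
      exact List.Nodup.map_on (fun a ha b hb hab => hρm.injOn ha hb hab) hn
    · intro i hi
      rw [leaves_relabel, List.mem_map] at hi
      obtain ⟨k, hk, rfl⟩ := hi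
      exact hlt k hk
    · simp [leaves_relabel]
  have hinv : ∀ i ∈ t.leaves, Function.invFunOn ρ {i | i ∈ t.leaves} (ρ i) = i :=
    fun i hi => hρm.injOn.leftInvOn_invFunOn hi
  have hsurj : ∀ q < t.leaves.length, ∃ i ∈ t.leaves, ρ i = q := by
    intro q hq
    have := hred.mem_leaves.2 hq
    rwa [leaves_relabel, List.mem_map] at this
  refine ⟨_, _, Function.invFunOn ρ {i | i ∈ t.leaves}, hred, ?_, ?_⟩
  · intro a ha b hb hab
    obtain ⟨a, ha', rfl⟩ := hsurj a ha
    obtain ⟨b, hb', rfl⟩ := hsurj b hb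
    rw [hinv a ha', hinv b hb']
    exact (hρm.lt_iff_lt ha' hb').1 hab
  · rw [relabel_relabel, relabel_id]
    exact hinv

/-- Substituting trees with disjoint leaves for the leaves of a tree is injective. -/
lemma bind_injective_of_disjoint {g : ℕ → OTree X} {s : Set ℕ}
    (hne : ∀ i ∈ s, (g i).leaves ≠ [])
    (hd : ∀ i ∈ s, ∀ k ∈ s, ∀ a, a ∈ (g i).leaves → a ∈ (g k).leaves → i = k)
    {t t' : OTree X} (ht : ∀ i ∈ t.leaves, i ∈ s) (ht' : ∀ i ∈ t'.leaves, i ∈ s)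
    (hn : t.leaves.Nodup) (hn' : t'.leaves.Nodup) (hc : t.IsCanonical) (hc' : t'.IsCanonical)
    (H : t.bind g = t'.bind g) : t = t' := by
  -- If `g i = t.bind g`, disjointness forces `i` to be the only leaf of `t`, and counting vertices
  -- on both sides leaves none for `t`.
  have aux : ∀ (i : ℕ) (t : OTree X), i ∈ s → (∀ k ∈ t.leaves, k ∈ s) → t.leaves.Nodup →
      t.IsCanonical → g i = t.bind g → t = leaf i := by
    intro i t hi ht hn hc H
    have hL : ∀ k ∈ t.leaves, k = i := by
      intro k hk
      obtain ⟨a, ha⟩ := List.exists_mem_of_ne_nil _ (hne k (ht k hk))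
      refine hd k (ht k hk) i hi a ha ?_
      rw [H]
      exact mem_leaves_bind.2 ⟨k, hk, ha⟩
    have hL' : t.leaves = [i] := by
      cases h : t.leaves with
      | nil => exact absurd h hc.leaves_ne_nil
      | cons a l =>
        cases l with
        | nil => rw [hL a (by simp [h])]
        | cons b l =>
          have h1 := hL a (by simp [h])
          have h2 := hL b (by simp [h])
          simp [h, h1, h2] at hn
    have hv := congrArg (vertexSum fun _ _ => 1) H
    rw [vertexSum_bind, hL'] at hv
    cases t with
    | leaf k => simpa [leaves] using hL'
    | node n x c => simp [vertexSum] at hv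
  induction t generalizing t' with
  | leaf i =>
    exact (aux i t' (ht i (by simp [leaves])) ht' hn' hc' H).symm
  | node n x c ih =>
    cases t' with
    | leaf i => exact aux i _ (ht' i (by simp [leaves])) ht hn hc H.symm
    | node n' x' c' =>
      simp only [bind, node.injEq] at H
      obtain ⟨rfl, H1, H2⟩ := H
      obtain rfl := eq_of_heq H1
      congr 1
      funext k
      exact ih k (fun i hi => ht i (mem_leaves_node.2 ⟨k, hi⟩))
        (fun i hi => ht' i (mem_leaves_node.2 ⟨k, hi⟩)) ((nodup_leaves_node hn).1 k)
        ((nodup_leaves_node hn').1 k) (hc.2.2 k) (hc'.2.2 k) (congrFun (eq_of_heq H2) k)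

end OTree

end

/-! ### The monomial order on trees with arbitrary leaf labels. -/

section
open OTree

variable {𝕜 : Type u} [Field 𝕜] {M : SigmaModule.{u, v} 𝕜} {B : HomogeneousBasis.{u, v, w} M}

/-- The extension of an order on monomials to canonical trees with arbitrary distinct leaf labels,
by order-preserving renumbering. -/
def StdLE (le : BTree B → BTree B → Prop) (t t' : BTree B) : Prop :=
  ∃ (r : ℕ) (a a' : BTree B) (f : ℕ → ℕ), a.IsReduced r ∧ a'.IsReduced r ∧
    StrictMonoOn f (Set.Iio r) ∧ t = a.relabel f ∧ t' = a'.relabel f ∧ le a a'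

namespace StdLE

variable {le : BTree B → BTree B → Prop}

lemma refl (hle : IsMonomialOrder B le) {t : BTree B} (ht : t.IsCanonical) (hn : t.leaves.Nodup) :
    StdLE le t t := by
  obtain ⟨n, a, f, ha, hf, rfl⟩ := ht.exists_reduced hn
  exact ⟨n, a, a, f, ha, ha, hf, rfl, rfl, hle.refl n a ha⟩

lemma leaves_perm {t t' : BTree B} (h : StdLE le t t') : t.leaves.Perm t'.leaves := by
  obtain ⟨r, a, a', f, ha, ha', hf, rfl, rfl, -⟩ := h
  rw [leaves_relabel, leaves_relabel]
  exact (ha.2.trans ha'.2.symm).map f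

lemma isCanonical {t t' : BTree B} (h : StdLE le t t') : t.IsCanonical ∧ t'.IsCanonical := by
  obtain ⟨r, a, a', f, ha, ha', hf, rfl, rfl, -⟩ := h
  exact ⟨ha.1.relabel (by rwa [ha.setOf_leaves]), ha'.1.relabel (by rwa [ha'.setOf_leaves])⟩

/-- The standardization is unique, and a reduced tree is its own. -/
lemma le_of_isReduced {r : ℕ} {t t' : BTree B} (h : StdLE le t t') (ht : t.IsReduced r)
    (ht' : t'.IsReduced r) : le t t' := by
  obtain ⟨r', a, a', f, ha, ha', hf, h1, h2, hl⟩ := h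
  have hr : r' = r := by
    have e1 := ha.2.length_eq
    have e2 := ht.2.length_eq
    rw [h1, leaves_relabel, List.length_map] at e2
    simp_all
  subst hr
  have hid : StrictMonoOn id (Set.Iio r') := strictMono_id.strictMonoOn _
  have e1 := ht.relabel_unique ha hid hf (by rw [← h1]; exact relabel_id fun _ _ => rfl)
  have e2 := ht'.relabel_unique ha' hid hf (by rw [← h2]; exact relabel_id fun _ _ => rfl)
  rwa [e1.2, e2.2]

/-- This is the axiom `compat` freed from numbering: the relative positions of the leaves define a
pointed shuffle, the same for both composites because related trees share their leaf labels. -/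
lemma subst (hle : IsMonomialOrder B le) {α α' β β' : BTree B} (hα : StdLE le α α')
    (hβ : StdLE le β β') (hm : β.minLeaf ∈ α.leaves)
    (hd : ∀ i ∈ α.leaves, i ∈ β.leaves → i = β.minLeaf) :
    StdLE le (α.bind fun i => if i = β.minLeaf then β else leaf i)
      (α'.bind fun i => if i = β.minLeaf then β' else leaf i) := by
  obtain ⟨m, a, a', f, ha, ha', hf, rfl, rfl, hal⟩ := hα
  obtain ⟨n, b, b', g, hb, hb', hg, rfl, rfl, hbl⟩ := hβ
  have hmin : (b.relabel g).minLeaf = g 0 := by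
    rw [minLeaf_relabel hb.1.leaves_ne_nil (by rw [hb.setOf_leaves]; exact hg.monotoneOn),
      hb.minLeaf]
  rw [hmin] at hm hd ⊢
  rw [leaves_relabel, List.mem_map] at hm
  obtain ⟨j, hj, hfj⟩ := hm
  have hjm := ha.mem_leaves.1 hj
  obtain ⟨p, h, hp, hh, h1, h2, h3⟩ := exists_pointedShuffle hjm hb.pos f g hf hg hfj (by
    intro i hi hij l hl e
    have := hd (f i) (by rw [leaves_relabel]; exact List.mem_map_of_mem (ha.mem_leaves.2 hi))
      (by rw [e, leaves_relabel]; exact List.mem_map_of_mem (hb.mem_leaves.2 hl))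
    exact hij (hf.injOn hi hjm (this.trans hfj.symm)))
  have key : ∀ a b : BTree B, a.IsReduced m → b.IsReduced n →
      (a.relabel f).bind (fun i => if i = g 0 then b.relabel g else leaf i) =
        ((graft n j a b).relabel (permFun p)).relabel h := by
    intro a b ha hb
    rw [graft_relabel_relabel (fun i hi => ha.mem_leaves.1 hi) (fun i hi => hb.mem_leaves.1 hi)
      h1 h2 h3, relabel_bind]
    refine bind_congr fun i hi => ?_
    have : f i = g 0 ↔ i = j := by
      rw [← hfj]
      exact ⟨fun e => hf.injOn (ha.mem_leaves.1 hi) hjm e, fun e => by rw [e]⟩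
    simp [this]
  exact ⟨_, _, _, h, ha.graft_relabel hjm hb hp, ha'.graft_relabel hjm hb' hp, hh,
    key a b ha hb, key a' b' ha' hb', hle.compat m n j a a' b b' hjm ha ha' hb hb' hal hbl p hp⟩

/-- Trees are substituted one at a time by `subst`, so monotonicity holds in all arguments
simultaneously. -/
lemma bind (hle : IsMonomialOrder B le) {N : ℕ} {z z' : BTree B} (hz : z.IsReduced N)
    (hz' : z'.IsReduced N) (h : le z z') {g g' : ℕ → BTree B}
    (hg : ∀ k < N, StdLE le (g k) (g' k))
    (hm : StrictMonoOn (fun k => (g k).minLeaf) (Set.Iio N))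
    (hd : ∀ i < N, ∀ k < N, ∀ a, a ∈ (g i).leaves → a ∈ (g k).leaves → i = k) :
    StdLE le (z.bind g) (z'.bind g') := by
  have hmem : ∀ i < N, (g i).minLeaf ∈ (g i).leaves := fun i hi =>
    minLeaf_mem (hg i hi).isCanonical.1.leaves_ne_nil
  -- Until `g k` is substituted, its place is held by a leaf that bears its smallest label. The
  -- second tree uses the same placeholders, since `g k` and `g' k` have the same leaves.
  have key : ∀ k ≤ N,
      StdLE le (z.bind fun i => if i < k then g i else leaf (g i).minLeaf)
        (z'.bind fun i => if i < k then g' i else leaf (g i).minLeaf) := by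
    intro k hk
    induction k with
    | zero =>
      refine ⟨N, z, z', fun k => (g k).minLeaf, hz, hz', hm, ?_, ?_, h⟩ <;> simp [OTree.relabel]
    | succ k ih =>
      have hkN : k < N := hk
      have hs := (ih hkN.le).subst hle (hg k hkN) ?_ ?_
      · have e : ∀ (z : BTree B) (g' : ℕ → BTree B), z.IsReduced N →
            (∀ i < N, (g i).leaves.Perm (g' i).leaves) →
            ((z.bind fun i => if i < k then g' i else leaf (g i).minLeaf).bind fun i =>
              if i = (g k).minLeaf then g' k else leaf i) =
            z.bind fun i => if i < k + 1 then g' i else leaf (g i).minLeaf := by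
          intro z g' hz hp
          rw [bind_bind]
          refine bind_congr fun i hi => ?_
          have hiN := hz.mem_leaves.1 hi
          rcases lt_trichotomy i k with hik | rfl | hik
          · simp only [hik, if_true, show i < k + 1 by omega]
            conv_rhs => rw [← bind_leaf (g' i)]
            refine bind_congr fun a ha => ?_
            rw [if_neg]
            rintro rfl
            exact hik.ne (hd i hiN k hkN _ ((hp i hiN).mem_iff.2 ha) (hmem k hkN))
          · simp [OTree.bind]
          · have : ¬ i < k + 1 := by omega
            simp only [not_lt.2 hik.le, this, if_false, OTree.bind]
            rw [if_neg]
            exact (hm hkN hiN hik).ne'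
        rwa [e z g hz fun _ _ => .refl _, e z' g' hz' fun i hi => (hg i hi).leaves_perm] at hs
      · exact mem_leaves_bind.2 ⟨k, hz.mem_leaves.2 hkN, by simp [leaves]⟩
      · intro a ha hak
        obtain ⟨i, hi, ha⟩ := mem_leaves_bind.1 ha
        have hiN := hz.mem_leaves.1 hi
        split_ifs at ha with hik
        · exact absurd (hd i hiN k hkN a ha hak) hik.ne
        · simp only [leaves, List.mem_singleton] at ha
          subst ha
          rw [hd i hiN k hkN _ (hmem i hiN) hak]
  have := key N le_rfl
  have e : ∀ (z : BTree B) (g' : ℕ → BTree B), z.IsReduced N →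
      (z.bind fun i => if i < N then g' i else leaf (g i).minLeaf) = z.bind g' :=
    fun z g' hz => bind_congr fun i hi => by simp [hz.mem_leaves.1 hi]
  rwa [e z g hz, e z' g' hz'] at this

end StdLE

end

/-! ### Bigrading of the free operad and of the operadic ideal. -/

section
open OTree

variable {𝕜 : Type u} [Field 𝕜] {M : SigmaModule.{u, v} 𝕜} (B : HomogeneousBasis.{u, v, w} M)

/-- The part of `x` on basis elements of degree other than `d` lies both in the piece of degree `d`
and in the sum of the other pieces, and these are independent. -/
lemma HomogeneousBasis.deg_eq {n : ℕ} {d : ℤ} {x : M.carrier n} (hx : x ∈ M.piece n d) {b : B.ι n}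
    (hb : b ∈ ((B.basis n).repr x).support) : B.deg n b = d := by
  by_contra hne
  set a := (B.basis n).repr x with ha
  have hsum : x = (a.sum fun b c => c • B.basis n b) := by
    conv_lhs => rw [← (B.basis n).linearCombination_repr x]
    rfl
  set y := ∑ b ∈ a.support.filter (fun b => B.deg n b = d), a b • B.basis n b with hy
  set z := ∑ b ∈ a.support.filter (fun b => ¬ B.deg n b = d), a b • B.basis n b with hz
  have hyz : x = y + z := by
    rw [hsum, hy, hz, Finset.sum_filter_add_sum_filter_not]; rfl
  have hyd : y ∈ M.piece n d := Submodule.sum_mem _ fun b hb => by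
    rw [← (Finset.mem_filter.1 hb).2]
    exact Submodule.smul_mem _ _ (B.basis_mem n b)
  have hzd : z ∈ M.piece n d := by
    have : z = x - y := by rw [hyz]; abel
    rw [this]
    exact Submodule.sub_mem _ hx hyd
  have hz' : z ∈ ⨆ e, ⨆ (_ : e ≠ d), M.piece n e := Submodule.sum_mem _ fun b hb => by
    refine Submodule.smul_mem _ _ ?_
    exact (le_iSup₂_of_le (f := fun e (_ : e ≠ d) => M.piece n e) (B.deg n b)
      (Finset.mem_filter.1 hb).2 le_rfl) (B.basis_mem n b)
  have hz0 : z = 0 := Submodule.disjoint_def.1 ((M.isInternal n).submodule_iSupIndep d) z hzd hz'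
  have hz1 : (B.basis n).repr z b = a b := by
    rw [hz, map_sum, Finsupp.finsetSum_apply]
    simp only [map_smul, Module.Basis.repr_self, Finsupp.smul_apply, smul_eq_mul]
    rw [Finset.sum_eq_single b]
    · simp
    · intro b' _ h
      simp [Finsupp.single_eq_of_ne h.symm]
    · intro h
      exact absurd (Finset.mem_filter.2 ⟨hb, hne⟩) h
  rw [hz0] at hz1
  simp only [map_zero, Finsupp.coe_zero, Pi.zero_apply] at hz1
  exact Finsupp.mem_support_iff.1 hb hz1.symm

/-- The weight and the degree of a monomial. -/
def biweight (t : BTree B) : ℤ × ℤ := t.vertexSum fun n b => (1, B.deg n b)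

lemma OTree.map_vertexSum {X : ℕ → Type*} {A A' : Type*} [AddCommMonoid A] [AddCommMonoid A']
    (φ : A →+ A') (f : ∀ n, X n → A) (t : OTree X) :
    φ (t.vertexSum f) = t.vertexSum fun n x => φ (f n x) := by
  induction t with
  | leaf i => simp [vertexSum]
  | node n x c ih => simp [vertexSum, ih]

lemma biweight_eq (t : BTree B) : biweight B t = ((t.numVertices : ℤ), BTree.deg B t) := by
  have h1 := map_vertexSum (AddMonoidHom.fst ℤ ℤ) (fun n b => ((1 : ℤ), B.deg n b)) t
  have h2 := map_vertexSum (AddMonoidHom.snd ℤ ℤ) (fun n b => ((1 : ℤ), B.deg n b)) t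
  have h3 := map_vertexSum (Nat.castAddMonoidHom ℤ) (fun _ _ => 1) t
  simp only [AddMonoidHom.coe_fst, AddMonoidHom.coe_snd, Nat.coe_castAddMonoidHom,
    Nat.cast_one] at h1 h2 h3
  refine Prod.ext ?_ ?_
  · simp only [biweight, numVertices, h1, h3]
  · simp only [biweight, h2, BTree.deg]

lemma sum_map_ite_eq {A : Type*} [AddCommMonoid A] (l : List ℕ) (i : ℕ) (a : A) :
    (l.map fun k => if k = i then a else 0).sum = l.count i • a := by
  induction l with
  | nil => simp
  | cons k l ih =>
    rw [List.map_cons, List.sum_cons, ih, List.count_cons]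
    by_cases hk : k = i <;> simp [hk, add_smul, add_comm]

lemma OTree.vertexSum_graft {X : ℕ → Type*} {A : Type*} [AddCommMonoid A] (f : ∀ n, X n → A)
    {n i : ℕ} {α β : OTree X} (hα : α.leaves.Nodup) (hi : i ∈ α.leaves) :
    (graft n i α β).vertexSum f = α.vertexSum f + β.vertexSum f := by
  rw [graft, vertexSum_bind]
  congr 1
  have : ∀ j, (if j < i then (leaf j : OTree X) else if j = i then β.relabel (· + i)
      else leaf (j + n - 1)).vertexSum f = if j = i then β.vertexSum f else 0 := by
    intro j
    rcases lt_trichotomy j i with h | rfl | h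
    · simp [h, h.ne, vertexSum]
    · simp
    · simp [not_lt.2 h.le, h.ne', vertexSum]
  simp only [this]
  rw [sum_map_ite_eq, List.count_eq_one_of_mem hα hi, one_smul]

lemma OTree.IsReduced.graft {X : ℕ → Type*} {m n j : ℕ} {x y : OTree X} (hj : j < m)
    (hx : x.IsReduced m) (hy : y.IsReduced n) : (graft n j x y).IsReduced (m + n - 1) := by
  have h1 : ∀ i, permFun (1 : Equiv.Perm (Fin (m + n - 1))) i = i := fun i => by
    simp [permFun]
  have h2 : permFun (1 : Equiv.Perm (Fin (m + n - 1))) = id := funext h1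
  have hp : IsPointedShuffle m n j 1 := by
    refine ⟨h1 j, ?_, ?_⟩ <;> rw [h2] <;> exact strictMono_id.strictMonoOn _
  have := hx.graft_relabel hj hy hp
  rwa [h2, relabel_id (f := id) fun _ _ => rfl] at this

variable {B}

lemma exists_mem_support_of_mem_support_sum {ι α R : Type*} [AddCommMonoid R] {s : Finset ι}
    {f : ι → α →₀ R} {a : α} (h : a ∈ (∑ i ∈ s, f i).support) : ∃ i ∈ s, a ∈ (f i).support := by
  classical
  simpa using Finsupp.support_finsetSum h

lemma mem_support_nodeTensor {n : ℕ} {x : M.carrier n} {z : Fin n → BTensor B} {t : BTree B}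
    (h : t ∈ (nodeTensor B n x z).support) :
    ∃ b ∈ ((B.basis n).repr x).support, ∃ c : Fin n → BTree B, (∀ k, c k ∈ (z k).support) ∧
      t = node n b c := by
  obtain ⟨b, hb, h⟩ := exists_mem_support_of_mem_support_sum h
  obtain ⟨c, hc, h⟩ := exists_mem_support_of_mem_support_sum h
  exact ⟨b, hb, c, Fintype.mem_piFinset.1 hc,
    Finset.mem_singleton.1 (Finsupp.support_single_subset h)⟩

/-- Sorting the entries restores the canonical form, and the action on the label of a vertex
preserves its degree. So the action of the symmetric groups respects both arity and biweight. -/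
lemma mem_support_renumberTree {f : ℕ → ℕ} {t : BTree B} (hc : t.IsCanonical)
    (hn : t.leaves.Nodup) (hf : Set.InjOn f {i | i ∈ t.leaves}) {t' : BTree B}
    (h : t' ∈ (renumberTree B f t).support) :
    t'.IsCanonical ∧ t'.leaves.Perm (t.leaves.map f) ∧ biweight B t' = biweight B t := by
  induction t generalizing t' with
  | leaf i =>
    have := Finset.mem_singleton.1 (Finsupp.support_single_subset h)
    subst this
    exact ⟨trivial, by simp [leaves], rfl⟩
  | node n b c ih =>
    simp only [renumberTree] at h
    set σ : Equiv.Perm (Fin n) := Tuple.sort fun k => ((c k).relabel f).minLeaf with hσ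
    obtain ⟨b', hb', d, hd, rfl⟩ := mem_support_nodeTensor (Finsupp.support_smul h)
    have hmem : ∀ k, ∀ i ∈ (c k).leaves, i ∈ (node n b c).leaves := fun k i hi =>
      mem_leaves_node.2 ⟨k, hi⟩
    have IH := fun k => ih (σ k) (hc.2.2 _) ((nodup_leaves_node hn).1 _) (hf.mono (hmem _)) (hd k)
    have hmin : ∀ k, (d k).minLeaf = ((c (σ k)).relabel f).minLeaf := fun k =>
      minLeaf_eq_of_perm (by rw [leaves_relabel]; exact (IH k).2.1)
    have hinj : Function.Injective fun k => ((c k).relabel f).minLeaf := by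
      intro k k' hkk'
      have hne : ∀ k, ((c k).relabel f).leaves ≠ [] := fun k => by
        rw [leaves_relabel]; simpa using (hc.2.2 k).leaves_ne_nil
      have h1 := minLeaf_mem (hne k)
      have h2 := minLeaf_mem (hne k')
      dsimp only at hkk'
      rw [← hkk'] at h2
      rw [leaves_relabel, List.mem_map] at h1 h2
      obtain ⟨i, hi, e⟩ := h1
      obtain ⟨i', hi', e'⟩ := h2
      have : i = i' := hf (hmem _ _ hi) (hmem _ _ hi') (e.trans e'.symm)
      subst this
      exact (nodup_leaves_node hn).2 _ _ _ hi hi'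
    refine ⟨⟨hc.1, ?_, fun k => (IH k).1⟩, ?_, ?_⟩
    · have : StrictMono ((fun k => ((c k).relabel f).minLeaf) ∘ σ) :=
        (Tuple.monotone_sort _).strictMono_of_injective (hinj.comp σ.injective)
      intro k k' hkk'
      simp only [hmin]
      exact this hkk'
    · have e : (node n b c).leaves.map f = (node n b fun k => (c k).relabel f).leaves := by
        rw [← relabel_node, leaves_relabel]
      rw [e]
      have h1 : (node n b' d).leaves.Perm (node n b fun k => (c (σ k)).relabel f).leaves := by
        simp only [leaves]
        have : ∀ {n : ℕ} (F G : Fin n → List ℕ), (∀ k, (F k).Perm (G k)) →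
            (List.ofFn F).flatten.Perm (List.ofFn G).flatten := by
          intro n F G H
          induction n with
          | zero => simp
          | succ n ih => simpa using (H 0).append (ih _ _ fun k => H k.succ)
        exact this _ _ fun k => by rw [leaves_relabel]; exact (IH k).2.1
      exact h1.trans (leaves_node_perm (Equiv.Perm.ofFn_comp_perm σ fun k => (c k).relabel f))
    · have hdeg : B.deg n b' = B.deg n b :=
        B.deg_eq (M.action_mem n _ _ _ (B.basis_mem n b)) hb'
      have : ∀ k, biweight B (d k) = biweight B (c (σ k)) := fun k => (IH k).2.2
      simp only [biweight] at this
      simp only [biweight, vertexSum, hdeg, this]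
      congr 1
      exact Equiv.sum_comp σ fun k => (c k).vertexSum fun n b => ((1 : ℤ), B.deg n b)

lemma symAction_eq {r : ℕ} (p : Equiv.Perm (Fin r)) (x : BTensor B) :
    symAction B p x = Finsupp.linearCombination 𝕜 (renumberTree B (permFun p)) x := rfl

lemma mem_support_partialComp {n i : ℕ} {x y : BTensor B} {t : BTree B}
    (h : t ∈ (partialComp B n i x y).support) :
    ∃ α ∈ x.support, ∃ β ∈ y.support, t = graft n i α β := by
  obtain ⟨α, hα, h⟩ := exists_mem_support_of_mem_support_sum h
  obtain ⟨β, hβ, h⟩ := exists_mem_support_of_mem_support_sum h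
  exact ⟨α, hα, β, hβ, Finset.mem_singleton.1 (Finsupp.support_single_subset h)⟩

lemma partialComp_mem {m n i : ℕ} (hi : i < m) {x y : BTensor B} (hx : x ∈ freeOperad B m)
    (hy : y ∈ freeOperad B n) : partialComp B n i x y ∈ freeOperad B (m + n - 1) := by
  intro t ht
  obtain ⟨α, hα, β, hβ, rfl⟩ := mem_support_partialComp ht
  exact (hx hα).graft hi (hy hβ)

lemma renumberTree_isReduced {r : ℕ} (p : Equiv.Perm (Fin r)) {t t' : BTree B}
    (ht : t.IsReduced r) (h : t' ∈ (renumberTree B (permFun p) t).support) :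
    t'.IsReduced r ∧ biweight B t' = biweight B t := by
  obtain ⟨h1, h2, h3⟩ := mem_support_renumberTree ht.1 ht.nodup
    (by rw [ht.setOf_leaves]; exact permFun_injOn p) h
  refine ⟨⟨h1, h2.trans ?_⟩, h3⟩
  refine perm_range_of_nodup ?_ ?_ ?_
  · exact List.Nodup.map_on (fun a ha b hb hab =>
      permFun_injOn p (ht.mem_leaves.1 ha) (ht.mem_leaves.1 hb) hab) ht.nodup
  · intro i hi
    obtain ⟨k, hk, rfl⟩ := List.mem_map.1 hi
    exact permFun_lt p (ht.mem_leaves.1 hk)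
  · simpa using ht.2.length_eq

lemma symAction_mem {r : ℕ} (p : Equiv.Perm (Fin r)) {x : BTensor B} (hx : x ∈ freeOperad B r) :
    symAction B p x ∈ freeOperad B r := by
  intro t ht
  obtain ⟨α, hα, h⟩ := exists_mem_support_of_mem_support_sum ht
  exact (renumberTree_isReduced p (hx hα) (Finsupp.support_smul h)).1

lemma InIdeal.mem_freeOperad {R : ℕ → Set (BTensor B)} (hR : ∀ r, ∀ x ∈ R r, x ∈ freeOperad B r)
    {r : ℕ} {x : BTensor B} (h : InIdeal B R r x) : x ∈ freeOperad B r := by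
  induction h with
  | of h => exact hR _ _ h
  | zero r => exact Submodule.zero_mem _
  | add _ _ h1 h2 => exact Submodule.add_mem _ h1 h2
  | smul a _ h => exact Submodule.smul_mem _ a h
  | act p _ h => exact symAction_mem p h
  | comp_left hi _ hy h => exact partialComp_mem hi h hy
  | comp_right hi hx _ h => exact partialComp_mem hi hx h

lemma filter_symAction {r : ℕ} (p : Equiv.Perm (Fin r)) {x : BTensor B} (hx : x ∈ freeOperad B r)
    (k : ℤ × ℤ) : (symAction B p x).filter (fun t => biweight B t = k) =
      symAction B p (x.filter fun t => biweight B t = k) := by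
  classical
  have h1 : (symAction B p x).filter (fun t => biweight B t = k) = ∑ t ∈ x.support,
      (x t • renumberTree B (permFun p) t).filter (fun t => biweight B t = k) :=
    map_sum (Finsupp.filterAddHom (M := 𝕜) fun t => biweight B t = k) _ _
  rw [h1, symAction, Finsupp.sum_filter_index, Finsupp.support_filter, Finset.sum_filter]
  refine Finset.sum_congr rfl fun t ht => ?_
  have hd : ∀ t' ∈ (x t • renumberTree B (permFun p) t).support,
      biweight B t' = biweight B t := fun t' ht' =>
    (renumberTree_isReduced p (hx ht) (Finsupp.support_smul ht')).2
  split_ifs with hk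
  · rw [Finsupp.filter_eq_self_iff]
    intro t' ht'
    rw [hd t' (Finsupp.mem_support_iff.2 ht'), hk]
  · rw [Finsupp.filter_eq_zero_iff]
    intro t' ht'
    by_contra h0
    exact hk ((hd t' (Finsupp.mem_support_iff.2 h0)).symm.trans ht')

lemma partialComp_eq_sum (n i : ℕ) (x y : BTensor B) : partialComp B n i x y =
    ∑ α ∈ x.support, ∑ β ∈ y.support, Finsupp.single (graft n i α β)
      (sgn 𝕜 (BTree.deg B β * BTree.degAfter B i α) * (x α * y β)) := rfl

lemma partialComp_single_right (n i : ℕ) (x : BTensor B) (β : BTree B) (b : 𝕜) :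
    partialComp B n i x (Finsupp.single β b) = ∑ α ∈ x.support, Finsupp.single (graft n i α β)
      (sgn 𝕜 (BTree.deg B β * BTree.degAfter B i α) * (x α * b)) := by
  rw [partialComp]
  exact Finset.sum_congr rfl fun α _ => Finsupp.sum_single_index (by simp)

lemma partialComp_single_left (n i : ℕ) (y : BTensor B) (α : BTree B) (a : 𝕜) :
    partialComp B n i (Finsupp.single α a) y = ∑ β ∈ y.support, Finsupp.single (graft n i α β)
      (sgn 𝕜 (BTree.deg B β * BTree.degAfter B i α) * (a * y β)) := by
  rw [partialComp]
  exact Finsupp.sum_single_index (by simp)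

lemma filter_partialComp {m n i : ℕ} (hi : i < m) {x y : BTensor B} (hx : x ∈ freeOperad B m)
    (k : ℤ × ℤ) : (partialComp B n i x y).filter (fun t => biweight B t = k) =
      ∑ α ∈ x.support, ∑ β ∈ y.support, if biweight B α + biweight B β = k then
        Finsupp.single (graft n i α β)
          (sgn 𝕜 (BTree.deg B β * BTree.degAfter B i α) * (x α * y β)) else 0 := by
  rw [partialComp_eq_sum]
  refine (map_sum (Finsupp.filterAddHom (M := 𝕜) fun t => biweight B t = k) _ _).trans ?_
  refine Finset.sum_congr rfl fun α hα => ?_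
  refine (map_sum (Finsupp.filterAddHom (M := 𝕜) fun t => biweight B t = k) _ _).trans ?_
  refine Finset.sum_congr rfl fun β hβ => ?_
  have h : biweight B (graft n i α β) = biweight B α + biweight B β :=
    vertexSum_graft _ (hx hα).nodup ((hx hα).mem_leaves.2 hi)
  change Finsupp.filter _ _ = _
  split_ifs with hk
  · exact Finsupp.filter_single_of_pos _ (h.trans hk)
  · exact Finsupp.filter_single_of_neg _ (h ▸ hk)

lemma operadIdeal_sum_mem {R : ℕ → Set (BTensor B)} {r : ℕ} {ι : Type*} {s : Finset ι}
    {f : ι → BTensor B} (h : ∀ i ∈ s, InIdeal B R r (f i)) : InIdeal B R r (∑ i ∈ s, f i) :=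
  (operadIdeal B R r).sum_mem h

/-- An ideal generated by homogeneous elements contains the homogeneous components of its elements.
This matters twice: the expansions in the PBW axiom are not assumed homogeneous, and the signs of
the differential are constant only on components of fixed degree. -/
lemma InIdeal.filter {R : ℕ → Set (BTensor B)} (hR : IsQuadratic B R) {r : ℕ} {x : BTensor B}
    (h : InIdeal B R r x) (k : ℤ × ℤ) :
    InIdeal B R r (x.filter fun t => biweight B t = k) := by
  classical
  have hR' : ∀ r, ∀ x ∈ R r, x ∈ freeOperad B r := fun r x hx t ht => ((hR r x hx).1 ht).1
  induction h generalizing k with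
  | @of r x h =>
    obtain ⟨h1, d, h2⟩ := hR r x h
    have h3 : ∀ t ∈ x.support, biweight B t = (2, d) := fun t ht => by
      rw [biweight_eq, h2 t ht, (h1 ht).2]; rfl
    by_cases hk : k = (2, d)
    · rw [(Finsupp.filter_eq_self_iff _ _).2]
      · exact .of h
      · intro t ht
        rw [h3 t (Finsupp.mem_support_iff.2 ht), hk]
    · rw [(Finsupp.filter_eq_zero_iff _ _).2]
      · exact .zero r
      · intro t ht
        by_contra h0
        exact hk (ht.symm.trans (h3 t (Finsupp.mem_support_iff.2 h0)))
  | zero r => rw [Finsupp.filter_zero]; exact .zero r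
  | add _ _ h1 h2 => rw [Finsupp.filter_add]; exact (h1 k).add (h2 k)
  | smul a _ h => rw [Finsupp.filter_smul]; exact (h k).smul a
  | act p h ih =>
    rw [filter_symAction p (h.mem_freeOperad hR')]
    exact (ih k).act p
  | @comp_left m n i x y hi hx hy ih =>
    rw [filter_partialComp hi (hx.mem_freeOperad hR'), Finset.sum_comm]
    -- For a fixed monomial `β` of `y`, the component of biweight `k` of the product comes from the
    -- component of `x` of biweight `k - biweight B β`.
    refine operadIdeal_sum_mem fun β hβ => ?_
    have e := (ih (k - biweight B β)).comp_left hi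
      (Finsupp.single_mem_supported 𝕜 (y β) (hy hβ) : Finsupp.single β (y β) ∈ freeOperad B n)
    rw [partialComp_single_right, Finsupp.support_filter, Finset.sum_filter] at e
    convert e using 1
    refine Finset.sum_congr rfl fun α hα => ?_
    by_cases h : biweight B α + biweight B β = k
    · have h' : biweight B α = k - biweight B β := by rw [← h]; abel
      rw [if_pos h, if_pos h', Finsupp.filter_apply_pos (fun t => biweight B t = _) _ h']
    · have h' : ¬ biweight B α = k - biweight B β := fun h' => h (by rw [h']; abel)
      rw [if_neg h, if_neg h']
  | @comp_right m n i x y hi hx hy ih =>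
    rw [filter_partialComp hi hx]
    refine operadIdeal_sum_mem fun α hα => ?_
    have e := (ih (k - biweight B α)).comp_right hi
      (Finsupp.single_mem_supported 𝕜 (x α) (hx hα) : Finsupp.single α (x α) ∈ freeOperad B m)
    rw [partialComp_single_left, Finsupp.support_filter, Finset.sum_filter] at e
    convert e using 1
    refine Finset.sum_congr rfl fun β hβ => ?_
    by_cases h : biweight B α + biweight B β = k
    · have h' : biweight B β = k - biweight B α := by rw [← h]; abel
      rw [if_pos h, if_pos h', Finsupp.filter_apply_pos (fun t => biweight B t = _) _ h']
    · have h' : ¬ biweight B β = k - biweight B α := fun h' => h (by rw [h']; abel)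
      rw [if_neg h, if_neg h']

lemma sgn_zero : sgn 𝕜 0 = 1 := by simp [sgn]

lemma koszulExponent_one {n : ℕ} (d : Fin n → ℤ) : koszulExponent 1 d = 0 := by
  refine Finset.sum_eq_zero fun a _ => Finset.sum_eq_zero fun b _ => if_neg ?_
  rintro ⟨h1, h2⟩
  exact lt_asymm h1 h2

lemma nodeTensor_single (n : ℕ) (b : B.ι n) (c : Fin n → BTree B) :
    nodeTensor B n (B.basis n b) (fun k => Finsupp.single (c k) 1) =
      Finsupp.single (node n b c) 1 := by
  have h1 : ((B.basis n).repr (B.basis n b)).support = {b} := by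
    rw [Module.Basis.repr_self]; exact Finsupp.support_single _ one_ne_zero
  have h2 : (fun k => (Finsupp.single (c k) (1 : 𝕜)).support) = fun k => {c k} :=
    funext fun k => Finsupp.support_single _ one_ne_zero
  rw [nodeTensor, h1, Finset.sum_singleton, h2, Fintype.piFinset_singleton, Finset.sum_singleton]
  simp

/-- When the relabelled tree is already canonical every sorting permutation is the identity, so
neither a Koszul sign nor an action on `M` occurs. This applies to composites along pointed
shuffles. -/
lemma renumberTree_of_isCanonical {f : ℕ → ℕ} {t : BTree B} (h : (t.relabel f).IsCanonical) :
    renumberTree B f t = Finsupp.single (t.relabel f) 1 := by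
  induction t with
  | leaf i => rfl
  | node n b c ih =>
    have hσ : (Tuple.sort fun k => ((c k).relabel f).minLeaf) = 1 := by
      rw [Tuple.sort_eq_refl_iff_monotone.2]
      · rfl
      · exact h.2.1.monotone
    have hk : ∀ k, renumberTree B f (c k) = Finsupp.single ((c k).relabel f) 1 := fun k =>
      ih k (h.2.2 k)
    simp only [renumberTree, hσ, koszulExponent_one, sgn_zero, one_smul, inv_one, map_one,
      Module.End.one_apply, Equiv.Perm.coe_one, id, hk]
    rw [nodeTensor_single, relabel_node]

/-- The operadic ideal is stable under composition on the right with a monomial, along pointed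
shuffles. -/
lemma InIdeal.shuffle_left {R : ℕ → Set (BTensor B)}
    (hR : ∀ r, ∀ x ∈ R r, x ∈ freeOperad B r) {m n i : ℕ} (hi : i < m) {x : BTensor B}
    (hx : InIdeal B R m x) {y : BTree B} (hy : y.IsReduced n) {p : Equiv.Perm (Fin (m + n - 1))}
    (hp : IsPointedShuffle m n i p) :
    InIdeal B R (m + n - 1) (∑ t ∈ x.support, Finsupp.single ((graft n i t y).relabel (permFun p))
      (sgn 𝕜 (BTree.deg B y * BTree.degAfter B i t) * x t)) := by
  have h := (hx.comp_left hi (Finsupp.single_mem_supported 𝕜 (1 : 𝕜) hy :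
    Finsupp.single y 1 ∈ freeOperad B n)).act p
  rw [partialComp_single_right, symAction_eq, map_sum] at h
  convert h using 1
  refine Finset.sum_congr rfl fun t ht => ?_
  rw [Finsupp.linearCombination_single, renumberTree_of_isCanonical
    ((hx.mem_freeOperad hR ht).graft_relabel hi hy hp).1]
  simp

/-- The operadic ideal is stable under composition on the left with a monomial, along pointed
shuffles. -/
lemma InIdeal.shuffle_right {R : ℕ → Set (BTensor B)}
    (hR : ∀ r, ∀ x ∈ R r, x ∈ freeOperad B r) {m n i : ℕ} (hi : i < m) {x : BTensor B}
    (hx : InIdeal B R n x) {y : BTree B} (hy : y.IsReduced m) {p : Equiv.Perm (Fin (m + n - 1))}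
    (hp : IsPointedShuffle m n i p) :
    InIdeal B R (m + n - 1) (∑ t ∈ x.support, Finsupp.single ((graft n i y t).relabel (permFun p))
      (sgn 𝕜 (BTree.deg B t * BTree.degAfter B i y) * x t)) := by
  have h := (hx.comp_right hi (Finsupp.single_mem_supported 𝕜 (1 : 𝕜) hy :
    Finsupp.single y 1 ∈ freeOperad B m)).act p
  rw [partialComp_single_left, symAction_eq, map_sum] at h
  convert h using 1
  refine Finset.sum_congr rfl fun t ht => ?_
  rw [Finsupp.linearCombination_single, renumberTree_of_isCanonical
    (hy.graft_relabel hi (hx.mem_freeOperad hR ht) hp).1]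
  simp

end

/-! ### Marked words: encoding treewise tensors by their expansions. -/

section
open OTree

variable {𝕜 : Type u} [Field 𝕜] {M : SigmaModule.{u, v} 𝕜} {B : HomogeneousBasis.{u, v, w} M}

/-- The `i`-th entry of a vertex. -/
def childAt {X : ℕ → Type*} {n : ℕ} (c : Fin n → OTree X) (i : ℕ) : OTree X :=
  if h : i < n then c ⟨i, h⟩ else leaf i

@[simp] lemma childAt_val {X : ℕ → Type*} {n : ℕ} (c : Fin n → OTree X) (i : Fin n) :
    childAt c i = c i := by simp [childAt]

lemma childAt_of_lt {X : ℕ → Type*} {n : ℕ} (c : Fin n → OTree X) {i : ℕ} (h : i < n) :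
    childAt c i = c ⟨i, h⟩ := by simp [childAt, h]

lemma flatMap_ofFn {X : ℕ → Type*} {β : Type*} {n : ℕ} (c : Fin n → OTree X) (F : OTree X → List β) :
    (List.ofFn c).flatMap F = (List.range n).flatMap fun i => F (childAt c i) := by
  rw [List.ofFn_eq_map, ← List.map_coe_finRange_eq_range, List.flatMap_map, List.flatMap_map]
  simp

/-- Words whose vertices carry a mark. -/
abbrev MarkedWord (B : HomogeneousBasis.{u, v, w} M) : Type w :=
  List (((Σ n, B.ι n) × Bool) ⊕ ℕ)

/-- Mark every vertex of a word, and substitute `h i` for the leaf `i`. -/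
def markWord (h : ℕ → MarkedWord B) (l : List ((Σ n, B.ι n) ⊕ ℕ)) : MarkedWord B :=
  l.flatMap (Sum.elim (fun u => [.inl (u, true)]) h)

/-- Remove the mark of the first vertex of a word. -/
def unmarkHead : MarkedWord B → MarkedWord B
  | .inl (u, _) :: l => .inl (u, false) :: l
  | l => l

/-- The word of the tree obtained by substituting the labels for the vertices. A vertex is marked if
it is not the root vertex of a label. -/
def markedWord : BarTree B → MarkedWord B
  | leaf i => [.inr i]
  | node n x c => unmarkHead (markWord
      (fun i => if h : i < n then markedWord (c ⟨i, h⟩) else [.inr i]) x.word)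

/-- Substitute the labels for the vertices. -/
def expand : BarTree B → BTree B
  | leaf i => leaf i
  | node n x c => x.bind fun i => if h : i < n then expand (c ⟨i, h⟩) else leaf i

lemma markedWord_node {n : ℕ} (x : BTree B) (c : Fin n → BarTree B) :
    markedWord (node n x c) = unmarkHead (markWord (fun i => markedWord (childAt c i)) x.word) := by
  rw [markedWord]
  congr 2
  funext i
  by_cases h : i < n <;> simp [childAt, h, markedWord]

lemma expand_node {n : ℕ} (x : BTree B) (c : Fin n → BarTree B) :
    expand (node n x c) = x.bind fun i => expand (childAt c i) := by
  rw [expand]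
  congr 1
  funext i
  by_cases h : i < n <;> simp [childAt, h, expand]

@[simp] lemma markWord_nil (h : ℕ → MarkedWord B) : markWord h [] = [] := rfl
@[simp] lemma markWord_inl (h : ℕ → MarkedWord B) (u : Σ n, B.ι n) (l) :
    markWord h (.inl u :: l) = .inl (u, true) :: markWord h l := rfl
@[simp] lemma markWord_inr (h : ℕ → MarkedWord B) (i : ℕ) (l) :
    markWord h (.inr i :: l) = h i ++ markWord h l := rfl
@[simp] lemma markWord_append (h : ℕ → MarkedWord B) (l l') :
    markWord h (l ++ l') = markWord h l ++ markWord h l' := List.flatMap_append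

lemma markWord_flatten (h : ℕ → MarkedWord B) (L) :
    markWord h (List.flatten L) = (L.map (markWord h)).flatten := by
  induction L with
  | nil => rfl
  | cons a L ih => simp [ih]

lemma markWord_congr {h h' : ℕ → MarkedWord B} {l : List ((Σ n, B.ι n) ⊕ ℕ)}
    (H : ∀ i ∈ wordLeaves l, h i = h' i) : markWord h l = markWord h' l := by
  induction l with
  | nil => rfl
  | cons a l ih =>
    rcases a with a | a
    · simp only [markWord_inl]; rw [ih fun i hi => H i (by simpa using hi)]
    · simp only [markWord_inr]
      rw [H a (by simp), ih fun i hi => H i (by simp [hi])]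

/-- Forget the marks. -/
def forgetMarks (l : MarkedWord B) : List ((Σ n, B.ι n) ⊕ ℕ) := l.map (Sum.map Prod.fst id)

lemma forgetMarks_unmarkHead (l : MarkedWord B) : forgetMarks (unmarkHead l) = forgetMarks l := by
  rcases l with _ | ⟨⟨u, b⟩ | i, l⟩ <;> rfl

lemma forgetMarks_markWord (h : ℕ → MarkedWord B) (l) : forgetMarks (markWord h l) =
    l.flatMap (Sum.elim (fun v => [.inl v]) fun i => forgetMarks (h i)) := by
  induction l with
  | nil => rfl
  | cons a l ih =>
    rcases a with a | a
    · simp [forgetMarks] at ih ⊢; exact ih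
    · simp [forgetMarks] at ih ⊢; exact ih

lemma word_expand (T : BarTree B) : (expand T).word = forgetMarks (markedWord T) := by
  induction T with
  | leaf i => rfl
  | node n x c ih =>
    rw [expand_node, markedWord_node, forgetMarks_unmarkHead, forgetMarks_markWord, word_bind]
    have : ∀ i, (expand (childAt c i)).word = forgetMarks (markedWord (childAt c i)) := by
      intro i
      by_cases h : i < n
      · rw [childAt_of_lt c h]; exact ih _
      · simp [childAt, h, expand, word, markedWord, forgetMarks]
    simp only [this]

lemma expand_eq_of_forgetMarks {T T' : BarTree B}
    (h : forgetMarks (markedWord T) = forgetMarks (markedWord T')) : expand T = expand T' :=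
  word_injective (by rw [word_expand, word_expand, h])

lemma leaves_expand {T : BarTree B} (hT : LabelsOK B T) : (expand T).leaves.Perm T.leaves := by
  induction T with
  | leaf i => rfl
  | node n x c ih =>
    rw [expand_node, leaves_bind]
    have e : (node n x c : BarTree B).leaves =
        (List.range n).flatMap fun i => (childAt c i).leaves := by
      rw [← flatMap_ofFn c leaves]
      simp [leaves, List.flatMap_def, List.map_ofFn, Function.comp_def]
    rw [e]
    refine (hT.1.2.flatMap_right _).trans (List.Perm.flatMap_left _ fun i hi => ?_)
    rw [List.mem_range] at hi
    rw [childAt_of_lt c hi]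
    exact ih _ (hT.2.2 _)

lemma minLeaf_expand {T : BarTree B} (hT : LabelsOK B T) : (expand T).minLeaf = T.minLeaf :=
  minLeaf_eq_of_perm (leaves_expand hT)

/-- Treewise tensors of the bar construction, with arbitrary distinct labels of the leaves. -/
structure IsBarTree (T : BarTree B) : Prop where
  canonical : T.IsCanonical
  labels : LabelsOK B T
  nodup : T.leaves.Nodup

lemma isBarTree_leaf (i : ℕ) : IsBarTree (leaf i : BarTree B) :=
  ⟨trivial, trivial, by simp [leaves]⟩

lemma IsBarTree.child {n : ℕ} {x : BTree B} {c : Fin n → BarTree B} (h : IsBarTree (node n x c))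
    (k : Fin n) : IsBarTree (c k) :=
  ⟨h.canonical.2.2 k, h.labels.2.2 k, (nodup_leaves_node h.nodup).1 k⟩

lemma IsBarTree.entry {n : ℕ} {x : BTree B} {c : Fin n → BarTree B} (h : IsBarTree (node n x c))
    (i : ℕ) : IsBarTree (childAt c i) := by
  by_cases hi : i < n
  · rw [childAt_of_lt c hi]; exact h.child _
  · simp [childAt, hi, isBarTree_leaf]

lemma isBarTree_iff {r : ℕ} {T : BarTree B} :
    IsBarMonomial B r T ↔ IsBarTree T ∧ T.leaves.Perm (List.range r) :=
  ⟨fun h => ⟨⟨h.1.1, h.2, h.1.nodup⟩, h.1.2⟩, fun h => ⟨⟨h.1.1, h.2⟩, h.1.2⟩⟩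

lemma IsBarTree.strictMonoOn {n : ℕ} {x : BTree B} {c : Fin n → BarTree B}
    (h : IsBarTree (node n x c)) :
    StrictMonoOn (fun i => (childAt c i).minLeaf) (Set.Iio n) := by
  intro a ha b hb hab
  simp only [Set.mem_Iio] at ha hb
  dsimp only
  rw [childAt_of_lt c ha, childAt_of_lt c hb]
  exact h.canonical.2.1 hab

lemma expand_isCanonical {T : BarTree B} (hT : IsBarTree T) : (expand T).IsCanonical := by
  induction T with
  | leaf i => trivial
  | node n x c ih =>
    rw [expand_node]
    have hx := hT.labels.1
    refine hx.1.bind (fun i hi => ?_) ?_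
    · rw [childAt_of_lt c (hx.mem_leaves.1 hi)]
      exact ih _ (hT.child _)
    · rw [hx.setOf_leaves]
      refine hT.strictMonoOn.congr fun i _ => ?_
      exact (minLeaf_expand (hT.entry i).labels).symm

lemma expand_nodup {T : BarTree B} (hT : IsBarTree T) : (expand T).leaves.Nodup :=
  (leaves_expand hT.labels).nodup_iff.2 hT.nodup

lemma exists_node_of_pos {x : BTree B} (h : 0 < x.numVertices) :
    ∃ (n : ℕ) (b : B.ι n) (c : Fin n → BTree B), x = node n b c := by
  cases x with
  | leaf i => simp [numVertices, vertexSum] at h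
  | node n b c => exact ⟨n, b, c, rfl⟩

/-- The root of a label is unmarked. This tells a parser where a label stops and the tree above one
of its entries starts. -/
lemma markedWord_head {T : BarTree B} (hT : LabelsOK B T) :
    (∃ i, markedWord T = [.inr i]) ∨ ∃ u l, markedWord T = .inl (u, false) :: l := by
  cases T with
  | leaf i => exact .inl ⟨i, rfl⟩
  | node n x c =>
    obtain ⟨m, b, d, rfl⟩ := exists_node_of_pos hT.2.1
    exact .inr ⟨_, _, by rw [markedWord_node]; rfl⟩

/-- All letters of a label occur as marked vertices here, while a substituted tree starts with a
leaf or an unmarked vertex, so the parse is forced. The numbers of the leaves of the label do not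
appear in the word; only the trees placed at these leaves can be compared. -/
lemma markWord_append_inj {c c' : ℕ → BarTree B}
    {t t' : BTree B} {l l' : MarkedWord B}
    (hc : ∀ i ∈ t.leaves, LabelsOK B (c i)) (hc' : ∀ i ∈ t'.leaves, LabelsOK B (c' i))
    (ih : ∀ i ∈ t.leaves, ∀ i' ∈ t'.leaves, ∀ l l' : MarkedWord B,
      markedWord (c i) ++ l = markedWord (c' i') ++ l' → c i = c' i' ∧ l = l')
    (H : markWord (fun i => markedWord (c i)) t.word ++ l =
      markWord (fun i => markedWord (c' i)) t'.word ++ l') :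
    t.word.map (Sum.map id c) = t'.word.map (Sum.map id c') ∧ l = l' := by
  induction t generalizing t' l l' with
  | leaf i =>
    cases t' with
    | leaf i' =>
      simpa [word] using ih i (by simp [leaves]) i' (by simp [leaves]) l l'
        (by simpa [word] using H)
    | node n b d =>
      exfalso
      rcases markedWord_head (hc i (by simp [leaves])) with ⟨k, hk⟩ | ⟨u, r, hk⟩ <;>
        simp [word, hk] at H
  | node n b d ihd =>
    cases t' with
    | leaf i' =>
      exfalso
      rcases markedWord_head (hc' i' (by simp [leaves])) with ⟨k, hk⟩ | ⟨u, r, hk⟩ <;>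
        simp [word, hk] at H
    | node n' b' d' =>
      simp only [word, markWord_inl, List.cons_append, List.cons.injEq, Sum.inl.injEq,
        Prod.mk.injEq, Sigma.mk.injEq, and_true] at H
      obtain ⟨⟨rfl, h1⟩, h2⟩ := H
      obtain rfl := eq_of_heq h1
      rw [markWord_flatten, markWord_flatten, List.map_ofFn, List.map_ofFn] at h2
      have hm : ∀ {d : Fin n → BTree B} (k : Fin n), ∀ i ∈ (d k).leaves,
          i ∈ (node n b d).leaves := fun k i hi => mem_leaves_node.2 ⟨k, hi⟩
      obtain ⟨h3, h4⟩ := flatten_ofFn_parse _ _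
        (fun k => (d k).word.map (Sum.map id c) = (d' k).word.map (Sum.map id c'))
        (fun k l l' hk => ihd k (t' := d' k) (fun i hi => hc i (hm k i hi))
          (fun i hi => hc' i (hm k i hi))
          (fun i hi i' hi' => ih i (hm k i hi) i' (hm k i' hi')) hk) h2
      refine ⟨?_, h4⟩
      simp only [word, List.map_cons, Sum.map_inl, id, List.map_flatten, List.map_ofFn,
        Function.comp_def, h3]

lemma word_relabel {X : ℕ → Type*} (f : ℕ → ℕ) (t : OTree X) :
    (t.relabel f).word = t.word.map (Sum.map id f) := by
  rw [OTree.relabel, word_bind]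
  induction t.word with
  | nil => rfl
  | cons a l ih => rcases a with a | a <;> simp [word] at ih ⊢ <;> exact ih

lemma leaves_map_eq_of_word {X : ℕ → Type*} {α : Type*} {t t' : OTree X} {f f' : ℕ → α}
    (H : t.word.map (Sum.map id f) = t'.word.map (Sum.map id f')) :
    t.leaves.map f = t'.leaves.map f' := by
  have key : ∀ (l : List ((Σ n, X n) ⊕ ℕ)) (f : ℕ → α),
      (l.map (Sum.map id f)).filterMap Sum.getRight? = (wordLeaves l).map f := by
    intro l f
    induction l with
    | nil => rfl
    | cons a l ih => rcases a with a | a <;> simp [List.filterMap_cons, ih]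
  rw [← wordLeaves_word, ← wordLeaves_word, ← key, ← key, H]

/-- The parse gives the shape of the root label and the trees at its leaves. The numbering of these
leaves is recovered from canonical form, since the entries are ordered by their smallest leaves. -/
lemma markedWord_append_inj {T T' : BarTree B} (hT : IsBarTree T) (hT' : IsBarTree T')
    {l l' : MarkedWord B} (H : markedWord T ++ l = markedWord T' ++ l') : T = T' ∧ l = l' := by
  induction T generalizing T' l l' with
  | leaf i =>
    cases T' with
    | leaf i' => simpa [markedWord] using H
    | node n x c =>
      obtain ⟨m, b, d, rfl⟩ := exists_node_of_pos hT'.labels.2.1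
      rw [markedWord_node] at H
      simp [markedWord, word, unmarkHead] at H
  | node n x c ih =>
    obtain ⟨m, b, d, hx⟩ := exists_node_of_pos hT.labels.2.1
    cases T' with
    | leaf i =>
      rw [hx, markedWord_node] at H
      simp [markedWord, word, unmarkHead] at H
    | node n' x' c' =>
      obtain ⟨m', b', d', hx'⟩ := exists_node_of_pos hT'.labels.2.1
      have H' : markWord (fun i => markedWord (childAt c i)) x.word ++ l =
          markWord (fun i => markedWord (childAt c' i)) x'.word ++ l' := by
        rw [markedWord_node, markedWord_node] at H
        subst hx hx'
        simp only [word, markWord_inl, unmarkHead, List.cons_append, List.cons.injEq,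
          Sum.inl.injEq, Prod.mk.injEq, and_true] at H ⊢
        exact H
      have hX := hT.labels.1
      have hX' := hT'.labels.1
      obtain ⟨h1, h2⟩ := markWord_append_inj (fun i _ => (hT.entry i).labels)
        (fun i _ => (hT'.entry i).labels) (fun i hi i' _ l l' h => by
          have hi' := hX.mem_leaves.1 hi
          rw [childAt_of_lt c hi'] at h ⊢
          exact ih _ (hT.child _) (hT'.entry i') h) H'
      have h3 := leaves_map_eq_of_word h1
      have hn : n = n' := by
        have := congrArg List.length h3
        simp only [List.length_map, hX.2.length_eq, hX'.2.length_eq, List.length_range] at this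
        exact this
      subst hn
      -- With every leaf numbered by the smallest leaf above it, the two labels coincide; uniqueness
      -- of standardization then identifies `x` and `x'`.
      have h4 : x.relabel (fun i => (childAt c i).minLeaf) =
          x'.relabel fun i => (childAt c' i).minLeaf := by
        refine word_injective ?_
        rw [word_relabel, word_relabel]
        have := congrArg (List.map (Sum.map id minLeaf)) h1
        simpa [List.map_map, Function.comp_def, Sum.map_map] using this
      obtain ⟨-, rfl⟩ := hX.relabel_unique hX' hT.strictMonoOn hT'.strictMonoOn h4
      refine ⟨?_, h2⟩
      congr 1
      funext k
      rw [List.map_inj_left] at h3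
      simpa using h3 k (hX.mem_leaves.2 k.2)

lemma markedWord_inj {T T' : BarTree B} (hT : IsBarTree T) (hT' : IsBarTree T')
    (H : markedWord T = markedWord T') : T = T' :=
  (markedWord_append_inj hT hT' (l := []) (l' := []) (by simpa using H)).1

end

/-! ### Contraction of an edge as a composition along a pointed shuffle. -/

section
open OTree

variable {𝕜 : Type u} [Field 𝕜] {M : SigmaModule.{u, v} 𝕜} {B : HomogeneousBasis.{u, v, w} M}

lemma countP_ofFn {α : Type*} {n : ℕ} (f : Fin n → α) (p : α → Prop) [DecidablePred p] :
    (List.ofFn f).countP (fun a => decide (p a)) = (Finset.univ.filter fun k => p (f k)).card := by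
  induction n with
  | zero => simp
  | succ n ih =>
    rw [List.ofFn_succ, List.countP_cons, ih, Fin.univ_succ, Finset.filter_cons]
    have : (Finset.filter (fun k => p (f k)) (Finset.map ⟨Fin.succ, Fin.succ_injective n⟩
        Finset.univ)).card = (Finset.univ.filter fun k : Fin n => p (f k.succ)).card := by
      rw [Finset.filter_map, Finset.card_map]; rfl
    by_cases h : p (f 0) <;> simp [h, this]

section Merge

variable {n m : ℕ} {c : Fin n → BarTree B} {j : Fin n} {d : Fin m → BarTree B}

lemma mem_mergedEntries {T : BarTree B} :
    T ∈ mergedEntries B c j d ↔ (∃ i, i ≠ j ∧ T = c i) ∨ ∃ l, T = d l := by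
  have h1 : T ∈ (List.ofFn c).take j ↔ ∃ i, i < j ∧ T = c i := by
    rw [List.mem_take_iff_getElem]
    simp only [List.getElem_ofFn, List.length_ofFn]
    constructor
    · rintro ⟨i, hi, rfl⟩; exact ⟨⟨i, by omega⟩, by rw [Fin.lt_def]; simp; omega, rfl⟩
    · rintro ⟨i, hi, rfl⟩; exact ⟨i, by rw [Fin.lt_def] at hi; omega, rfl⟩
  have h2 : T ∈ (List.ofFn c).drop (j + 1) ↔ ∃ i, j < i ∧ T = c i := by
    rw [List.mem_drop_iff_getElem]
    simp only [List.getElem_ofFn, List.length_ofFn]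
    constructor
    · rintro ⟨i, hi, rfl⟩; exact ⟨⟨j + 1 + i, by omega⟩, by rw [Fin.lt_def]; simp; omega, rfl⟩
    · rintro ⟨i, hi, rfl⟩
      rw [Fin.lt_def] at hi
      exact ⟨i - (j + 1), by omega, by congr 2; omega⟩
  rw [mergedEntries, List.mem_append, List.mem_append, h1, h2, List.mem_ofFn]
  constructor
  · rintro ((⟨i, hi, e⟩ | ⟨l, e⟩) | ⟨i, hi, e⟩)
    · exact .inl ⟨i, hi.ne, e⟩
    · exact .inr ⟨l, e.symm⟩
    · exact .inl ⟨i, hi.ne', e⟩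
  · rintro (⟨i, hi, e⟩ | ⟨l, e⟩)
    · rcases lt_or_gt_of_ne hi with h | h
      · exact .inl (.inl ⟨i, h, e⟩)
      · exact .inr ⟨i, h, e⟩
    · exact .inl (.inr ⟨l, e.symm⟩)

lemma take_append_drop_ofFn :
    (List.ofFn c).take j ++ c j :: (List.ofFn c).drop (j + 1) = List.ofFn c := by
  conv_rhs => rw [← List.take_append_drop j (List.ofFn c)]
  congr 1
  rw [List.drop_eq_getElem_cons (i := j) (by simp)]
  simp

lemma length_mergedEntries : (mergedEntries B c j d).length = n + m - 1 := by
  simp only [mergedEntries, List.length_append, List.length_take, List.length_ofFn,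
    List.length_drop]
  omega

/-- The smallest leaves of the entries of the contracted vertex have the expected rank. -/
lemma countP_mergedEntries (a : ℕ) :
    (mergedEntries B c j d).countP (fun T => decide (T.minLeaf < a)) = subtreeRank c j d a := by
  have h1 := countP_ofFn c fun T => T.minLeaf < a
  rw [← take_append_drop_ofFn (j := j), List.countP_append, List.countP_cons] at h1
  have h2 : (Finset.univ.filter fun k => (c k).minLeaf < a).card =
      (Finset.univ.filter fun k => k ≠ j ∧ (c k).minLeaf < a).card +
        if (c j).minLeaf < a then 1 else 0 := by
    rw [← Finset.card_filter_add_card_filter_not (s := Finset.univ.filter fun k =>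
      (c k).minLeaf < a) (fun k => k ≠ j), Finset.filter_filter, Finset.filter_filter]
    congr 1
    · congr 1
      ext k
      simp [and_comm]
    · split_ifs with h
      · rw [Finset.card_eq_one]
        exact ⟨j, by ext k; simp; rintro rfl; exact h⟩
      · rw [Finset.card_eq_zero]
        ext k
        simp only [Finset.mem_filter, Finset.mem_univ, true_and, not_not, Finset.notMem_empty,
          iff_false, not_and]
        rintro h' rfl
        exact h h'
  rw [subtreeRank, mergedEntries, List.countP_append, List.countP_append,
    countP_ofFn d fun T => T.minLeaf < a]
  simp only [decide_eq_true_eq] at h1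
  omega

/-- The entries of the vertex obtained by contracting an edge. -/
def contractEntries (c : Fin n → BarTree B) (j : Fin n) (d : Fin m → BarTree B) :
    Fin (mergedEntries B c j d).length → BarTree B :=
  fun k => (mergedEntries B c j d).get (mergedSort B c j d k)

lemma ofFn_contractEntries_perm :
    (List.ofFn (contractEntries c j d)).Perm (mergedEntries B c j d) := by
  have := Equiv.Perm.ofFn_comp_perm (mergedSort B c j d) (mergedEntries B c j d).get
  rwa [List.ofFn_get] at this

lemma mem_contractEntries (k) : contractEntries c j d k ∈ mergedEntries B c j d :=
  List.get_mem _ _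

lemma exists_contractEntries {T : BarTree B} (hT : T ∈ mergedEntries B c j d) :
    ∃ k, contractEntries c j d k = T := by
  rw [← ofFn_contractEntries_perm.mem_iff, List.mem_ofFn] at hT
  exact hT

/-- A vertex with entries `c`, and a vertex with entries `d` at the end of its entry `j`, in a
canonical tree with distinct leaves. -/
structure IsMergeable (c : Fin n → BarTree B) (j : Fin n) (d : Fin m → BarTree B) : Prop where
  canonical : ∀ i, (c i).IsCanonical
  strictMono : StrictMono fun i => (c i).minLeaf
  canonical' : ∀ l, (d l).IsCanonical
  strictMono' : StrictMono fun l => (d l).minLeaf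
  pos : 0 < m
  leaves : (c j).leaves = (List.ofFn d).flatMap leaves
  nodup : ((List.ofFn c).flatMap OTree.leaves).Nodup

lemma leaves_node {X : ℕ → Type*} {n : ℕ} (x : X n) (c : Fin n → OTree X) :
    (node n x c).leaves = (List.ofFn c).flatMap leaves := by
  simp [leaves, List.flatMap_def, List.map_ofFn, Function.comp_def]

lemma IsMergeable.mk' {x y : BTree B} (hc : (node n x c : BarTree B).IsCanonical)
    (hn : (node n x c : BarTree B).leaves.Nodup) (hj : c j = node m y d) : IsMergeable c j d where
  canonical := hc.2.2
  strictMono := hc.2.1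
  canonical' := by have := hc.2.2 j; rw [hj] at this; exact this.2.2
  strictMono' := by have := hc.2.2 j; rw [hj] at this; exact this.2.1
  pos := by have := hc.2.2 j; rw [hj] at this; exact this.1
  leaves := by rw [hj, leaves_node]
  nodup := by rwa [leaves_node] at hn

namespace IsMergeable

variable (h : IsMergeable c j d)
include h

lemma minLeaf_eq : (c j).minLeaf = (d ⟨0, h.pos⟩).minLeaf := by
  rw [minLeaf_eq_iff (h.canonical j).leaves_ne_nil, h.leaves]
  refine ⟨List.mem_flatMap.2 ⟨_, List.mem_ofFn.2 ⟨_, rfl⟩, minLeaf_mem (h.canonical' _).leaves_ne_nil⟩,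
    fun b hb => ?_⟩
  obtain ⟨T, hT, hb⟩ := List.mem_flatMap.1 hb
  obtain ⟨l, rfl⟩ := List.mem_ofFn.1 hT
  exact (h.strictMono'.monotone (Fin.mk_le_of_le_val (Nat.zero_le _))).trans (minLeaf_le hb)

lemma leaves_perm :
    ((mergedEntries B c j d).flatMap OTree.leaves).Perm ((List.ofFn c).flatMap OTree.leaves) := by
  rw [← take_append_drop_ofFn (c := c) (j := j), mergedEntries]
  simp [List.flatMap_append, h.leaves]

lemma ne_nil {T : BarTree B} (hT : T ∈ mergedEntries B c j d) : T.IsCanonical := by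
  rcases mem_mergedEntries.1 hT with ⟨i, -, rfl⟩ | ⟨l, rfl⟩
  · exact h.canonical i
  · exact h.canonical' l

lemma pairwise_ne : (mergedEntries B c j d).Pairwise fun T T' => T.minLeaf ≠ T'.minLeaf := by
  have h1 := h.leaves_perm.nodup_iff.2 h.nodup
  rw [List.nodup_flatMap] at h1
  refine h1.2.imp_of_mem fun {T T'} hT hT' hd e => ?_
  exact hd (minLeaf_mem (h.ne_nil hT).leaves_ne_nil)
    (e ▸ minLeaf_mem (h.ne_nil hT').leaves_ne_nil)

lemma minLeaf_injective :
    Function.Injective fun k => ((mergedEntries B c j d).get k).minLeaf := by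
  have h1 := List.pairwise_iff_get.1 h.pairwise_ne
  intro k k' e
  rcases lt_trichotomy k k' with hk | hk | hk
  · exact absurd e (h1 k k' hk)
  · exact hk
  · exact absurd e.symm (h1 k' k hk)

lemma strictMono_contractEntries : StrictMono fun k => (contractEntries c j d k).minLeaf :=
  (Tuple.monotone_sort fun k => ((mergedEntries B c j d).get k).minLeaf).strictMono_of_injective
    (h.minLeaf_injective.comp (mergedSort B c j d).injective)

/-- `subtreeRank` counts the merged entries with a smaller smallest leaf; after sorting these are
the entries at the positions before `k`. -/
lemma rank_contractEntries (k) : subtreeRank c j d (contractEntries c j d k).minLeaf = k := by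
  rw [← countP_mergedEntries, ← ofFn_contractEntries_perm.countP_eq,
    countP_ofFn _ fun T : BarTree B => T.minLeaf < (contractEntries c j d k).minLeaf]
  have : ∀ k', (contractEntries c j d k').minLeaf < (contractEntries c j d k).minLeaf ↔ k' < k :=
    fun k' => h.strictMono_contractEntries.lt_iff_lt
  rw [Finset.filter_congr fun k' _ => this k']
  exact (congrArg Finset.card (by ext; simp)).trans (Fin.card_Iio k)

lemma childAt_rank {T : BarTree B} (hT : T ∈ mergedEntries B c j d) :
    subtreeRank c j d T.minLeaf < (mergedEntries B c j d).length ∧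
      childAt (contractEntries c j d) (subtreeRank c j d T.minLeaf) = T := by
  obtain ⟨k, rfl⟩ := exists_contractEntries hT
  rw [h.rank_contractEntries]
  exact ⟨k.2, childAt_val _ _⟩

end IsMergeable

/-- The label of the vertex obtained by contracting an edge. -/
def contractLabel (x : BTree B) (c : Fin n → BarTree B) (j : Fin n) (y : BTree B)
    (d : Fin m → BarTree B) : BTree B :=
  x.bind fun i => if i = j then y.relabel fun l => subtreeRank c j d (childAt d l).minLeaf
    else leaf (subtreeRank c j d (childAt c i).minLeaf)

/-- On labels with leaves in the expected range, the dependent tests in `contractTree` can be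
replaced by the total function `childAt`. -/
lemma contractTree_eq {x y : BTree B} (hx : ∀ i ∈ x.leaves, i < n) (hy : ∀ l ∈ y.leaves, l < m) :
    contractTree B x c j y d = node _ (contractLabel x c j y d) (contractEntries c j d) := by
  rw [contractTree, contractLabel]
  congr 1
  refine bind_congr fun i hi => ?_
  have hi' := hx i hi
  simp only [hi', dite_true]
  by_cases hij : i = j
  · subst hij
    simp only [if_true]
    refine relabel_congr fun l hl => ?_
    simp [childAt, hy l hl]
  · rw [if_neg (fun h => hij (congrArg Fin.val h)), if_neg hij]
    simp [childAt, hi']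

/-- Both functions take `N` values, so the inclusion of the values of `f` among those of `g` is an
equality, and an increasing enumeration is determined by its range. -/
lemma strictMono_ext {N : ℕ} {f g : ℕ → ℕ} (hf : StrictMonoOn f (Set.Iio N))
    (hg : StrictMonoOn g (Set.Iio N)) (h : ∀ k < N, ∃ k' < N, f k = g k') :
    ∀ k < N, f k = g k := by
  choose! e he using h
  have hinj : Function.Injective fun k : Fin N => (⟨e k, (he k k.2).1⟩ : Fin N) := by
    intro a b hab
    refine Fin.ext (hf.injOn a.2 b.2 ?_)
    rw [(he a a.2).2, (he b b.2).2, Fin.mk.inj_iff.1 hab]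
  have hsurj := Finite.surjective_of_injective hinj
  have : (fun k : Fin N => f k) = fun k : Fin N => g k := by
    refine (StrictMono.range_inj (f := fun k : Fin N => f k) (g := fun k : Fin N => g k)
      (fun a b hab => hf a.2 b.2 hab) (fun a b hab => hg a.2 b.2 hab)).1 ?_
    ext a
    constructor
    · rintro ⟨k, rfl⟩; exact ⟨⟨e k, (he k k.2).1⟩, (he k k.2).2.symm⟩
    · rintro ⟨k, rfl⟩
      obtain ⟨k', rfl⟩ := hsurj k
      exact ⟨k', (he k' k'.2).2⟩
  exact fun k hk => congrFun this ⟨k, hk⟩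

/-- The composition of labels in a contraction is a composition along a pointed shuffle. -/
lemma IsMergeable.exists_shuffle (h : IsMergeable c j d) :
    ∃ p : Equiv.Perm (Fin (n + m - 1)), IsPointedShuffle n m j p ∧
      ∀ x y : BTree B, x.IsReduced n → y.IsReduced m →
        contractLabel x c j y d = (graft m j x y).relabel (permFun p) := by
  have hf : StrictMonoOn (fun i => (childAt c i).minLeaf) (Set.Iio n) := by
    intro a ha b hb hab
    dsimp only
    rw [childAt_of_lt c ha, childAt_of_lt c hb]
    exact h.strictMono hab
  have hg : StrictMonoOn (fun i => (childAt d i).minLeaf) (Set.Iio m) := by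
    intro a ha b hb hab
    dsimp only
    rw [childAt_of_lt d ha, childAt_of_lt d hb]
    exact h.strictMono' hab
  have hnd := h.nodup
  rw [List.nodup_flatMap, List.pairwise_ofFn] at hnd
  have hdj : ∀ l, ∀ a ∈ (d l).leaves, a ∈ (c j).leaves := fun l a ha => by
    rw [h.leaves]; exact List.mem_flatMap.2 ⟨_, List.mem_ofFn.2 ⟨l, rfl⟩, ha⟩
  obtain ⟨p, φ, hp, hφ, h1, h2, h3⟩ := exists_pointedShuffle j.2 h.pos
    (fun i => (childAt c i).minLeaf) (fun i => (childAt d i).minLeaf) hf hg (by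
      rw [childAt_val, h.minLeaf_eq, childAt_of_lt d h.pos]) (by
      intro i hi hij l hl e
      rw [childAt_of_lt c hi, childAt_of_lt d hl] at e
      have m1 := minLeaf_mem (h.canonical ⟨i, hi⟩).leaves_ne_nil
      have m2 := hdj _ _ (minLeaf_mem (h.canonical' ⟨l, hl⟩).leaves_ne_nil)
      rw [← e] at m2
      rcases lt_or_gt_of_ne hij with hlt | hlt
      · exact hnd.2 (i := ⟨i, hi⟩) (j := j) hlt m1 m2
      · exact hnd.2 (i := j) (j := ⟨i, hi⟩) hlt m2 m1)
  refine ⟨p, hp, fun x y hx hy => ?_⟩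
  have hmemc : ∀ i < n, i ≠ j → childAt c i ∈ mergedEntries B c j d := fun i hi hij => by
    rw [childAt_of_lt c hi]
    exact mem_mergedEntries.2 (.inl ⟨_, fun e => hij (congrArg Fin.val e), rfl⟩)
  have hmemd : ∀ l < m, childAt d l ∈ mergedEntries B c j d := fun l hl => by
    rw [childAt_of_lt d hl]
    exact mem_mergedEntries.2 (.inr ⟨_, rfl⟩)
  have hN := length_mergedEntries (c := c) (j := j) (d := d)
  set ψ : ℕ → ℕ := fun k => (childAt (contractEntries c j d) k).minLeaf with hψ
  have hψm : StrictMonoOn ψ (Set.Iio (n + m - 1)) := by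
    rw [← hN]
    intro a ha b hb hab
    simp only [hψ]
    rw [childAt_of_lt _ ha, childAt_of_lt _ hb]
    exact h.strictMono_contractEntries hab
  have hψr : ∀ T ∈ mergedEntries B c j d, ψ (subtreeRank c j d T.minLeaf) = T.minLeaf :=
    fun T hT => by rw [hψ]; dsimp only; rw [(h.childAt_rank hT).2]
  have hlt : ∀ T ∈ mergedEntries B c j d, subtreeRank c j d T.minLeaf < n + m - 1 :=
    fun T hT => hN ▸ (h.childAt_rank hT).1
  -- `φ` (from the shuffle) and `ψ` (from the sorted entries) both enumerate the smallest leaves of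
  -- the merged entries in increasing order.
  have hφψ : ∀ k < n + m - 1, φ k = ψ k := by
    refine strictMono_ext hφ hψm fun k hk => ?_
    obtain ⟨q, hq⟩ := p.surjective ⟨k, hk⟩
    have hq' : permFun p q = k := by rw [permFun_of_lt p q.2]; simp [hq]
    rw [← hq']
    have hjn := j.2
    have hqlt := q.2
    rcases lt_or_ge q.1 j with hqj | hqj
    · refine ⟨_, hlt _ (hmemc q (by omega) hqj.ne), ?_⟩
      rw [h1 _ hqj, hψr _ (hmemc q (by omega) hqj.ne)]
    rcases lt_or_ge q.1 (j + m) with hqm | hqm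
    · refine ⟨_, hlt _ (hmemd (q - j) (by omega)), ?_⟩
      rw [hψr _ (hmemd (q - j) (by omega)), ← h2 _ (by omega)]
      congr 2; omega
    · have := h.pos
      refine ⟨_, hlt _ (hmemc (q + 1 - m) (by omega) (by omega)), ?_⟩
      rw [hψr _ (hmemc (q + 1 - m) (by omega) (by omega)), ← h3 _ (by omega) (by omega)]
      congr 2; omega
  have e1 := graft_relabel_relabel (fun i hi => hx.mem_leaves.1 hi)
    (fun i hi => hy.mem_leaves.1 hi) h1 h2 h3
  have hw := hx.graft_relabel j.2 hy hp
  have hlz : ∀ i ∈ (contractLabel x c j y d).leaves, i < n + m - 1 := by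
    intro i hi
    obtain ⟨k, hk, hi⟩ := mem_leaves_bind.1 hi
    split_ifs at hi with hkj
    · rw [leaves_relabel, List.mem_map] at hi
      obtain ⟨l, hl, rfl⟩ := hi
      exact hlt _ (hmemd l (hy.mem_leaves.1 hl))
    · simp only [OTree.leaves, List.mem_singleton] at hi
      subst hi
      exact hlt _ (hmemc k (hx.mem_leaves.1 hk) hkj)
  -- Ranks become smallest leaves after relabelling by `φ`, which is injective, so the comparison
  -- can be made there.
  refine relabel_injOn (h := φ) hφ.injOn hlz (fun i hi => hw.mem_leaves.1 hi) ?_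
  rw [e1, relabel_congr fun i hi => hφψ i (hlz i hi), contractLabel, OTree.relabel, bind_bind]
  refine bind_congr fun i hi => ?_
  split_ifs with hij
  · change ((y.relabel _).relabel ψ) = _
    rw [relabel_relabel]
    exact relabel_congr fun l hl => hψr _ (hmemd l (hy.mem_leaves.1 hl))
  · simp only [OTree.bind]
    rw [hψr _ (hmemc i (hx.mem_leaves.1 hi) hij)]

lemma IsMergeable.contractLabel_isReduced (h : IsMergeable c j d) {x y : BTree B}
    (hx : x.IsReduced n) (hy : y.IsReduced m) :
    (contractLabel x c j y d).IsReduced (mergedEntries B c j d).length := by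
  obtain ⟨p, hp, h'⟩ := h.exists_shuffle
  rw [h' x y hx hy, length_mergedEntries]
  exact hx.graft_relabel j.2 hy hp

lemma biweight_contractLabel {x y : BTree B} (hx : x.IsReduced n) :
    biweight B (contractLabel x c j y d) = biweight B x + biweight B y := by
  simp only [biweight, contractLabel, vertexSum_bind]
  congr 1
  have : ∀ i, (if i = (j : ℕ) then y.relabel fun l => subtreeRank c j d (childAt d l).minLeaf
      else leaf (subtreeRank c j d (childAt c i).minLeaf) : BTree B).vertexSum
        (fun n b => ((1 : ℤ), B.deg n b)) =
      if i = j then y.vertexSum (fun n b => ((1 : ℤ), B.deg n b)) else 0 := by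
    intro i
    split_ifs <;> simp [vertexSum]
  simp only [this]
  rw [sum_map_ite_eq, List.count_eq_one_of_mem hx.nodup (hx.mem_leaves.2 j.2), one_smul]

end Merge

end

/-! ### Contractions of edges are markings of vertices. -/

section
open OTree

variable {𝕜 : Type u} [Field 𝕜] {M : SigmaModule.{u, v} 𝕜} {B : HomogeneousBasis.{u, v, w} M}

lemma exists_word_split {X : ℕ → Type*} {x : OTree X} (hn : x.leaves.Nodup) {j : ℕ}
    (hj : j ∈ x.leaves) : ∃ r₁ r₂, x.word = r₁ ++ .inr j :: r₂ ∧ j ∉ wordLeaves r₁ ∧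
      j ∉ wordLeaves r₂ := by
  rw [← wordLeaves_word, mem_wordLeaves] at hj
  obtain ⟨r₁, r₂, h⟩ := List.append_of_mem hj
  refine ⟨r₁, r₂, h, ?_⟩
  rw [← wordLeaves_word, h, wordLeaves_append, wordLeaves_inr, List.nodup_append] at hn
  refine ⟨fun h1 => hn.2.2 j h1 j (by simp) rfl, (List.nodup_cons.1 hn.2.1).1⟩

lemma unmarkHead_append {a : MarkedWord B} (ha : a ≠ []) (b : MarkedWord B) :
    unmarkHead (a ++ b) = unmarkHead a ++ b := by
  rcases a with _ | ⟨⟨u, b⟩ | i, l⟩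
  · exact absurd rfl ha
  · rfl
  · rfl

lemma markWord_flatMap (h : ℕ → MarkedWord B) (g : ℕ → List ((Σ n, B.ι n) ⊕ ℕ)) (l) :
    markWord h (l.flatMap (Sum.elim (fun v => [.inl v]) g)) =
      markWord (fun i => markWord h (g i)) l := by
  induction l with
  | nil => rfl
  | cons a l ih =>
    rcases a with a | a
    · simp only [List.flatMap_cons, Sum.elim_inl, List.singleton_append, markWord_inl, ih]
    · simp only [List.flatMap_cons, Sum.elim_inr, markWord_append, markWord_inr, ih]

lemma markWord_bind (h : ℕ → MarkedWord B) (g : ℕ → BTree B) (x : BTree B) :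
    markWord h (x.bind g).word = markWord (fun i => markWord h (g i).word) x.word := by
  rw [word_bind, markWord_flatMap]

lemma markWord_split {h h' : ℕ → MarkedWord B} {j : ℕ} {r₁ r₂ : List ((Σ n, B.ι n) ⊕ ℕ)}
    (h1 : j ∉ wordLeaves r₁) (h2 : j ∉ wordLeaves r₂)
    (hh : ∀ i ∈ wordLeaves r₁ ++ wordLeaves r₂, i ≠ j → h' i = h i) :
    markWord h' (r₁ ++ .inr j :: r₂) = markWord h r₁ ++ (h' j ++ markWord h r₂) := by
  rw [markWord_append, markWord_inr,
    markWord_congr fun i hi => hh i (List.mem_append_left _ hi) (fun e => h1 (e ▸ hi)),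
    markWord_congr fun i hi => hh i (List.mem_append_right _ hi) (fun e => h2 (e ▸ hi))]

lemma markWord_ne_nil {h : ℕ → MarkedWord B} {r₁ r₂ : List ((Σ n, B.ι n) ⊕ ℕ)} {x : BTree B}
    (hx : 0 < x.numVertices) {j : ℕ} (hr : x.word = r₁ ++ .inr j :: r₂) : markWord h r₁ ≠ [] := by
  obtain ⟨n, b, d, rfl⟩ := exists_node_of_pos hx
  cases r₁ with
  | nil => simp [word] at hr
  | cons a r =>
    simp only [word, List.cons_append, List.cons.injEq] at hr
    rw [← hr.1]
    simp

section Contract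

variable {n m : ℕ} {x y : BTree B} {c : Fin n → BarTree B} {j : Fin n} {d : Fin m → BarTree B}

lemma markedWord_node_split (hx : 0 < x.numVertices) {r₁ r₂ : List ((Σ n, B.ι n) ⊕ ℕ)}
    (hr : x.word = r₁ ++ .inr (j : ℕ) :: r₂) :
    markedWord (node n x c) = unmarkHead (markWord (fun i => markedWord (childAt c i)) r₁) ++
      (markedWord (c j) ++ markWord (fun i => markedWord (childAt c i)) r₂) := by
  rw [markedWord_node, hr, markWord_append, unmarkHead_append (markWord_ne_nil hx hr),
    markWord_inr, childAt_val]

lemma numVertices_contractLabel (hx : x.IsReduced n) : (contractLabel x c j y d).numVertices =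
    x.numVertices + y.numVertices := by
  have := biweight_contractLabel (c := c) (j := j) (d := d) (y := y) hx
  rw [biweight_eq, biweight_eq, biweight_eq] at this
  have := congrArg Prod.fst this
  simp only [Prod.fst_add] at this
  exact_mod_cast this

lemma IsBarTree.isMergeable (h : IsBarTree (node n x c)) (hj : c j = node m y d) :
    IsMergeable c j d := .mk' h.canonical h.nodup hj

lemma IsBarTree.contractTree_eq (h : IsBarTree (node n x c)) (hj : c j = node m y d) :
    contractTree B x c j y d = node _ (contractLabel x c j y d) (contractEntries c j d) := by
  have hy := (h.child j).labels
  rw [hj] at hy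
  exact OperadPBW.contractTree_eq (fun i hi => h.labels.1.mem_leaves.1 hi)
    (fun i hi => hy.1.mem_leaves.1 hi)

lemma contractTree_leaves (h : IsMergeable c j d) {N : BTree B} :
    (node _ N (contractEntries c j d) : BarTree B).leaves.Perm (node n x c : BarTree B).leaves := by
  rw [leaves_node, leaves_node]
  exact (ofFn_contractEntries_perm.flatMap_right _).trans h.leaves_perm

lemma IsBarTree.contract (h : IsBarTree (node n x c)) (hj : c j = node m y d) :
    IsBarTree (contractTree B x c j y d) ∧
      (contractTree B x c j y d).leaves.Perm (node n x c : BarTree B).leaves := by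
  have hm := h.isMergeable hj
  have hcj := (h.child j)
  rw [hj] at hcj
  have hlen := length_mergedEntries (c := c) (j := j) (d := d)
  have hpos := hm.pos
  have hjn := j.2
  rw [h.contractTree_eq hj]
  have hp := contractTree_leaves (x := x) hm (N := contractLabel x c j y d)
  refine ⟨⟨⟨by omega, hm.strictMono_contractEntries, fun k => hm.ne_nil (mem_contractEntries k)⟩,
    ⟨hm.contractLabel_isReduced h.labels.1 hcj.labels.1, ?_, fun k => ?_⟩,
    hp.nodup_iff.2 h.nodup⟩, hp⟩
  · rw [numVertices_contractLabel h.labels.1]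
    have := h.labels.2.1
    omega
  · rcases mem_mergedEntries.1 (mem_contractEntries (c := c) (j := j) (d := d) k) with
      ⟨i, -, e⟩ | ⟨l, e⟩
    · rw [e]; exact h.labels.2.2 i
    · rw [e]; exact hcj.labels.2.2 l

/-- The ranks used in the new label and the sorting of the new entries cancel in the word. What
changes is that `y` is now inside a label, so its root keeps its mark. -/
lemma IsBarTree.markedWord_contractTree (h : IsBarTree (node n x c)) (hj : c j = node m y d)
    {r₁ r₂ : List ((Σ n, B.ι n) ⊕ ℕ)} (hr : x.word = r₁ ++ .inr (j : ℕ) :: r₂)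
    (h1 : (j : ℕ) ∉ wordLeaves r₁) (h2 : (j : ℕ) ∉ wordLeaves r₂) :
    markedWord (contractTree B x c j y d) =
      unmarkHead (markWord (fun i => markedWord (childAt c i)) r₁) ++
      (markWord (fun i => markedWord (childAt d i)) y.word ++
        markWord (fun i => markedWord (childAt c i)) r₂) := by
  have hm := h.isMergeable hj
  have hcj := (h.child j)
  rw [hj] at hcj
  have hL : ∀ i ∈ wordLeaves r₁ ++ wordLeaves r₂, i < n := fun i hi => by
    rw [← h.labels.1.mem_leaves, ← wordLeaves_word, hr]
    simp only [wordLeaves_append, wordLeaves_inr, List.mem_append, List.mem_cons] at hi ⊢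
    tauto
  rw [h.contractTree_eq hj, markedWord_node, contractLabel, markWord_bind, hr,
    markWord_split (h := fun i => markedWord (childAt c i)) h1 h2, unmarkHead_append]
  · congr 2
    simp only [if_true]
    rw [OTree.relabel, markWord_bind]
    refine markWord_congr fun l hl => ?_
    rw [wordLeaves_word] at hl
    have hl' := hcj.labels.1.mem_leaves.1 hl
    simp only [word, markWord_inr, markWord_nil, List.append_nil]
    rw [(hm.childAt_rank _).2]
    rw [childAt_of_lt d hl']
    exact mem_mergedEntries.2 (.inr ⟨_, rfl⟩)
  · exact markWord_ne_nil h.labels.2.1 hr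
  · intro i hi hij
    simp only [if_neg hij, word, markWord_inr, markWord_nil, List.append_nil]
    rw [(hm.childAt_rank _).2]
    rw [childAt_of_lt c (hL i hi)]
    exact mem_mergedEntries.2 (.inl ⟨_, fun e => hij (congrArg Fin.val e), rfl⟩)

lemma IsBarTree.node_congr (h : IsBarTree (node n x c)) {c' : Fin n → BarTree B}
    (hc : ∀ k, IsBarTree (c' k)) (hp : ∀ k, (c' k).leaves.Perm (c k).leaves) :
    IsBarTree (node n x c') ∧
      (node n x c' : BarTree B).leaves.Perm (node n x c : BarTree B).leaves := by
  have hl : (node n x c' : BarTree B).leaves.Perm (node n x c : BarTree B).leaves := by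
    rw [leaves_node, leaves_node]
    simp only [List.ofFn_eq_map, List.flatMap_map]
    exact List.Perm.flatMap_left _ fun k _ => hp k
  refine ⟨⟨⟨h.canonical.1, fun k k' hk => ?_, fun k => (hc k).canonical⟩,
    ⟨h.labels.1, h.labels.2.1, fun k => (hc k).labels⟩, hl.nodup_iff.2 h.nodup⟩, hl⟩
  dsimp only
  rw [minLeaf_eq_of_perm (hp k), minLeaf_eq_of_perm (hp k')]
  exact h.canonical.2.1 hk

lemma IsBarTree.update (h : IsBarTree (node n x c)) {T : BarTree B} (hT : IsBarTree T)
    (hp : T.leaves.Perm (c j).leaves) : IsBarTree (node n x (Function.update c j T)) ∧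
      (node n x (Function.update c j T) : BarTree B).leaves.Perm
        (node n x c : BarTree B).leaves := by
  refine h.node_congr (fun k => ?_) (fun k => ?_)
  · by_cases hk : k = j
    · subst hk; simpa
    · simpa [hk] using h.child k
  · by_cases hk : k = j
    · subst hk; simpa
    · simp [hk]

lemma childAt_update {X : ℕ → Type*} {n : ℕ} (c : Fin n → OTree X) (j : Fin n) (T : OTree X) {i : ℕ}
    (hi : i ≠ j) : childAt (Function.update c j T) i = childAt c i := by
  by_cases h : i < n
  · rw [childAt_of_lt _ h, childAt_of_lt _ h, Function.update_of_ne]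
    exact fun e => hi (congrArg Fin.val e)
  · simp [childAt, h]

lemma markedWord_update (hx : 0 < x.numVertices) {r₁ r₂ : List ((Σ n, B.ι n) ⊕ ℕ)}
    (hr : x.word = r₁ ++ .inr (j : ℕ) :: r₂) (h1 : (j : ℕ) ∉ wordLeaves r₁)
    (h2 : (j : ℕ) ∉ wordLeaves r₂) (T : BarTree B) :
    markedWord (node n x (Function.update c j T)) =
      unmarkHead (markWord (fun i => markedWord (childAt c i)) r₁) ++
        (markedWord T ++ markWord (fun i => markedWord (childAt c i)) r₂) := by
  rw [markedWord_node, hr, markWord_split (h := fun i => markedWord (childAt c i)) h1 h2,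
    unmarkHead_append (markWord_ne_nil hx hr), childAt_val, Function.update_self]
  intro i _ hij
  rw [childAt_update c j T hij]

end Contract

/-- `Contracts T T'`: the tree `T'` is obtained from `T` by contracting an internal edge. -/
inductive Contracts : BarTree B → BarTree B → Prop
  | root {n : ℕ} {x : BTree B} {c : Fin n → BarTree B} (j : Fin n) {m : ℕ} {y : BTree B}
      {d : Fin m → BarTree B} (h : c j = node m y d) :
      Contracts (node n x c) (contractTree B x c j y d)
  | above {n : ℕ} {x : BTree B} {c : Fin n → BarTree B} (j : Fin n) {T : BarTree B}
      (h : Contracts (c j) T) : Contracts (node n x c) (node n x (Function.update c j T))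

/-- The marked word `l'` is obtained from `l` by marking a vertex, other than the root. -/
def MarksOne (l l' : MarkedWord B) : Prop :=
  ∃ l₁ v l₂, l₁ ≠ [] ∧ l = l₁ ++ .inl (v, false) :: l₂ ∧ l' = l₁ ++ .inl (v, true) :: l₂

lemma unmarkHead_ne_nil {l : MarkedWord B} (h : l ≠ []) : unmarkHead l ≠ [] := by
  rcases l with _ | ⟨⟨u, b⟩ | i, l⟩ <;> simp_all [unmarkHead]

lemma markedWord_node_label {n : ℕ} {y : BTree B} (hy : 0 < y.numVertices)
    {c : Fin n → BarTree B} : ∃ v l, markedWord (node n y c) = .inl (v, false) :: l ∧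
      markWord (fun i => markedWord (childAt c i)) y.word = .inl (v, true) :: l := by
  obtain ⟨m, b, d, rfl⟩ := exists_node_of_pos hy
  exact ⟨_, _, by rw [markedWord_node]; rfl, rfl⟩

/-- Besides showing that contractions stay among valid tensors on the same leaves, this reduces them
to their trace on words, from which the later facts on expansion, weight and degree are read. -/
lemma Contracts.isBarTree {T T' : BarTree B} (h : Contracts T T') (hT : IsBarTree T) :
    IsBarTree T' ∧ T'.leaves.Perm T.leaves ∧ MarksOne (markedWord T) (markedWord T') := by
  induction h with
  | @root n x c j m y d hj =>
    obtain ⟨h1, h2⟩ := hT.contract hj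
    refine ⟨h1, h2, ?_⟩
    obtain ⟨r₁, r₂, hr, hr1, hr2⟩ := exists_word_split hT.labels.1.nodup
      (hT.labels.1.mem_leaves.2 j.2)
    have hy := (hT.child j).labels
    rw [hj] at hy
    obtain ⟨v, l, e1, e2⟩ := markedWord_node_label (c := d) hy.2.1
    refine ⟨unmarkHead (markWord (fun i => markedWord (childAt c i)) r₁), v,
      l ++ markWord (fun i => markedWord (childAt c i)) r₂, unmarkHead_ne_nil (markWord_ne_nil hT.labels.2.1 hr), ?_, ?_⟩
    · rw [markedWord_node_split hT.labels.2.1 hr, hj, e1]; rfl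
    · rw [hT.markedWord_contractTree hj hr hr1 hr2, e2]; rfl
  | @above n x c j T h ih =>
    obtain ⟨h1, h2, l₁, v, l₂, h3, h4, h5⟩ := ih (hT.child j)
    obtain ⟨h6, h7⟩ := hT.update h1 h2
    refine ⟨h6, h7, ?_⟩
    obtain ⟨r₁, r₂, hr, hr1, hr2⟩ := exists_word_split hT.labels.1.nodup
      (hT.labels.1.mem_leaves.2 j.2)
    refine ⟨unmarkHead (markWord (fun i => markedWord (childAt c i)) r₁) ++ l₁, v,
      l₂ ++ markWord (fun i => markedWord (childAt c i)) r₂, by simp [h3], ?_, ?_⟩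
    · rw [markedWord_node_split hT.labels.2.1 hr, h4]; simp
    · rw [markedWord_update hT.labels.2.1 hr hr1 hr2, h5]; simp

/-- Vertices of the label itself are marked, so an unmarked vertex belongs to the tree substituted
for some leaf `i`. -/
lemma exists_split_of_markWord {h : ℕ → MarkedWord B} {r : List ((Σ n, B.ι n) ⊕ ℕ)} {v}
    {l₁ l₂ : MarkedWord B} (H : markWord h r = l₁ ++ .inl (v, false) :: l₂) :
    ∃ r₁ i r₂ a b, r = r₁ ++ .inr i :: r₂ ∧ h i = a ++ .inl (v, false) :: b ∧
      l₁ = markWord h r₁ ++ a ∧ l₂ = b ++ markWord h r₂ := by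
  induction r generalizing l₁ with
  | nil => simp at H
  | cons a r ih =>
    rcases a with u | i
    · cases l₁ with
      | nil => simp at H
      | cons a l₁ =>
        simp only [markWord_inl, List.cons_append, List.cons.injEq] at H
        obtain ⟨r₁, i, r₂, a', b, h1, h2, h3, h4⟩ := ih H.2
        exact ⟨.inl u :: r₁, i, r₂, a', b, by rw [h1]; rfl, h2, by
          rw [markWord_inl, H.1, h3]; rfl, h4⟩
    · rw [markWord_inr, List.append_eq_append_iff] at H
      rcases H with ⟨a', h1, h2⟩ | ⟨a', h1, h2⟩
      · obtain ⟨r₁, i', r₂, a, b, h3, h4, h5, h6⟩ := ih h2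
        exact ⟨.inr i :: r₁, i', r₂, a, b, by rw [h3]; rfl, h4, by
          rw [markWord_inr, h1, h5, List.append_assoc], h6⟩
      · cases a' with
        | nil =>
          obtain ⟨r₁, i', r₂, a, b, h3, h4, h5, h6⟩ := ih (l₁ := []) (by simpa using h2.symm)
          refine ⟨.inr i :: r₁, i', r₂, a, b, by rw [h3]; rfl, h4, ?_, h6⟩
          rw [markWord_inr, List.append_assoc, ← h5, h1]; simp
        | cons a₀ a' =>
          simp only [List.cons_append, List.cons.injEq] at h2
          exact ⟨[], i, r, l₁, a', rfl, by rw [h1, h2.1], by simp, h2.2⟩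

/-- Converse to `Contracts.isBarTree`: an unmarked vertex other than the root is the root of a
label, hence the upper end of an edge. -/
lemma exists_contracts {T : BarTree B} (hT : IsBarTree T) {l₁ l₂ : MarkedWord B} {v}
    (h0 : l₁ ≠ []) (H : markedWord T = l₁ ++ .inl (v, false) :: l₂) :
    ∃ T', Contracts T T' ∧ markedWord T' = l₁ ++ .inl (v, true) :: l₂ := by
  induction T generalizing l₁ l₂ with
  | leaf i =>
    cases l₁ with
    | nil => exact absurd rfl h0
    | cons a l => simp [markedWord] at H
  | node n x c ih =>
    obtain ⟨a₀, l₁, rfl⟩ := List.exists_cons_of_ne_nil h0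
    obtain ⟨u, l, e1, e2⟩ := markedWord_node_label (c := c) hT.labels.2.1
    obtain ⟨m, b, d, hx⟩ := exists_node_of_pos hT.labels.2.1
    rw [e1] at H
    simp only [List.cons_append, List.cons.injEq] at H
    obtain ⟨H1, H2⟩ := H
    subst H1
    rw [hx, word] at e2
    simp only [markWord_inl, List.cons.injEq, Sum.inl.injEq, Prod.mk.injEq, and_true] at e2
    rw [← e2.2] at H2
    obtain ⟨r₁, i, r₂, a, b', h1, h2, h3, h4⟩ := exists_split_of_markWord H2
    have hr : x.word = (.inl ⟨m, b⟩ :: r₁) ++ .inr i :: r₂ := by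
      rw [hx, word, h1]; rfl
    have hi : i ∈ x.leaves := by
      rw [← wordLeaves_word, mem_wordLeaves, hr]; simp
    have hin := hT.labels.1.mem_leaves.1 hi
    have hnd : i ∉ wordLeaves r₁ ∧ i ∉ wordLeaves r₂ := by
      have := hT.labels.1.nodup
      rw [← wordLeaves_word, hr, wordLeaves_append, wordLeaves_inl, wordLeaves_inr,
        List.nodup_append] at this
      exact ⟨fun h1 => this.2.2 i h1 i (by simp) rfl, (List.nodup_cons.1 this.2.1).1⟩
    have hh : unmarkHead (markWord (fun i => markedWord (childAt c i)) (.inl ⟨m, b⟩ :: r₁)) =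
        .inl (u, false) :: markWord (fun i => markedWord (childAt c i)) r₁ := by
      rw [markWord_inl, ← e2.1]; rfl
    rw [childAt_of_lt c hin] at h2
    -- If the vertex is the first letter of its entry, the edge starts at the root vertex; otherwise
    -- it lies inside that entry.
    by_cases ha : a = []
    · subst ha
      have hcj : ∃ (m' : ℕ) (y : BTree B) (d' : Fin m' → BarTree B),
          c ⟨i, hin⟩ = node m' y d' := by
        cases hc : c ⟨i, hin⟩ with
        | leaf k => rw [hc] at h2; simp [markedWord] at h2
        | node m' y d' => exact ⟨_, _, _, rfl⟩
      obtain ⟨m', y, d', hcj⟩ := hcj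
      refine ⟨_, .root ⟨i, hin⟩ hcj, ?_⟩
      have hy := (hT.child ⟨i, hin⟩).labels
      rw [hcj] at hy
      obtain ⟨v', l', e3, e4⟩ := markedWord_node_label (c := d') hy.2.1
      rw [hcj, e3] at h2
      simp only [List.nil_append, List.cons.injEq, Sum.inl.injEq, Prod.mk.injEq, and_true] at h2
      rw [hT.markedWord_contractTree hcj hr hnd.1 hnd.2, hh, e4, h3, h4, h2.1, h2.2]
      simp
    · obtain ⟨T', h5, h6⟩ := ih ⟨i, hin⟩ (hT.child _) ha h2
      refine ⟨_, .above ⟨i, hin⟩ h5, ?_⟩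
      rw [markedWord_update hT.labels.2.1 hr hnd.1 hnd.2, hh, h6, h3, h4]
      simp

end

/-! ### Signs modulo 2: weighted inversions and degrees of words. -/

section
open OTree

variable {𝕜 : Type u} [Field 𝕜] {M : SigmaModule.{u, v} 𝕜} {B : HomogeneousBasis.{u, v, w} M}

/-- The sign attached to an exponent modulo `2`. -/
def sg (𝕜 : Type u) [Field 𝕜] (a : ZMod 2) : 𝕜 := if a = 0 then 1 else -1

lemma sgn_eq_sg (k : ℤ) : sgn 𝕜 k = sg 𝕜 (k : ZMod 2) := by
  rcases Int.even_or_odd k with h | h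
  · have : (k : ZMod 2) = 0 := (ZMod.intCast_zmod_eq_zero_iff_dvd k 2).2 h.two_dvd
    simp [sgn, sg, this, Int.negOnePow_even k h]
  · have : (k : ZMod 2) ≠ 0 := fun h' =>
      (Int.not_even_iff_odd.2 h) (even_iff_two_dvd.2 ((ZMod.intCast_zmod_eq_zero_iff_dvd k 2).1 h'))
    simp [sgn, sg, this, Int.negOnePow_odd k h]

lemma zmod_two_cases (a : ZMod 2) : a = 0 ∨ a = 1 := by
  revert a; decide

lemma sg_add (a b : ZMod 2) : sg 𝕜 (a + b) = sg 𝕜 a * sg 𝕜 b := by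
  have h : (1 : ZMod 2) + 1 = 0 := by decide
  rcases zmod_two_cases a with rfl | rfl <;> rcases zmod_two_cases b with rfl | rfl <;>
    simp [sg, h]

lemma sg_mul_self (a : ZMod 2) : sg 𝕜 a * sg 𝕜 a = 1 := by
  simp only [sg]; split_ifs <;> simp

lemma sg_ne_zero (a : ZMod 2) : sg 𝕜 a ≠ 0 := by
  simp only [sg]; split_ifs <;> simp

/-! ### Inversions -/

/-- The sum of the weights of the elements with key smaller than `k`. -/
def lowerSum (k : ℕ) (L : List (ℕ × ZMod 2)) : ZMod 2 :=
  (L.map fun b => if b.1 < k then b.2 else 0).sum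

/-- The sum of the products of weights over the pairs of elements with decreasing keys. -/
def inversions : List (ℕ × ZMod 2) → ZMod 2
  | [] => 0
  | a :: L => a.2 * lowerSum a.1 L + inversions L

/-- The sum of the products of weights over the pairs, from two lists, with decreasing keys. -/
def crossInversions (A L : List (ℕ × ZMod 2)) : ZMod 2 :=
  (A.map fun a => a.2 * lowerSum a.1 L).sum

lemma lowerSum_append (k : ℕ) (A L : List (ℕ × ZMod 2)) :
    lowerSum k (A ++ L) = lowerSum k A + lowerSum k L := by simp [lowerSum]

lemma lowerSum_zero (L : List (ℕ × ZMod 2)) : lowerSum 0 L = 0 := by simp [lowerSum]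

lemma inversions_append (A L : List (ℕ × ZMod 2)) :
    inversions (A ++ L) = inversions A + crossInversions A L + inversions L := by
  induction A with
  | nil => simp [inversions, crossInversions]
  | cons a A ih =>
    simp only [List.cons_append, inversions, ih, crossInversions, lowerSum_append, List.map_cons,
      List.sum_cons]
    ring

lemma crossInversions_append_left (A A' L : List (ℕ × ZMod 2)) :
    crossInversions (A ++ A') L = crossInversions A L + crossInversions A' L := by
  simp [crossInversions]

lemma crossInversions_append_right (A L L' : List (ℕ × ZMod 2)) :
    crossInversions A (L ++ L') = crossInversions A L + crossInversions A L' := by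
  simp only [crossInversions, lowerSum_append, mul_add, List.sum_map_add]

lemma crossInversions_eq_zero {A L : List (ℕ × ZMod 2)} (h : ∀ a ∈ A, ∀ b ∈ L, a.1 ≤ b.1) :
    crossInversions A L = 0 := by
  refine List.sum_eq_zero fun q hq => ?_
  obtain ⟨a, ha, rfl⟩ := List.mem_map.1 hq
  have : lowerSum a.1 L = 0 := by
    refine List.sum_eq_zero fun q hq => ?_
    obtain ⟨b, hb, rfl⟩ := List.mem_map.1 hq
    exact if_neg (not_lt.2 (h a ha b hb))
  rw [this, mul_zero]

lemma inversions_eq_zero {L : List (ℕ × ZMod 2)} (h : L.Pairwise fun a b => a.1 ≤ b.1) :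
    inversions L = 0 := by
  induction L with
  | nil => rfl
  | cons a L ih =>
    rw [List.pairwise_cons] at h
    have h1 := crossInversions_eq_zero (A := [a]) (L := L) (by simpa using h.1)
    simp only [crossInversions, List.map_cons, List.map_nil, List.sum_cons, List.sum_nil,
      add_zero] at h1
    rw [inversions, ih h.2, h1, add_zero]

lemma inversions_ofFn {N : ℕ} (key : Fin N → ℕ) (d : Fin N → ZMod 2) :
    inversions (List.ofFn fun k => (key k, d k)) =
      ∑ q, ∑ p, if q < p ∧ key p < key q then d q * d p else 0 := by
  induction N with
  | zero => simp [inversions]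
  | succ N ih =>
    rw [List.ofFn_succ, inversions, ih, Fin.sum_univ_succ]
    congr 1
    · rw [Fin.sum_univ_succ, lowerSum, List.map_ofFn, List.sum_ofFn, Finset.mul_sum]
      simp
    · refine Finset.sum_congr rfl fun q _ => ?_
      rw [Fin.sum_univ_succ]
      simp

/-- For a sorting permutation, the pairs that are exchanged are those with decreasing keys. The
exponent therefore depends on the list of keys and weights alone. -/
lemma koszulExponent_eq_inversions {N : ℕ} (σ : Equiv.Perm (Fin N)) (key : Fin N → ℕ)
    (hσ : StrictMono (key ∘ σ)) (d : Fin N → ℤ) :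
    ((koszulExponent σ d : ℤ) : ZMod 2) =
      inversions (List.ofFn fun k => (key k, (d k : ZMod 2))) := by
  rw [inversions_ofFn, koszulExponent]
  push_cast
  have h1 : ∀ a b, (a < b ∧ σ b < σ a) ↔ (σ b < σ a ∧ key (σ a) < key (σ b)) := fun a b => by
    have : key (σ a) < key (σ b) ↔ a < b := hσ.lt_iff_lt
    rw [this, and_comm]
  simp only [h1]
  rw [Finset.sum_comm]
  rw [← Equiv.sum_comp σ fun q => ∑ p, if q < p ∧ key p < key q then (d q : ZMod 2) * d p else 0]
  refine Finset.sum_congr rfl fun a _ => ?_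
  rw [← Equiv.sum_comp σ fun p =>
    if σ a < p ∧ key p < key (σ a) then (d (σ a) : ZMod 2) * d p else 0]
  exact Finset.sum_congr rfl fun b _ => by rw [mul_comm]

/-! ### Weights of words -/

/-- The suspended degree of a tree, modulo `2`. -/
def susp (T : BarTree B) : ZMod 2 := (suspendedDeg B T : ZMod 2)

/-- The sum of the degrees of the vertices of a word, modulo `2`. -/
def wordDeg (r : List ((Σ n, B.ι n) ⊕ ℕ)) : ZMod 2 :=
  (r.map (Sum.elim (fun v => (B.deg v.1 v.2 : ZMod 2)) fun _ => 0)).sum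

/-- The sum of a function over the leaves of a word. -/
def leafSum (r : List ((Σ n, B.ι n) ⊕ ℕ)) (f : ℕ → ZMod 2) : ZMod 2 := ((wordLeaves r).map f).sum

/-- The elements of a word, with their keys and weights: a vertex has the key `0` and the weight
given by its degree, a leaf has a positive key and the weight given by the tree above it. -/
def keyWord {n : ℕ} (c : Fin n → BarTree B) (r : List ((Σ n, B.ι n) ⊕ ℕ)) : List (ℕ × ZMod 2) :=
  r.map (Sum.elim (fun v => (0, (B.deg v.1 v.2 : ZMod 2)))
    fun i => ((childAt c i).minLeaf + 1, susp (childAt c i)))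

/-- The exponent of the sign that relates the order of the factors of a treewise tensor of labels
to the order of the vertices of the expanded tree. -/
def orderExponent : BarTree B → ZMod 2
  | leaf _ => 0
  | node _ x c => ∑ k, orderExponent (c k) + inversions (keyWord c x.word)

/-- The total degree of the vertices of a marked word, where the unmarked ones are suspended. -/
def markedDeg (l : MarkedWord B) : ZMod 2 :=
  (l.map (Sum.elim (fun v => (B.deg v.1.1 v.1.2 : ZMod 2) + 1 + if v.2 then 1 else 0)
    fun _ => 0)).sum

@[simp] lemma markedDeg_append (l l' : MarkedWord B) :
    markedDeg (l ++ l') = markedDeg l + markedDeg l' := by simp [markedDeg]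

lemma wordDeg_word (x : BTree B) : wordDeg x.word = (BTree.deg B x : ZMod 2) := by
  have := map_vertexSum (Int.castAddHom (ZMod 2)) B.deg x
  simp only [Int.coe_castAddHom] at this
  rw [BTree.deg, this, vertexSum_eq]
  rfl

lemma zmod_add_self (a : ZMod 2) : a + a = 0 := CharTwo.add_self_eq_zero a

lemma markedDeg_markWord (h : ℕ → MarkedWord B) (r) :
    markedDeg (markWord h r) = wordDeg r + leafSum r fun i => markedDeg (h i) := by
  induction r with
  | nil => simp [markedDeg, wordDeg, leafSum]
  | cons a r ih =>
    rcases a with a | a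
    · have h1 : markedDeg (markWord h (.inl a :: r)) =
          B.deg a.1 a.2 + markedDeg (markWord h r) := by
        simp only [markWord_inl, markedDeg, List.map_cons, List.sum_cons, Sum.elim_inl, if_true]
        rw [add_assoc (B.deg a.1 a.2 : ZMod 2), zmod_add_self, add_zero]
      rw [h1, ih]
      simp [wordDeg, leafSum, add_assoc]
    · rw [markWord_inr, markedDeg_append, ih]
      simp [wordDeg, leafSum]
      ring

/-- Unmarking the root letter of a label restores its suspension. -/
lemma markedDeg_unmarkHead {x : BTree B} {h : ℕ → MarkedWord B}
    (hx : 0 < x.numVertices) {r₁ r₂ : List ((Σ n, B.ι n) ⊕ ℕ)} (hr : x.word = r₁ ++ r₂)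
    (h0 : r₁ ≠ []) :
    markedDeg (unmarkHead (markWord h r₁)) = markedDeg (markWord h r₁) + 1 := by
  obtain ⟨n, b, d, rfl⟩ := exists_node_of_pos hx
  obtain ⟨a, r, rfl⟩ := List.exists_cons_of_ne_nil h0
  simp only [word, List.cons_append, List.cons.injEq] at hr
  rw [← hr.1]
  simp only [markWord_inl, unmarkHead, markedDeg, List.map_cons, List.sum_cons, Sum.elim_inl,
    if_true, Bool.false_eq_true, if_false]
  ring_nf
  rw [show (3 : ZMod 2) = 1 by decide]

lemma leafSum_word {n : ℕ} {x : BTree B} (hx : x.IsReduced n) (f : ℕ → ZMod 2) :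
    leafSum x.word f = ∑ k : Fin n, f k := by
  rw [leafSum, wordLeaves_word, (hx.2.map f).sum_eq, ← List.map_coe_finRange_eq_range,
    List.map_map, Fin.sum_univ_def]
  rfl

lemma leafSum_append (r r' : List ((Σ n, B.ι n) ⊕ ℕ)) (f : ℕ → ZMod 2) :
    leafSum (r ++ r') f = leafSum r f + leafSum r' f := by simp [leafSum]

lemma leafSum_inr (i : ℕ) (r' : List ((Σ n, B.ι n) ⊕ ℕ)) (f : ℕ → ZMod 2) :
    leafSum (.inr i :: r') f = f i + leafSum r' f := by simp [leafSum]

lemma leafSum_congr {r : List ((Σ n, B.ι n) ⊕ ℕ)} {f g : ℕ → ZMod 2}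
    (h : ∀ i ∈ wordLeaves r, f i = g i) : leafSum r f = leafSum r g := by
  rw [leafSum, leafSum, List.map_congr_left h]

lemma leafSum_add (r : List ((Σ n, B.ι n) ⊕ ℕ)) (f g : ℕ → ZMod 2) :
    leafSum r (fun i => f i + g i) = leafSum r f + leafSum r g := List.sum_map_add

lemma leafSum_mul (r : List ((Σ n, B.ι n) ⊕ ℕ)) (a : ZMod 2) (f : ℕ → ZMod 2) :
    leafSum r (fun i => a * f i) = a * leafSum r f := List.sum_map_mul_left _ _ _

lemma leafSum_sum (r : List ((Σ n, B.ι n) ⊕ ℕ)) {m : ℕ} (F : Fin m → ℕ → ZMod 2) :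
    leafSum r (fun i => ∑ l, F l i) = ∑ l, leafSum r (F l) := by
  simp only [leafSum]
  induction wordLeaves r with
  | nil => simp
  | cons a L ih => simp [ih, Finset.sum_add_distrib]

lemma susp_leaf (i : ℕ) : susp (leaf i : BarTree B) = 0 := by
  simp [susp, suspendedDeg, vertexSum]

lemma susp_node {n : ℕ} (x : BTree B) (c : Fin n → BarTree B) :
    susp (node n x c) = BTree.deg B x + 1 + ∑ k, susp (c k) := by
  simp [susp, suspendedDeg, vertexSum]

/-- Each label contributes one suspension, carried by its single unmarked vertex. -/
lemma markedDeg_markedWord {T : BarTree B} (hT : LabelsOK B T) :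
    markedDeg (markedWord T) = susp T := by
  induction T with
  | leaf i => simp [markedWord, markedDeg, susp_leaf]
  | node n x c ih =>
    rw [markedWord_node, markedDeg_unmarkHead (r₂ := []) hT.2.1 (by simp) (by
      intro h
      obtain ⟨n, b, d, rfl⟩ := exists_node_of_pos hT.2.1
      simp [word] at h), markedDeg_markWord, wordDeg_word, leafSum_word hT.1, susp_node]
    simp only [childAt_val, fun k => ih k (hT.2.2 k)]
    ring

section KeyWord

variable {n : ℕ} (c : Fin n → BarTree B) (r : List ((Σ n, B.ι n) ⊕ ℕ))

/-- Vertices have key `0` and leaves have positive keys, so every vertex lies below the positive key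
`k + 1`. -/
lemma lowerSum_keyWord (k : ℕ) : lowerSum (k + 1) (keyWord c r) = wordDeg r + leafSum r
    fun i => if (childAt c i).minLeaf < k then susp (childAt c i) else 0 := by
  induction r with
  | nil => simp [lowerSum, keyWord, wordDeg, leafSum]
  | cons a r ih =>
    rcases a with a | a
    · simp [lowerSum, keyWord, wordDeg, leafSum] at ih ⊢
      rw [ih]; ring
    · simp [lowerSum, keyWord, wordDeg, leafSum] at ih ⊢
      rw [ih]; ring

/-- A vertex has key `0`, hence nothing below it: as the left member of a pair only a leaf
contributes. -/
lemma crossInversions_keyWord (L : List (ℕ × ZMod 2)) : crossInversions (keyWord c r) L =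
    leafSum r fun i => susp (childAt c i) * lowerSum ((childAt c i).minLeaf + 1) L := by
  induction r with
  | nil => simp [crossInversions, keyWord, leafSum]
  | cons a r ih =>
    rcases a with a | a
    · simp [crossInversions, keyWord, leafSum, lowerSum_zero] at ih ⊢
      exact ih
    · simp [crossInversions, keyWord, leafSum] at ih ⊢
      exact ih

end KeyWord

/-- The part of a word that follows a leaf. -/
def wordAfter {α : Type*} (i : ℕ) : List (α ⊕ ℕ) → List (α ⊕ ℕ)
  | [] => []
  | .inl _ :: l => wordAfter i l
  | .inr k :: l => if k = i then l else wordAfter i l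

lemma wordAfter_append {α : Type*} (i : ℕ) (l l' : List (α ⊕ ℕ)) : wordAfter i (l ++ l') =
    if i ∈ wordLeaves l then wordAfter i l ++ l' else wordAfter i l' := by
  induction l with
  | nil => simp
  | cons a l ih =>
    rcases a with a | a
    · simp only [List.cons_append, wordAfter, wordLeaves_inl]; exact ih
    · by_cases h : a = i
      · simp [wordAfter, h]
      · simp [wordAfter, h, ih, Ne.symm h]

lemma wordDeg_append (r r' : List ((Σ n, B.ι n) ⊕ ℕ)) :
    wordDeg (r ++ r') = wordDeg r + wordDeg r' := by simp [wordDeg]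

lemma wordDeg_wordAfter_flatten {n : ℕ} (i : ℕ) (F : Fin n → List ((Σ n, B.ι n) ⊕ ℕ))
    (hF : ∀ k k', i ∈ wordLeaves (F k) → i ∈ wordLeaves (F k') → k = k') :
    wordDeg (wordAfter i (List.ofFn F).flatten) = ∑ k, if i ∈ wordLeaves (F k) then
      wordDeg (wordAfter i (F k)) else if ∃ k' < k, i ∈ wordLeaves (F k') then wordDeg (F k)
        else 0 := by
  induction n with
  | zero => simp [wordAfter, wordDeg]
  | succ n ih =>
    rw [List.ofFn_succ, List.flatten_cons, wordAfter_append, Fin.sum_univ_succ]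
    by_cases h0 : i ∈ wordLeaves (F 0)
    · have h1 : ∀ k : Fin n, i ∉ wordLeaves (F k.succ) := fun k hk =>
        (Fin.succ_ne_zero k) (hF _ _ hk h0)
      have h2 : ∀ k : Fin n, ∃ k' < k.succ, i ∈ wordLeaves (F k') := fun k =>
        ⟨0, Fin.succ_pos k, h0⟩
      simp only [h0, if_true, wordDeg_append, h1, if_false, h2]
      congr 1
      induction n with
      | zero => simp [wordDeg]
      | succ n ih' =>
        have : ∀ (n : ℕ) (G : Fin n → List ((Σ n, B.ι n) ⊕ ℕ)),
            wordDeg (List.ofFn G).flatten = ∑ k, wordDeg (G k) := by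
          intro n G
          induction n with
          | zero => simp [wordDeg]
          | succ n ih => rw [List.ofFn_succ, List.flatten_cons, wordDeg_append, ih,
              Fin.sum_univ_succ]
        exact this _ _
    · have h2 : ∀ k : Fin n, (∃ k' < k.succ, i ∈ wordLeaves (F k')) ↔
          ∃ k' < k, i ∈ wordLeaves (F k'.succ) := by
        intro k
        constructor
        · rintro ⟨k', hk', h⟩
          induction k' using Fin.cases with
          | zero => exact absurd h h0
          | succ k' => exact ⟨k', Fin.succ_lt_succ_iff.1 hk', h⟩
        · rintro ⟨k', hk', h⟩
          exact ⟨_, Fin.succ_lt_succ_iff.2 hk', h⟩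
      rw [if_neg h0, if_neg h0, if_neg (by simp), zero_add,
        ih (fun k => F k.succ) fun k k' h h' => Fin.succ_injective _ (hF _ _ h h')]
      simp only [h2]

/-- The sign of a partial composition moves the inserted factor past the letters that follow the
leaf `i`; this reads their degree on the word. -/
lemma degAfter_eq {x : BTree B} (hn : x.leaves.Nodup) (i : ℕ) (hi : i ∈ x.leaves) :
    ((BTree.degAfter B i x : ℤ) : ZMod 2) = wordDeg (wordAfter i x.word) := by
  induction x with
  | leaf k => simp [BTree.degAfter, word, wordAfter, wordDeg]
  | node n b c ih =>
    have h1 := nodup_leaves_node hn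
    rw [BTree.degAfter, word, wordAfter, wordDeg_wordAfter_flatten i _ (by
      simp only [wordLeaves_word]; exact fun k k' => h1.2 k k' i)]
    push_cast
    refine Finset.sum_congr rfl fun k _ => ?_
    simp only [wordLeaves_word]
    by_cases hk : i ∈ (c k).leaves
    · simp only [hk, if_true, ih k (h1.1 k) hk]
    · simp only [hk, if_false]
      split_ifs
      · rw [wordDeg_word]
      · simp

lemma wordAfter_split {α : Type*} {i : ℕ} {r₁ r₂ : List (α ⊕ ℕ)} (h : i ∉ wordLeaves r₁) :
    wordAfter i (r₁ ++ .inr i :: r₂) = r₂ := by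
  rw [wordAfter_append, if_neg h]; simp [wordAfter]

end

/-! ### The sign of a single contraction in terms of the word. -/

section
open OTree

variable {𝕜 : Type u} [Field 𝕜] {M : SigmaModule.{u, v} 𝕜} {B : HomogeneousBasis.{u, v, w} M}

lemma keyWord_append {n : ℕ} (c : Fin n → BarTree B) (r r') :
    keyWord c (r ++ r') = keyWord c r ++ keyWord c r' := by simp [keyWord]

lemma keyWord_inr {n : ℕ} (c : Fin n → BarTree B) (i : ℕ) (r) : keyWord c (.inr i :: r) =
    ((childAt c i).minLeaf + 1, susp (childAt c i)) :: keyWord c r := by simp [keyWord]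

lemma keyWord_flatMap {n n' : ℕ} {c : Fin n → BarTree B} {e : Fin n' → BarTree B}
    {r : List ((Σ n, B.ι n) ⊕ ℕ)} {G : ℕ → List ((Σ n, B.ι n) ⊕ ℕ)}
    (h : ∀ i ∈ wordLeaves r, ∃ k, G i = [.inr k] ∧ childAt e k = childAt c i) :
    keyWord e (r.flatMap (Sum.elim (fun v => [.inl v]) G)) = keyWord c r := by
  induction r with
  | nil => rfl
  | cons a r ih =>
    rw [List.flatMap_cons, keyWord_append]
    rcases a with a | a
    · rw [ih (by simpa using h)]; rfl
    · obtain ⟨k, h1, h2⟩ := h a (by simp)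
      rw [ih (fun i hi => h i (by simp [hi])), Sum.elim_inr, h1]
      simp [keyWord, h2]

/-- Modulo 2, the pairs inside `L₁` and `L₂` or between them occur twice; what survives involves the
replaced element `a` or the block `Ly`. -/
lemma inversions_replace (L₁ L₂ Ly : List (ℕ × ZMod 2)) (a : ℕ × ZMod 2) :
    inversions (L₁ ++ a :: L₂) + inversions (L₁ ++ (Ly ++ L₂)) = crossInversions L₁ [a] +
      crossInversions [a] L₂ + crossInversions L₁ Ly + crossInversions Ly L₂ + inversions Ly := by
  have h : a :: L₂ = [a] ++ L₂ := rfl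
  rw [h]
  simp only [inversions_append, crossInversions_append_right]
  have h1 : inversions [a] = 0 := by simp [inversions, lowerSum]
  rw [h1]
  linear_combination zmod_add_self (inversions L₁) + zmod_add_self (inversions L₂) +
    zmod_add_self (crossInversions L₁ L₂)

lemma sum_drop_ofFn {α : Type*} {n : ℕ} (c : Fin n → α) (j : Fin n) (f : α → ZMod 2) :
    (((List.ofFn c).drop (j + 1)).map f).sum = ∑ k, if j < k then f (c k) else 0 := by
  induction n with
  | zero => exact j.elim0
  | succ n ih =>
    rw [List.ofFn_succ, List.drop_succ_cons, Fin.sum_univ_succ]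
    induction j using Fin.cases with
    | zero => simp [List.map_ofFn, List.sum_ofFn]
    | succ j =>
      have := ih (fun k => c k.succ) j
      simpa using this

section Root

variable {n m : ℕ} {x y : BTree B} {c : Fin n → BarTree B} {j : Fin n} {d : Fin m → BarTree B}

lemma sum_orderExponent_contractEntries :
    ∑ k, orderExponent (c k) + ∑ k, orderExponent (contractEntries c j d k) =
      orderExponent (c j) + ∑ l, orderExponent (d l) := by
  have h1 : ∑ k, orderExponent (contractEntries c j d k) =
      ((mergedEntries B c j d).map orderExponent).sum := by
    rw [← (ofFn_contractEntries_perm.map orderExponent).sum_eq, List.map_ofFn, List.sum_ofFn]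
    rfl
  have h2 : ∑ k, orderExponent (c k) = ((List.ofFn c).map orderExponent).sum := by
    rw [List.map_ofFn, List.sum_ofFn]; rfl
  have h3 : ∑ l, orderExponent (d l) = ((List.ofFn d).map orderExponent).sum := by
    rw [List.map_ofFn, List.sum_ofFn]; rfl
  rw [h1, h2, h3, ← take_append_drop_ofFn (c := c) (j := j), mergedEntries]
  simp only [List.map_append, List.sum_append, List.map_cons, List.sum_cons]
  linear_combination zmod_add_self ((List.take (↑j) (List.ofFn c)).map orderExponent).sum +
    zmod_add_self ((List.drop (↑j + 1) (List.ofFn c)).map orderExponent).sum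

/-- The list of merged entries consists of three increasing blocks, and the first lies below the
other two. The only inversions are between an entry of the upper vertex and an entry `c k`, `j < k`,
with a smaller smallest leaf. -/
lemma IsMergeable.koszulExponent_eq (h : IsMergeable c j d) :
    ((koszulExponent (mergedSort B c j d)
      fun k => suspendedDeg B ((mergedEntries B c j d).get k) : ℤ) : ZMod 2) =
    ∑ k, if j < k then susp (c k) *
      ∑ l, (if (c k).minLeaf < (d l).minLeaf then susp (d l) else 0) else 0 := by
  rw [koszulExponent_eq_inversions _ (fun k => ((mergedEntries B c j d).get k).minLeaf)
    h.strictMono_contractEntries]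
  have h1 : (List.ofFn fun k => (((mergedEntries B c j d).get k).minLeaf,
      (suspendedDeg B ((mergedEntries B c j d).get k) : ZMod 2))) =
      (mergedEntries B c j d).map fun T => (T.minLeaf, susp T) := by
    conv_rhs => rw [← List.ofFn_get (mergedEntries B c j d), List.map_ofFn]
    rfl
  have hc : (List.ofFn c).Pairwise fun T T' => T.minLeaf < T'.minLeaf := by
    rw [List.pairwise_ofFn]; exact fun i j hij => h.strictMono hij
  have hd : (List.ofFn d).Pairwise fun T T' => T.minLeaf < T'.minLeaf := by
    rw [List.pairwise_ofFn]; exact fun i j hij => h.strictMono' hij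
  rw [← take_append_drop_ofFn (c := c) (j := j), List.pairwise_append, List.pairwise_cons] at hc
  have hdj : ∀ T ∈ List.ofFn d, (c j).minLeaf ≤ T.minLeaf := by
    intro T hT
    obtain ⟨l, rfl⟩ := List.mem_ofFn.1 hT
    rw [h.minLeaf_eq]
    exact h.strictMono'.monotone (Fin.mk_le_of_le_val (Nat.zero_le _))
  rw [h1, mergedEntries, List.map_append, inversions_append, List.map_append,
    crossInversions_append_left, inversions_eq_zero, crossInversions_eq_zero,
    inversions_eq_zero (L := ((List.ofFn c).drop (j + 1)).map _)]
  · rw [crossInversions, List.map_map, List.map_ofFn, List.sum_ofFn]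
    simp only [Function.comp_apply, lowerSum, List.map_map]
    have h2 : ∀ l : Fin m, (List.map ((fun b : ℕ × ZMod 2 => if b.1 < (d l).minLeaf then b.2 else 0)
        ∘ fun T => (T.minLeaf, susp T)) ((List.ofFn c).drop (j + 1))).sum =
        ∑ k, if j < k then (if (c k).minLeaf < (d l).minLeaf then susp (c k) else 0) else 0 :=
      fun l => sum_drop_ofFn c j fun T => if T.minLeaf < (d l).minLeaf then susp T else 0
    simp only [h2, zero_add, add_zero, Finset.mul_sum]
    rw [Finset.sum_comm]
    refine Finset.sum_congr rfl fun k _ => ?_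
    by_cases hk : j < k
    · simp only [hk, if_true]
      refine Finset.sum_congr rfl fun l _ => ?_
      split_ifs <;> ring
    · simp [hk]
  · rw [List.pairwise_map]
    exact hc.2.1.2.imp fun h => h.le
  · intro a ha b hb
    obtain ⟨T, hT, rfl⟩ := List.mem_map.1 ha
    obtain ⟨T', hT', rfl⟩ := List.mem_map.1 hb
    exact (hc.2.2 T hT T' (List.mem_cons_of_mem _ hT')).le
  · rw [← List.map_append, List.pairwise_map, List.pairwise_append]
    refine ⟨hc.1.imp fun h => h.le, hd.imp fun h => h.le, fun T hT T' hT' => ?_⟩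
    exact (hc.2.2 T hT _ List.mem_cons_self).le.trans (hdj T' hT')

/-- In the key word of the root label, the letter of the entry `j` is replaced by the key word of
`y`, and the letters on both sides are unchanged. The contributions of the other entries cancel
modulo 2. -/
lemma IsBarTree.orderExponent_contractTree (h : IsBarTree (node n x c)) (hj : c j = node m y d)
    {r₁ r₂ : List ((Σ n, B.ι n) ⊕ ℕ)} (hr : x.word = r₁ ++ .inr (j : ℕ) :: r₂)
    (h1 : (j : ℕ) ∉ wordLeaves r₁) (h2 : (j : ℕ) ∉ wordLeaves r₂) :
    orderExponent (node n x c) + orderExponent (contractTree B x c j y d) =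
      crossInversions (keyWord c r₁) [((c j).minLeaf + 1, susp (c j))] +
      crossInversions [((c j).minLeaf + 1, susp (c j))] (keyWord c r₂) +
      crossInversions (keyWord c r₁) (keyWord d y.word) +
      crossInversions (keyWord d y.word) (keyWord c r₂) := by
  have hm := h.isMergeable hj
  have hcj := h.child j
  rw [hj] at hcj
  have hL : ∀ i ∈ wordLeaves r₁ ++ wordLeaves r₂, i < n := fun i hi => by
    rw [← h.labels.1.mem_leaves, ← wordLeaves_word, hr]
    simp only [wordLeaves_append, wordLeaves_inr, List.mem_append, List.mem_cons] at hi ⊢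
    tauto
  have hk : keyWord (contractEntries c j d) (contractLabel x c j y d).word =
      keyWord c r₁ ++ (keyWord d y.word ++ keyWord c r₂) := by
    have hside : ∀ r : List ((Σ n, B.ι n) ⊕ ℕ), (∀ i ∈ wordLeaves r, i < n ∧ i ≠ j) →
        ∀ i ∈ wordLeaves r, ∃ k, ((if i = j then
            y.relabel fun l => subtreeRank c j d (childAt d l).minLeaf
          else leaf (subtreeRank c j d (childAt c i).minLeaf) : BTree B)).word = [.inr k] ∧
          childAt (contractEntries c j d) k = childAt c i := by
      intro r hr i hi
      rw [if_neg (hr i hi).2]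
      refine ⟨_, rfl, (hm.childAt_rank ?_).2⟩
      rw [childAt_of_lt c (hr i hi).1]
      exact mem_mergedEntries.2 (.inl ⟨_, fun e => (hr i hi).2 (congrArg Fin.val e), rfl⟩)
    rw [contractLabel, word_bind, hr, List.flatMap_append, List.flatMap_cons, keyWord_append,
      keyWord_append, keyWord_flatMap (c := c), keyWord_flatMap (c := c)]
    · congr 2
      rw [Sum.elim_inr, if_pos rfl, OTree.relabel, word_bind]
      refine keyWord_flatMap fun l hl => ⟨_, rfl, (hm.childAt_rank ?_).2⟩
      rw [wordLeaves_word] at hl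
      rw [childAt_of_lt d (hcj.labels.1.mem_leaves.1 hl)]
      exact mem_mergedEntries.2 (.inr ⟨_, rfl⟩)
    · exact hside r₂ fun i hi => ⟨hL i (by simp [hi]), fun e => h2 (e ▸ hi)⟩
    · exact hside r₁ fun i hi => ⟨hL i (by simp [hi]), fun e => h1 (e ▸ hi)⟩
  have hs := sum_orderExponent_contractEntries (c := c) (j := j) (d := d)
  have hκ : orderExponent (c j) = ∑ l, orderExponent (d l) + inversions (keyWord d y.word) := by
    rw [hj, orderExponent]
  have hi := inversions_replace (keyWord c r₁) (keyWord c r₂) (keyWord d y.word)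
    ((c j).minLeaf + 1, susp (c j))
  rw [h.contractTree_eq hj, orderExponent, orderExponent, hk, hr, keyWord_append, keyWord_inr,
    childAt_val]
  linear_combination hs + hκ + hi + zmod_add_self (∑ l, orderExponent (d l)) +
    zmod_add_self (inversions (keyWord d y.word))

lemma crossInversions_singleton (a : ℕ × ZMod 2) (L) :
    crossInversions [a] L = a.2 * lowerSum a.1 L := by simp [crossInversions]

lemma IsBarTree.leafSum_split (h : IsBarTree (node n x c)) {r₁ r₂ : List ((Σ n, B.ι n) ⊕ ℕ)}
    (hr : x.word = r₁ ++ .inr (j : ℕ) :: r₂) (f : ℕ → ZMod 2) :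
    ∑ k : Fin n, f k = leafSum r₁ f + (f j + leafSum r₂ f) := by
  rw [← leafSum_word h.labels.1, hr, leafSum_append, leafSum_inr]

/-- The exponent of the sign of the contraction of an edge at the root. -/
lemma IsBarTree.contractExponent_eq (h : IsBarTree (node n x c)) (hj : c j = node m y d)
    {r₁ r₂ : List ((Σ n, B.ι n) ⊕ ℕ)} (hr : x.word = r₁ ++ .inr (j : ℕ) :: r₂)
    (h1 : (j : ℕ) ∉ wordLeaves r₁) (h2 : (j : ℕ) ∉ wordLeaves r₂) :
    (contractExponent B x c j y d : ZMod 2) = orderExponent (node n x c) +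
      orderExponent (contractTree B x c j y d) + wordDeg r₁ +
      leafSum r₁ fun i => susp (childAt c i) := by
  have hm := h.isMergeable hj
  have hcj := h.child j
  rw [hj] at hcj
  have hL : ∀ i ∈ wordLeaves r₁ ++ wordLeaves r₂, i < n := fun i hi => by
    rw [← h.labels.1.mem_leaves, ← wordLeaves_word, hr]
    simp only [wordLeaves_append, wordLeaves_inr, List.mem_append, List.mem_cons] at hi ⊢
    tauto
  have hS : susp (c j) = wordDeg y.word + 1 + ∑ l, susp (d l) := by
    rw [hj, susp_node, wordDeg_word]
  have hdj : ∀ l, (c j).minLeaf ≤ (d l).minLeaf := fun l => by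
    rw [hm.minLeaf_eq]
    exact hm.strictMono'.monotone (Fin.mk_le_of_le_val (Nat.zero_le _))
  have hdeg : ((BTree.deg B x : ℤ) : ZMod 2) = wordDeg r₁ + wordDeg r₂ := by
    rw [← wordDeg_word, hr, wordDeg_append]; simp [wordDeg]
  have hafter : ((BTree.degAfter B j x : ℤ) : ZMod 2) = wordDeg r₂ := by
    rw [degAfter_eq h.labels.1.nodup _ (h.labels.1.mem_leaves.2 j.2), hr, wordAfter_split h1]
  -- `F k` is the share of the entry `c k` in the sign: for `k < j` it is crossed by `Σy`, for `k >
  -- j` it may be crossed by entries of `d` in the sorting. Regrouping the shares by position in the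
  -- word of `x` makes them comparable with inversions.
  let F : ℕ → ZMod 2 := fun k => if k < j then (wordDeg y.word + 1) * susp (childAt c k) else
    if j < k then susp (childAt c k) *
      ∑ l, (if (childAt c k).minLeaf < (d l).minLeaf then susp (d l) else 0) else 0
  have hF : (wordDeg y.word + 1) * (∑ k ∈ Finset.univ.filter (· < j), susp (c k)) +
      (∑ k, if j < k then susp (c k) *
      ∑ l, (if (c k).minLeaf < (d l).minLeaf then susp (d l) else 0) else 0) =
      leafSum r₁ F + leafSum r₂ F := by
    have := h.leafSum_split hr F
    rw [show F j = 0 by simp [F], zero_add] at this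
    rw [← this, Finset.sum_filter, Finset.mul_sum, ← Finset.sum_add_distrib]
    refine Finset.sum_congr rfl fun k _ => ?_
    simp only [F, childAt_val, Fin.val_fin_lt]
    by_cases hk : k < j
    · simp [hk, hk.le]
    · simp [hk]
  have hE : (contractExponent B x c j y d : ZMod 2) = leafSum r₁ F + leafSum r₂ F +
      (wordDeg r₁ + wordDeg r₂) + wordDeg y.word * wordDeg r₂ := by
    rw [← hF, ← hm.koszulExponent_eq, contractExponent]
    push_cast
    rw [hdeg, hafter, ← wordDeg_word]
    simp only [susp]
    ring
  rw [hE, h.orderExponent_contractTree hj hr h1 h2, crossInversions_keyWord,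
    crossInversions_keyWord, crossInversions_keyWord, crossInversions_singleton]
  simp only [lowerSum_keyWord]
  -- Leaves before `j` in the word: their inversions with the entry `j`, their inversions with the
  -- key word of `y`, and the prefix term of the statement.
  have e1 : leafSum r₁ F = (leafSum r₁ fun i => susp (childAt c i) * lowerSum
      ((childAt c i).minLeaf + 1) [((c j).minLeaf + 1, susp (c j))]) +
      (leafSum r₁ fun i => susp (childAt c i) * (wordDeg y.word + leafSum y.word fun l =>
        if (childAt d l).minLeaf < (childAt c i).minLeaf then susp (childAt d l) else 0)) +
      leafSum r₁ fun i => susp (childAt c i) := by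
    rw [← leafSum_add, ← leafSum_add]
    refine leafSum_congr fun i hi => ?_
    have hin := hL i (by simp [hi])
    have hij : i ≠ j := fun e => h1 (e ▸ hi)
    have hne : ∀ l, (c ⟨i, hin⟩).minLeaf ≠ (d l).minLeaf := fun l e => by
      have hm1 := minLeaf_mem (hm.canonical ⟨i, hin⟩).leaves_ne_nil
      have hm2 : (d l).minLeaf ∈ (c j).leaves := by
        rw [hj, mem_leaves_node]
        exact ⟨l, minLeaf_mem (hm.canonical' l).leaves_ne_nil⟩
      rw [e] at hm1
      exact hij (congrArg Fin.val ((nodup_leaves_node h.nodup).2 _ _ _ hm1 hm2))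
    simp only [F, lowerSum, List.map_cons, List.map_nil, List.sum_cons, List.sum_nil, add_zero,
      leafSum_word hcj.labels.1, childAt_val, childAt_of_lt c hin, add_lt_add_iff_right]
    rcases lt_or_gt_of_ne hij with hij | hij
    · have hα : (c ⟨i, hin⟩).minLeaf < (c j).minLeaf := hm.strictMono (Fin.lt_def.2 hij)
      have : ∀ l, ¬ (d l).minLeaf < (c ⟨i, hin⟩).minLeaf := fun l =>
        not_lt.2 (hα.le.trans (hdj l))
      simp only [hij, if_true, this, if_false, not_lt.2 hα.le, Finset.sum_const_zero]
      ring
    · have hα : (c j).minLeaf < (c ⟨i, hin⟩).minLeaf := hm.strictMono (Fin.lt_def.2 hij)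
      -- Disjoint leaves exclude equality of smallest leaves, so each `d l` falls on one side.
      have hsum : ∑ l, susp (d l) =
          (∑ l, if (c ⟨i, hin⟩).minLeaf < (d l).minLeaf then susp (d l) else 0) +
          ∑ l, if (d l).minLeaf < (c ⟨i, hin⟩).minLeaf then susp (d l) else 0 := by
        rw [← Finset.sum_add_distrib]
        refine Finset.sum_congr rfl fun l _ => ?_
        rcases lt_or_gt_of_ne (hne l) with h | h
        · simp [h, h.le]
        · simp [h, h.le]
      simp only [not_lt.2 hij.le, hij, hα, if_true, if_false, hS, hsum]
      linear_combination -susp (c ⟨i, hin⟩) * (zmod_add_self (wordDeg y.word) +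
        zmod_add_self (∑ l, if (d l).minLeaf < (c ⟨i, hin⟩).minLeaf then susp (d l) else 0) +
        zmod_add_self 1)
  -- Leaves after `j` in the word: only inversions occur, with no prefix term. The products with
  -- `wordDeg r₂` are separated in `e3` and absorbed by `hS`.
  have e2 : leafSum r₂ F = susp (c j) * (leafSum r₂ fun i =>
      if (childAt c i).minLeaf < (c j).minLeaf then susp (childAt c i) else 0) +
      leafSum y.word fun l => susp (childAt d l) * leafSum r₂ fun i =>
        if (childAt c i).minLeaf < (childAt d l).minLeaf then susp (childAt c i) else 0 := by
    rw [leafSum_word hcj.labels.1]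
    simp only [childAt_val, ← leafSum_mul]
    rw [← leafSum_sum, ← leafSum_add]
    refine leafSum_congr fun i hi => ?_
    have hin := hL i (by simp [hi])
    have hij : i ≠ j := fun e => h2 (e ▸ hi)
    simp only [F, childAt_of_lt c hin]
    rcases lt_or_gt_of_ne hij with hij | hij
    · have hα : (c ⟨i, hin⟩).minLeaf < (c j).minLeaf := hm.strictMono (Fin.lt_def.2 hij)
      have : ∀ l, (c ⟨i, hin⟩).minLeaf < (d l).minLeaf := fun l => hα.trans_le (hdj l)
      simp only [hij, if_true, this, hα, hS, ← Finset.sum_mul]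
      linear_combination -susp (c ⟨i, hin⟩) * zmod_add_self (∑ l, susp (d l))
    · have hα : (c j).minLeaf < (c ⟨i, hin⟩).minLeaf := hm.strictMono (Fin.lt_def.2 hij)
      simp only [not_lt.2 hij.le, hij, not_lt.2 hα.le, if_true, if_false, mul_zero, zero_add,
        Finset.mul_sum]
      refine Finset.sum_congr rfl fun l _ => ?_
      split_ifs <;> ring
  have e3 : (leafSum y.word fun l => susp (childAt d l) * (wordDeg r₂ + leafSum r₂ fun i =>
        if (childAt c i).minLeaf < (childAt d l).minLeaf then susp (childAt c i) else 0)) =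
      wordDeg r₂ * (∑ l, susp (d l)) + leafSum y.word fun l => susp (childAt d l) *
        leafSum r₂ fun i =>
        if (childAt c i).minLeaf < (childAt d l).minLeaf then susp (childAt c i) else 0 := by
    rw [Finset.mul_sum]
    rw [show (∑ l, wordDeg r₂ * susp (d l)) = leafSum y.word fun l => wordDeg r₂ *
      susp (childAt d l) by rw [leafSum_word hcj.labels.1]; simp, ← leafSum_add]
    exact leafSum_congr fun l _ => by ring
  rw [e1, e2, e3]
  linear_combination -wordDeg r₂ * hS - wordDeg r₂ * zmod_add_self (∑ l, susp (d l))

/-- The exponent of the sign of the contraction of an edge above an entry of the root. -/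
lemma IsBarTree.orderExponent_update (h : IsBarTree (node n x c)) {T : BarTree B}
    (hmin : T.minLeaf = (c j).minLeaf) (hS : susp T = susp (c j) + 1)
    {r₁ r₂ : List ((Σ n, B.ι n) ⊕ ℕ)} (hr : x.word = r₁ ++ .inr (j : ℕ) :: r₂)
    (h1 : (j : ℕ) ∉ wordLeaves r₁) (h2 : (j : ℕ) ∉ wordLeaves r₂) :
    BTree.deg B x + 1 + ∑ k ∈ Finset.univ.filter (· < j), susp (c k) +
      orderExponent (c j) + orderExponent T =
    orderExponent (node n x c) + orderExponent (node n x (Function.update c j T)) +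
      wordDeg r₁ + (leafSum r₁ fun i => susp (childAt c i)) + 1 := by
  have hL : ∀ i ∈ wordLeaves r₁ ++ wordLeaves r₂, i < n := fun i hi => by
    rw [← h.labels.1.mem_leaves, ← wordLeaves_word, hr]
    simp only [wordLeaves_append, wordLeaves_inr, List.mem_append, List.mem_cons] at hi ⊢
    tauto
  have hmono : StrictMono fun k => (c k).minLeaf := h.canonical.2.1
  have hk : ∀ r : List ((Σ n, B.ι n) ⊕ ℕ), (j : ℕ) ∉ wordLeaves r →
      keyWord (Function.update c j T) r = keyWord c r := by
    intro r hr
    refine List.map_congr_left fun a ha => ?_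
    rcases a with a | a
    · rfl
    · rw [Sum.elim_inr, Sum.elim_inr, childAt_update]
      rintro rfl
      exact hr (mem_wordLeaves.2 ha)
  have hdeg : ((BTree.deg B x : ℤ) : ZMod 2) = wordDeg r₁ + wordDeg r₂ := by
    rw [← wordDeg_word, hr, wordDeg_append]; simp [wordDeg]
  have hs : ∑ k, orderExponent (c k) + ∑ k, orderExponent (Function.update c j T k) =
      orderExponent (c j) + orderExponent T := by
    rw [← Finset.add_sum_erase _ _ (Finset.mem_univ j),
      ← Finset.add_sum_erase _ (fun k => orderExponent (Function.update c j T k))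
        (Finset.mem_univ j), Function.update_self]
    rw [Finset.sum_congr rfl (g := fun k => orderExponent (c k)) (s₁ := Finset.univ.erase j)
      (f := fun k => orderExponent (Function.update c j T k))
      fun k hk => by rw [Function.update_of_ne (Finset.ne_of_mem_erase hk)]]
    linear_combination zmod_add_self (∑ k ∈ Finset.univ.erase j, orderExponent (c k))
  have hi := inversions_replace (keyWord c r₁) (keyWord c r₂) [((c j).minLeaf + 1, susp (c j) + 1)]
    ((c j).minLeaf + 1, susp (c j))
  have hsing : inversions [((c j).minLeaf + 1, susp (c j) + 1)] = 0 := by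
    simp [inversions, lowerSum]
  rw [hsing, crossInversions_singleton, crossInversions_singleton, crossInversions_keyWord,
    crossInversions_keyWord, lowerSum_keyWord, List.singleton_append] at hi
  have hF := h.leafSum_split hr fun k => if k < j then susp (childAt c k) else 0
  simp only [childAt_val, Fin.val_fin_lt, lt_irrefl, if_false, zero_add] at hF
  rw [hdeg, orderExponent, orderExponent, hr, keyWord_append, keyWord_append, keyWord_inr,
    keyWord_inr, childAt_val, childAt_val, Function.update_self, hk _ h1, hk _ h2, hmin, hS,
    Finset.sum_filter, hF]
  -- The weight of the entry `j` changes by one in the inner contraction. So a leaf of `r₁` numbered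
  -- above `j` contributes its own weight once, and a leaf numbered below `j` contributes it twice,
  -- that is, zero.
  have e1 : (leafSum r₁ fun k => if k < j then susp (childAt c k) else 0) +
      (leafSum r₁ fun i => susp (childAt c i)) =
      (leafSum r₁ fun i => susp (childAt c i) * lowerSum ((childAt c i).minLeaf + 1)
        [((c j).minLeaf + 1, susp (c j))]) +
      leafSum r₁ fun i => susp (childAt c i) * lowerSum ((childAt c i).minLeaf + 1)
        [((c j).minLeaf + 1, susp (c j) + 1)] := by
    rw [← leafSum_add, ← leafSum_add]
    refine leafSum_congr fun i hi => ?_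
    have hin := hL i (by simp [hi])
    have hij : i ≠ j := fun e => h1 (e ▸ hi)
    simp only [lowerSum, List.map_cons, List.map_nil, List.sum_cons, List.sum_nil, add_zero,
      childAt_of_lt c hin, add_lt_add_iff_right]
    rcases lt_or_gt_of_ne hij with hij | hij
    · have hα : (c ⟨i, hin⟩).minLeaf < (c j).minLeaf := hmono (Fin.lt_def.2 hij)
      simp only [hij, if_true, not_lt.2 hα.le, if_false, mul_zero]
      exact zmod_add_self _
    · have hα : (c j).minLeaf < (c ⟨i, hin⟩).minLeaf := hmono (Fin.lt_def.2 hij)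
      simp only [not_lt.2 hij.le, if_false, hα, if_true]
      linear_combination -susp (c ⟨i, hin⟩) * zmod_add_self (susp (c j))
  have e2 : (leafSum r₂ fun k => if k < j then susp (childAt c k) else 0) =
      leafSum r₂ fun i =>
        if (childAt c i).minLeaf < (c j).minLeaf then susp (childAt c i) else 0 := by
    refine leafSum_congr fun i hi => ?_
    have hin := hL i (by simp [hi])
    rw [childAt_of_lt c hin]
    have := hmono.lt_iff_lt (a := ⟨i, hin⟩) (b := j)
    simp only [Fin.lt_def] at this
    simp only [this]
  dsimp only at hi
  have two : (2 : ZMod 2) = 0 := rfl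
  linear_combination e1 + e2 - hs - hi - (wordDeg r₂ * susp (c j) +
    (leafSum r₂ fun i => if (childAt c i).minLeaf < (c j).minLeaf then susp (childAt c i) else 0) *
      susp (c j) + leafSum r₁ fun i => susp (childAt c i)) * two

end Root

end

/-! ### The differential as a signed sum over positions, and its square. -/

section
open OTree

variable {𝕜 : Type u} [Field 𝕜] {M : SigmaModule.{u, v} 𝕜} {B : HomogeneousBasis.{u, v, w} M}

open Classical in
/-- The tree with a given marked word. -/
noncomputable def ofMarkedWord (l : MarkedWord B) : BarTree B :=
  if h : ∃ T, IsBarTree T ∧ markedWord T = l then h.choose else leaf 0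

lemma ofMarkedWord_markedWord {T : BarTree B} (hT : IsBarTree T) :
    ofMarkedWord (markedWord T) = T := by
  have h : ∃ T', IsBarTree T' ∧ markedWord T' = markedWord T := ⟨T, hT, rfl⟩
  rw [ofMarkedWord, dif_pos h]
  exact markedWord_inj h.choose_spec.1 hT h.choose_spec.2

/-- Mark the element at the position `p`. -/
def markAt (l : MarkedWord B) (p : ℕ) : MarkedWord B :=
  l.modify p (Sum.map (fun v => (v.1, true)) id)

/-- The position `p` is the one of an unmarked vertex, different from the root. -/
def IsContractible (l : MarkedWord B) (p : ℕ) : Prop :=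
  0 < p ∧ ∃ v, l[p]? = some (.inl (v, false))

/-- Contract the edge under the vertex at the position `p` of the marked word. -/
noncomputable def contractAt (T : BarTree B) (p : ℕ) : BarTree B :=
  ofMarkedWord (markAt (markedWord T) p)

lemma markAt_append (l₁ l₂ : MarkedWord B) (v b) :
    markAt (l₁ ++ .inl (v, b) :: l₂) l₁.length = l₁ ++ .inl (v, true) :: l₂ := by
  induction l₁ with
  | nil => rfl
  | cons a l ih => simpa [markAt] using ih

lemma length_markAt (l : MarkedWord B) (p : ℕ) : (markAt l p).length = l.length := by
  simp [markAt]

lemma isContractible_iff {l : MarkedWord B} {p : ℕ} : IsContractible l p ↔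
    ∃ l₁ v l₂, l₁ ≠ [] ∧ l = l₁ ++ .inl (v, false) :: l₂ ∧ l₁.length = p := by
  constructor
  · rintro ⟨h0, v, h⟩
    obtain ⟨hp, h⟩ := List.getElem?_eq_some_iff.1 h
    refine ⟨l.take p, v, l.drop (p + 1), ?_, ?_, ?_⟩
    · rw [← List.length_pos_iff_ne_nil, List.length_take]; omega
    · rw [← h, List.cons_getElem_drop_succ, List.take_append_drop]
    · rw [List.length_take]; omega
  · rintro ⟨l₁, v, l₂, h0, rfl, rfl⟩
    exact ⟨List.length_pos_iff_ne_nil.2 h0, v, by simp⟩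

lemma IsContractible.lt {l : MarkedWord B} {p : ℕ} (h : IsContractible l p) : p < l.length := by
  obtain ⟨_, v, h⟩ := h
  exact (List.getElem?_eq_some_iff.1 h).1

lemma contractAt_eq {T T' : BarTree B} (hT' : IsBarTree T') {l₁ l₂ : MarkedWord B} {v}
    (h : markedWord T = l₁ ++ .inl (v, false) :: l₂)
    (h' : markedWord T' = l₁ ++ .inl (v, true) :: l₂) : contractAt T l₁.length = T' := by
  rw [contractAt, h, markAt_append, ← h', ofMarkedWord_markedWord hT']

lemma IsContractible.contracts {T : BarTree B} (hT : IsBarTree T) {p : ℕ}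
    (hp : IsContractible (markedWord T) p) : Contracts T (contractAt T p) ∧
      markedWord (contractAt T p) = markAt (markedWord T) p := by
  obtain ⟨l₁, v, l₂, h0, h, rfl⟩ := isContractible_iff.1 hp
  obtain ⟨T', h1, h2⟩ := exists_contracts hT h0 h
  rw [contractAt_eq (h1.isBarTree hT).1 h h2]
  exact ⟨h1, by rw [h2, h, markAt_append]⟩

lemma isContractible_markAt {l : MarkedWord B} {p q : ℕ} (hp : IsContractible l p) :
    IsContractible (markAt l p) q ↔ q ≠ p ∧ IsContractible l q := by
  by_cases h : q = p
  · subst h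
    obtain ⟨_, v, hv⟩ := hp
    simp [IsContractible, markAt, hv]
  · simp [IsContractible, markAt, Ne.symm h, h]

lemma markAt_comm (l : MarkedWord B) (p q : ℕ) : markAt (markAt l p) q = markAt (markAt l q) p := by
  refine List.ext_getElem? fun i => ?_
  simp only [markAt, List.getElem?_modify]
  by_cases h : p = i <;> by_cases h' : q = i <;> simp [h, h']

/-- Marking a vertex removes its suspension and so changes the parity of all later prefixes. This
asymmetry between `p` and `q` is what makes two contractions anticommute. -/
lemma markedDeg_take_markAt {l : MarkedWord B} {p q : ℕ} (hp : IsContractible l p) :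
    markedDeg ((markAt l p).take q) = markedDeg (l.take q) + if p < q then 1 else 0 := by
  obtain ⟨l₁, v, l₂, h0, rfl, rfl⟩ := isContractible_iff.1 hp
  rw [markAt_append]
  by_cases h : l₁.length < q
  · obtain ⟨k, rfl⟩ := Nat.exists_eq_add_of_lt h
    rw [if_pos h, add_assoc, List.take_length_add_append, List.take_length_add_append]
    simp [markedDeg]
    ring
  · rw [if_neg h, add_zero, List.take_append_of_le_length (not_lt.1 h),
      List.take_append_of_le_length (not_lt.1 h)]

open Classical in
/-- The term of the differential given by the contraction at the position `p`. -/
noncomputable def diffTerm (T : BarTree B) (p : ℕ) : BarTensor B :=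
  if IsContractible (markedWord T) p then Finsupp.single (contractAt T p)
    (sg 𝕜 (orderExponent T + orderExponent (contractAt T p) +
      markedDeg ((markedWord T).take p) + 1)) else 0

lemma diffTerm_of_split {T T' : BarTree B} (hT' : IsBarTree T') {l₁ l₂ : MarkedWord B} {v}
    (h0 : l₁ ≠ []) (h : markedWord T = l₁ ++ .inl (v, false) :: l₂)
    (h' : markedWord T' = l₁ ++ .inl (v, true) :: l₂) : diffTerm T l₁.length =
      Finsupp.single T' (sg 𝕜 (orderExponent T + orderExponent T' + markedDeg l₁ + 1)) := by
  rw [diffTerm, if_pos (isContractible_iff.2 ⟨l₁, v, l₂, h0, h, rfl⟩), contractAt_eq hT' h h', h]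
  simp

lemma diffTerm_of_not {T : BarTree B} {l₁ l₂ : MarkedWord B} {a}
    (h : markedWord T = l₁ ++ a :: l₂) (ha : ∀ v, a ≠ .inl (v, false)) :
    diffTerm T l₁.length = 0 := by
  rw [diffTerm, if_neg]
  rintro ⟨_, v, hv⟩
  rw [h] at hv
  simp at hv
  exact ha v hv

lemma diffTerm_zero (T : BarTree B) : diffTerm T 0 = 0 := if_neg fun h => lt_irrefl _ h.1

/-- The sum over the positions of a word `markWord h r`, gathered according to the leaves of `r`. -/
lemma sum_range_markWord {A : Type*} [AddCommMonoid A] {h : ℕ → MarkedWord B}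
    {r : List ((Σ n, B.ι n) ⊕ ℕ)} {f : ℕ → A} {g : ℕ → A}
    (h0 : ∀ r₁ v r₂, r = r₁ ++ .inl v :: r₂ → f (markWord h r₁).length = 0)
    (h1 : ∀ r₁ i r₂, r = r₁ ++ .inr i :: r₂ →
      ∑ p ∈ Finset.range (h i).length, f ((markWord h r₁).length + p) = g i) :
    ∑ p ∈ Finset.range (markWord h r).length, f p = ((wordLeaves r).map g).sum := by
  induction r generalizing f with
  | nil => simp
  | cons a r ih =>
    rcases a with v | i
    · rw [markWord_inl, List.length_cons, Finset.sum_range_succ', ih]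
      · have := h0 [] v r rfl
        simp at this
        simp [this]
      · intro r₁ v' r₂ hr
        have := h0 (.inl v :: r₁) v' r₂ (by rw [hr]; rfl)
        simpa using this
      · intro r₁ i r₂ hr
        have := h1 (.inl v :: r₁) i r₂ (by rw [hr]; rfl)
        rw [← this]
        refine Finset.sum_congr rfl fun p _ => ?_
        simp [add_right_comm]
    · rw [markWord_inr, List.length_append, Finset.sum_range_add, ih]
      · have := h1 [] i r rfl
        simp at this
        simp [this]
      · intro r₁ v' r₂ hr
        have := h0 (.inr i :: r₁) v' r₂ (by rw [hr]; rfl)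
        simpa using this
      · intro r₁ k r₂ hr
        have := h1 (.inr i :: r₁) k r₂ (by rw [hr]; rfl)
        rw [← this]
        refine Finset.sum_congr rfl fun p _ => ?_
        simp [add_assoc]

lemma length_unmarkHead (l : MarkedWord B) : (unmarkHead l).length = l.length := by
  rcases l with _ | ⟨⟨u, b⟩ | i, l⟩ <;> rfl

/-- One unmarked vertex becomes marked, so one suspension is lost. -/
lemma Contracts.susp_eq {T T' : BarTree B} (h : Contracts T T') (hT : IsBarTree T) :
    susp T' = susp T + 1 := by
  obtain ⟨h1, h2, l₁, v, l₂, h3, h4, h5⟩ := h.isBarTree hT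
  rw [← markedDeg_markedWord h1.labels, ← markedDeg_markedWord hT.labels, h4, h5]
  simp [markedDeg]
  ring

/-- The differential of a treewise tensor is a sum over the positions of its word. -/
theorem barDiffTree_eq {T : BarTree B} (hT : IsBarTree T) :
    barDiffTree B T = ∑ p ∈ Finset.range (markedWord T).length, diffTerm T p := by
  induction T with
  | leaf i => simp [barDiffTree, markedWord, diffTerm_zero]
  | node n x c ih =>
    let H : ℕ → MarkedWord B := fun i => markedWord (childAt c i)
    -- The positions in the word of the entry `j` correspond to the edge from the root vertex to
    -- this entry, if it is not a leaf, and to the internal edges of the entry.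
    have hkey : ∀ r₁ (j : Fin n) r₂, x.word = r₁ ++ .inr (j : ℕ) :: r₂ →
        ∑ p ∈ Finset.range (H j).length, diffTerm (node n x c) ((markWord H r₁).length + p) =
        contractRoot B x c j + sgn 𝕜 (BTree.deg B x + 1 +
          ∑ k ∈ Finset.univ.filter (· < j), suspendedDeg B (c k)) •
        Finsupp.mapDomain (fun T => node n x (Function.update c j T)) (barDiffTree B (c j)) := by
      intro r₁ j r₂ hr
      have hnd : (j : ℕ) ∉ wordLeaves r₁ ∧ (j : ℕ) ∉ wordLeaves r₂ := by
        have := hT.labels.1.nodup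
        rw [← wordLeaves_word, hr, wordLeaves_append, wordLeaves_inr,
          List.nodup_append] at this
        exact ⟨fun h1 => this.2.2 _ h1 j (by simp) rfl, (List.nodup_cons.1 this.2.1).1⟩
      have hne := markWord_ne_nil (h := H) hT.labels.2.1 hr
      have hpre : markedDeg (unmarkHead (markWord H r₁)) =
          wordDeg r₁ + (leafSum r₁ fun i => susp (childAt c i)) + 1 := by
        rw [markedDeg_unmarkHead hT.labels.2.1 hr (fun h => hne (by rw [h]; rfl)),
          markedDeg_markWord]
        congr 2
        exact leafSum_congr fun i _ => markedDeg_markedWord (hT.entry i).labels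
      have hsplit := markedWord_node_split (c := c) hT.labels.2.1 hr
      have hlen : (markWord H r₁).length = (unmarkHead (markWord H r₁)).length :=
        (length_unmarkHead _).symm
      have hHj : H j = markedWord (c j) := by simp [H]
      have hcpos : ∃ N, (markedWord (c j)).length = N + 1 := by
        rcases markedWord_head (hT.child j).labels with ⟨i, e⟩ | ⟨u, l, e⟩ <;> simp [e]
      obtain ⟨N, hN⟩ := hcpos
      -- The position `0` of the entry is split off: it gives the contraction at the root, and
      -- nothing in the differential of the entry itself. The other positions are matched one by
      -- one.
      rw [ih j (hT.child j), hHj, hN, Finset.sum_range_succ', Finset.sum_range_succ',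
        diffTerm_zero]
      simp only [add_zero]
      rw [add_comm]
      congr 1
      · rw [hlen]
        cases hcj : c j with
        | leaf i =>
          rw [hcj] at hsplit
          rw [diffTerm_of_not hsplit (by simp), contractRoot, hcj]
        | node m y d =>
          have hy := (hT.child j).labels
          rw [hcj] at hy
          obtain ⟨v, l, e1, e2⟩ := markedWord_node_label (c := d) hy.2.1
          have h1 := hT.contract hcj
          rw [hcj, e1] at hsplit
          have hsplit' := hT.markedWord_contractTree hcj hr hnd.1 hnd.2
          rw [e2] at hsplit'
          rw [diffTerm_of_split h1.1 (unmarkHead_ne_nil hne) hsplit hsplit', contractRoot, hcj]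
          dsimp only
          rw [sgn_eq_sg, hT.contractExponent_eq hcj hr hnd.1 hnd.2, hpre]
          congr 2
          linear_combination zmod_add_self 1
      · rw [Finsupp.mapDomain_finsetSum, Finset.smul_sum]
        refine Finset.sum_congr rfl fun p hpN => ?_
        by_cases hp : IsContractible (markedWord (c j)) (p + 1)
        · obtain ⟨hc, hmw⟩ := hp.contracts (hT.child j)
          obtain ⟨l₁, v, l₂, h0, h, hl⟩ := isContractible_iff.1 hp
          rw [← hl] at hc hmw ⊢
          rw [h, markAt_append] at hmw
          obtain ⟨hb, hperm, _⟩ := hc.isBarTree (hT.child j)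
          have hupd := hT.update hb hperm
          have hsplit' := markedWord_update (c := c) hT.labels.2.1 hr hnd.1 hnd.2
            (contractAt (c j) l₁.length)
          rw [diffTerm_of_split hb h0 h hmw, Finsupp.mapDomain_single, Finsupp.smul_single,
            smul_eq_mul, sgn_eq_sg, ← sg_add]
          rw [h] at hsplit
          rw [hmw] at hsplit'
          have := diffTerm_of_split (T := node n x c) hupd.1
            (l₁ := unmarkHead (markWord H r₁) ++ l₁)
            (l₂ := l₂ ++ markWord (fun i => markedWord (childAt c i)) r₂) (v := v)
            (by simp [h0]) (by rw [hsplit]; simp [H]) (by rw [hsplit']; simp [H])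
          rw [List.length_append, length_unmarkHead] at this
          rw [this, markedDeg_append, hpre]
          have hε := hT.orderExponent_update (minLeaf_eq_of_perm hperm)
            (hc.susp_eq (hT.child j)) hr hnd.1 hnd.2
          congr 2
          push_cast
          simp only [susp] at hε ⊢
          linear_combination -hε
        · rw [diffTerm, diffTerm, if_neg hp, if_neg]
          · simp
          · intro hq
            refine hp ⟨Nat.succ_pos _, ?_⟩
            obtain ⟨_, v, hv⟩ := hq
            refine ⟨v, ?_⟩
            rw [hsplit, hlen, List.getElem?_append_right (Nat.le_add_right _ _),
              Nat.add_sub_cancel_left, List.getElem?_append_left (by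
                have := Finset.mem_range.1 hpN
                omega)] at hv
            exact hv
    rw [markedWord_node, length_unmarkHead, sum_range_markWord (h := H) (g := fun i =>
      if h : i < n then contractRoot B x c ⟨i, h⟩ + sgn 𝕜 (BTree.deg B x + 1 +
          ∑ k ∈ Finset.univ.filter (· < (⟨i, h⟩ : Fin n)), suspendedDeg B (c k)) •
        Finsupp.mapDomain (fun T => node n x (Function.update c ⟨i, h⟩ T))
          (barDiffTree B (c ⟨i, h⟩)) else 0), wordLeaves_word, (hT.labels.1.2.map _).sum_eq,
      ← List.map_coe_finRange_eq_range, List.map_map, barDiffTree, ← Finset.sum_add_distrib,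
      Fin.sum_univ_def]
    · congr 2
      funext k
      simp
    · intro r₁ v r₂ hr
      cases r₁ with
      | nil => exact diffTerm_zero _
      | cons a r₁ =>
        have hmw : markedWord (node n x c) = unmarkHead (markWord H (a :: r₁)) ++
            .inl (v, true) :: markWord H r₂ := by
          rw [markedWord_node, hr, markWord_append, unmarkHead_append, markWord_inl]
          obtain ⟨m, b, d, rfl⟩ := exists_node_of_pos hT.labels.2.1
          simp only [word, List.cons_append, List.cons.injEq] at hr
          rw [← hr.1]; simp
        rw [← length_unmarkHead, diffTerm_of_not hmw (by simp)]
    · intro r₁ i r₂ hr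
      have hi : i < n := by
        rw [← hT.labels.1.mem_leaves, ← wordLeaves_word, hr]; simp
      rw [dif_pos hi]
      exact hkey r₁ ⟨i, hi⟩ r₂ hr

lemma barDiff_single (T : BarTree B) (a : 𝕜) :
    barDiff B (Finsupp.single T a) = a • barDiffTree B T := by
  simp [barDiff]

/-- The differential squares to zero. -/
theorem barDiff_barDiffTree {T : BarTree B} (hT : IsBarTree T) :
    barDiff B (barDiffTree B T) = 0 := by
  classical
  set l := markedWord T with hl
  -- The contraction at `p` followed by that at `q`. The order exponent of the intermediate tree
  -- occurs twice and disappears; the last term is the suspension lost at `p`, seen from `q` when `p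
  -- < q`.
  let D : ℕ × ℕ → BarTensor B := fun z =>
    if IsContractible l z.1 ∧ z.2 ≠ z.1 ∧ IsContractible l z.2 then
      Finsupp.single (ofMarkedWord (markAt (markAt l z.1) z.2))
        (sg 𝕜 (orderExponent T + orderExponent (ofMarkedWord (markAt (markAt l z.1) z.2)) +
          markedDeg (l.take z.1) + markedDeg (l.take z.2) + if z.1 < z.2 then 1 else 0)) else 0
  have hD : barDiff B (barDiffTree B T) =
      ∑ z ∈ Finset.range l.length ×ˢ Finset.range l.length, D z := by
    rw [barDiffTree_eq hT, map_sum, Finset.sum_product]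
    refine Finset.sum_congr rfl fun p _ => ?_
    by_cases hp : IsContractible l p
    · obtain ⟨hc, hmw⟩ := hp.contracts hT
      have hb := (hc.isBarTree hT).1
      rw [diffTerm, if_pos hp, barDiff_single, barDiffTree_eq hb, hmw, length_markAt,
        Finset.smul_sum]
      refine Finset.sum_congr rfl fun q _ => ?_
      rw [diffTerm, hmw]
      by_cases hq : q ≠ p ∧ IsContractible l q
      · rw [if_pos ((isContractible_markAt hp).2 hq), markedDeg_take_markAt hp,
          Finsupp.smul_single, smul_eq_mul, ← sg_add]
        simp only [D, hp, hq, if_true, ne_eq, not_false_eq_true, and_self]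
        rw [contractAt, hmw]
        congr 2
        linear_combination zmod_add_self (orderExponent (contractAt T p)) + zmod_add_self 1
      · rw [if_neg fun h => hq ((isContractible_markAt hp).1 h), smul_zero]
        exact (if_neg fun h => hq h.2).symm
    · rw [diffTerm, if_neg hp, map_zero]
      exact (Finset.sum_eq_zero fun q _ => if_neg fun h => hp h.1).symm
  rw [hD]
  -- Exchanging `p` and `q` gives the same tree, since markings commute, with the opposite sign.
  refine Finset.sum_involution (fun z _ => (z.2, z.1)) ?_ ?_ ?_ ?_
  · rintro ⟨p, q⟩ _
    simp only [D]
    by_cases h : IsContractible l p ∧ q ≠ p ∧ IsContractible l q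
    · have h2 : IsContractible l q ∧ p ≠ q ∧ IsContractible l p := ⟨h.2.2, h.2.1.symm, h.1⟩
      rw [if_pos h, if_pos h2, markAt_comm l q p, ← Finsupp.single_add]
      have : ∀ a b : ZMod 2, a + 1 = b → sg 𝕜 a + sg 𝕜 b = 0 := by
        rintro a _ rfl
        rcases zmod_two_cases a with rfl | rfl <;> simp [sg, show (1 + 1 : ZMod 2) = 0 from rfl]
      rw [this, Finsupp.single_zero]
      rcases lt_or_gt_of_ne h.2.1 with h' | h'
      · simp only [h', h'.le.not_gt, if_true, if_false]; ring
      · simp only [h', h'.le.not_gt, if_true, if_false]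
        linear_combination zmod_add_self 1
    · rw [if_neg h, if_neg fun h' => h ⟨h'.2.2, h'.2.1.symm, h'.1⟩, add_zero]
  · rintro ⟨p, q⟩ _ h0 h
    simp only [Prod.mk.injEq] at h
    exact h0 (if_neg fun h' => h'.2.1 h.1)
  · rintro ⟨p, q⟩ h
    simp only [Finset.mem_product] at h ⊢
    exact ⟨h.2, h.1⟩
  · rintro ⟨p, q⟩ _; rfl

end

/-! ### Trees with one varying label, and the relations of the bar construction. -/

section
open OTree

variable {𝕜 : Type u} [Field 𝕜] {M : SigmaModule.{u, v} 𝕜} {B : HomogeneousBasis.{u, v, w} M}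

/-! ### Contractions of varying trees -/

section Replace

variable {n m : ℕ} {x y : BTree B} {c c' : Fin n → BarTree B} {j : Fin n}
  {d d' : Fin m → BarTree B}

lemma subtreeRank_congr (hc : ∀ i, i ≠ j → (c' i).minLeaf = (c i).minLeaf)
    (hd : ∀ l, (d' l).minLeaf = (d l).minLeaf) : subtreeRank c' j d' = subtreeRank c j d := by
  funext a
  rw [subtreeRank, subtreeRank]
  congr 2
  · refine Finset.filter_congr fun k _ => ?_
    by_cases hk : k = j
    · simp [hk]
    · rw [hc k hk]
  · exact Finset.filter_congr fun l _ => by rw [hd]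

/-- The new label sees the entries through the order of their smallest leaves alone. -/
lemma contractLabel_congr (hc : ∀ i, i ≠ j → (c' i).minLeaf = (c i).minLeaf)
    (hd : ∀ l, (d' l).minLeaf = (d l).minLeaf) :
    contractLabel x c' j y d' = contractLabel x c j y d := by
  rw [contractLabel, contractLabel, subtreeRank_congr hc hd]
  refine bind_congr fun i _ => ?_
  have hd' : ∀ l, (childAt d' l).minLeaf = (childAt d l).minLeaf := fun l => by
    by_cases hl : l < m
    · rw [childAt_of_lt _ hl, childAt_of_lt _ hl, hd]
    · simp [childAt, hl]
  by_cases hi : i = j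
  · simp only [hi, if_true, hd']
  · have hc' : (childAt c' i).minLeaf = (childAt c i).minLeaf := by
      by_cases hin : i < n
      · rw [childAt_of_lt _ hin, childAt_of_lt _ hin, hc _ fun e => hi (congrArg Fin.val e)]
      · simp [childAt, hin]
    simp only [hi, if_false, hc']

lemma IsMergeable.contractExponent_cast (h : IsMergeable c j d) :
    (contractExponent B x c j y d : ZMod 2) = (BTree.deg B y + 1) *
      (∑ k ∈ Finset.univ.filter (· < j), susp (c k)) + BTree.deg B x +
      BTree.deg B y * BTree.degAfter B j x +
      ∑ k, if j < k then susp (c k) *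
        ∑ l, (if (c k).minLeaf < (d l).minLeaf then susp (d l) else 0) else 0 := by
  rw [← h.koszulExponent_eq, contractExponent]
  push_cast
  rfl

lemma IsMergeable.contractExponent_congr (h : IsMergeable c j d) (h' : IsMergeable c' j d')
    (hc : ∀ i, i ≠ j → (c' i).minLeaf = (c i).minLeaf ∧ susp (c' i) = susp (c i))
    (hd : ∀ l, (d' l).minLeaf = (d l).minLeaf ∧ susp (d' l) = susp (d l)) :
    sgn 𝕜 (contractExponent B x c' j y d') = sgn 𝕜 (contractExponent B x c j y d) := by
  rw [sgn_eq_sg, sgn_eq_sg, h.contractExponent_cast, h'.contractExponent_cast]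
  congr 3
  · congr 2
    refine Finset.sum_congr rfl fun k hk => ?_
    exact (hc k (Finset.mem_filter.1 hk).2.ne).2
  · funext k
    by_cases hk : j < k
    · simp only [hk, if_true, hc k hk.ne', hd]
    · simp [hk]

lemma node_ext {X : ℕ → Type*} {N N' : ℕ} (hN : N = N') {x : ∀ n, X n} {e : Fin N → OTree X}
    {e' : Fin N' → OTree X} (h : ∀ k < N, childAt e k = childAt e' k) :
    node N (x N) e = node N' (x N') e' := by
  subst hN
  congr 1
  funext k
  simpa using h k k.2

lemma IsMergeable.ne (h : IsMergeable c j d) {i : Fin n} (hi : i ≠ j) (l : Fin m) :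
    (c i).minLeaf ≠ (d l).minLeaf := by
  intro e
  have h1 := minLeaf_mem (h.canonical i).leaves_ne_nil
  have h2 : (d l).minLeaf ∈ (c j).leaves := by
    rw [h.leaves]
    exact List.mem_flatMap.2 ⟨_, List.mem_ofFn.2 ⟨l, rfl⟩,
      minLeaf_mem (h.canonical' l).leaves_ne_nil⟩
  rw [e] at h1
  have h3 := (List.nodup_flatMap.1 h.nodup).2
  rw [List.pairwise_ofFn] at h3
  rcases lt_or_gt_of_ne hi with hi | hi
  · exact h3 hi h1 h2
  · exact h3 hi h2 h1

open Classical in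
-- Sorting depends on smallest leaves alone, so replacing one of the merged entries by a tree with
-- the same smallest leaf commutes with the contraction.
lemma IsBarTree.contractTree_replace (h : IsBarTree (node n x c)) (hj : c j = node m y d)
    (h' : IsBarTree (node n x c')) (hj' : c' j = node m y d') {T T' : BarTree B}
    (hmin : T'.minLeaf = T.minLeaf) (hc : ∀ i, i ≠ j → c' i = if c i = T then T' else c i)
    (hd : ∀ l, d' l = if d l = T then T' else d l) {q} (hq : contractEntries c j d q = T) :
    contractTree B x c' j y d' =
      node _ (contractLabel x c j y d) (Function.update (contractEntries c j d) q T') := by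
  have hm := h.isMergeable hj
  have hm' := h'.isMergeable hj'
  have hite : ∀ U : BarTree B, (if U = T then T' else U).minLeaf = U.minLeaf := fun U => by
    by_cases hU : U = T
    · rw [if_pos hU, hmin, hU]
    · rw [if_neg hU]
  have hc1 : ∀ i, i ≠ j → (c' i).minLeaf = (c i).minLeaf := fun i hi => by rw [hc i hi, hite]
  have hd1 : ∀ l, (d' l).minLeaf = (d l).minLeaf := fun l => by rw [hd, hite]
  rw [h'.contractTree_eq hj', contractLabel_congr hc1 hd1]
  refine node_ext (x := fun _ => contractLabel x c j y d)
    (by rw [length_mergedEntries, length_mergedEntries]) fun k hk => ?_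
  rw [length_mergedEntries, ← length_mergedEntries (c := c) (j := j) (d := d)] at hk
  obtain ⟨k, rfl⟩ : ∃ k' : Fin _, k = k'.val := ⟨⟨k, hk⟩, rfl⟩
  have hU := mem_contractEntries (c := c) (j := j) (d := d) k
  have hrk := hm.rank_contractEntries k
  set U := contractEntries c j d k with hUk
  have hU' : (if U = T then T' else U) ∈ mergedEntries B c' j d' := by
    rcases mem_mergedEntries.1 hU with ⟨i, hi, e⟩ | ⟨l, e⟩
    · rw [e, ← hc i hi]; exact mem_mergedEntries.2 (.inl ⟨i, hi, rfl⟩)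
    · rw [e, ← hd l]; exact mem_mergedEntries.2 (.inr ⟨l, rfl⟩)
  -- An entry is placed at the position given by its rank, and the ranks do not change under the
  -- replacement.
  have h1 := (hm'.childAt_rank hU').2
  rw [hite, subtreeRank_congr hc1 hd1, hrk] at h1
  rw [h1, childAt_val]
  by_cases hkq : k = q
  · rw [hkq, Function.update_self, if_pos (by rw [hUk, hkq, hq])]
  · rw [Function.update_of_ne hkq, if_neg, hUk]
    intro e
    rw [← hq, hUk] at e
    exact hkq (hm.strictMono_contractEntries.injective (congrArg minLeaf e))

lemma mergedEntries_update (T : BarTree B) :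
    mergedEntries B (Function.update c j T) j d = mergedEntries B c j d := by
  rw [mergedEntries, mergedEntries]
  congr 1
  · congr 1
    refine List.ext_getElem (by simp) fun i h1 h2 => ?_
    simp only [List.length_take, List.length_ofFn] at h1
    simp only [List.getElem_take, List.getElem_ofFn]
    rw [Function.update_of_ne]
    intro e
    have := congrArg Fin.val e
    dsimp only at this
    omega
  · refine List.ext_getElem (by simp) fun i h1 h2 => ?_
    simp only [List.getElem_drop, List.getElem_ofFn]
    rw [Function.update_of_ne]
    intro e
    have := congrArg Fin.val e
    dsimp only at this
    omega

lemma contractTree_update (T : BarTree B) :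
    contractTree B x (Function.update c j T) j y d = contractTree B x c j y d := by
  have h1 : subtreeRank (Function.update c j T) j d = subtreeRank c j d :=
    subtreeRank_congr (fun i hi => by rw [Function.update_of_ne hi]) fun _ => rfl
  unfold contractTree mergedSort
  rw [mergedEntries_update, h1]
  congr 1
  refine bind_congr fun i _ => ?_
  by_cases hi : i < n
  · by_cases hij : (⟨i, hi⟩ : Fin n) = j
    · simp [hi, hij]
    · simp [hi, hij]
  · simp [hi]

end Replace

lemma contractRoot_of_node {n m : ℕ} {x y : BTree B} {c : Fin n → BarTree B} {j : Fin n}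
    {d : Fin m → BarTree B} (h : c j = node m y d) : contractRoot B x c j =
      Finsupp.single (contractTree B x c j y d) (sgn 𝕜 (contractExponent B x c j y d)) := by
  rw [contractRoot, h]

lemma contractRoot_of_leaf {n : ℕ} {x : BTree B} {c : Fin n → BarTree B} {j : Fin n} {i : ℕ}
    (h : c j = leaf i) : contractRoot B x c j = 0 := by
  rw [contractRoot, h]

/-! ### Contexts -/

/-- The maps that insert a label at a given vertex, with `n` entries, of a tree. -/
inductive IsContext (n : ℕ) : (BTree B → BarTree B) → Prop
  | root (c : Fin n → BarTree B) : IsContext n fun t => node n t c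
  | above {C : BTree B → BarTree B} (m : ℕ) (y : BTree B) (c : Fin m → BarTree B) (j : Fin m) :
      IsContext n C → IsContext n fun t => node m y (Function.update c j (C t))

namespace IsContext

variable {n : ℕ} {C : BTree B → BarTree B}

lemma leaves_eq (hC : IsContext n C) (t t' : BTree B) : (C t).leaves = (C t').leaves := by
  induction hC with
  | root c => simp [leaves]
  | above m y c j hC ih =>
    simp only [leaves]
    congr 2
    funext k
    by_cases hk : k = j
    · subst hk; simpa using ih
    · simp [hk]

lemma minLeaf_eq (hC : IsContext n C) (t t' : BTree B) : (C t).minLeaf = (C t').minLeaf := by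
  rw [minLeaf, minLeaf, hC.leaves_eq t t']

lemma injective (hC : IsContext n C) : Function.Injective C := by
  induction hC with
  | root c => intro t t' h; simpa using h
  | above m y c j hC ih =>
    intro t t' h
    simp only [node.injEq, heq_eq_eq, true_and] at h
    have := congrFun h j
    simp only [Function.update_self] at this
    exact ih this

lemma susp_eq (hC : IsContext n C) {t t' : BTree B} (h : BTree.deg B t = BTree.deg B t') :
    susp (C t) = susp (C t') := by
  induction hC with
  | root c => rw [susp_node, susp_node, h]
  | above m y c j hC ih =>
    rw [susp_node, susp_node]
    congr 1
    refine Finset.sum_congr rfl fun k _ => ?_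
    by_cases hk : k = j
    · subst hk; simpa using ih
    · simp [hk]

lemma isBarRelation {R : ℕ → Set (BTensor B)} (hC : IsContext n C) {x : BTensor B}
    (hx : x ∈ operadIdeal B R n) : IsBarRelation B R (Finsupp.mapDomain C x) := by
  induction hC with
  | root c => exact .root n x c hx
  | @above C m y c j hC ih =>
    have := IsBarRelation.above m y c j _ ih
    rwa [← Finsupp.mapDomain_comp] at this

end IsContext

/-- A relation becomes a fixed context applied to an element of the ideal, so that its differential
can be studied as a sum over one varying label. -/
lemma exists_isContext {R : ℕ → Set (BTensor B)} {z : BarTensor B} (h : IsBarRelation B R z) :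
    ∃ n C x, IsContext n C ∧ x ∈ operadIdeal B R n ∧ z = Finsupp.mapDomain C x := by
  induction h with
  | root n x c hx => exact ⟨n, _, x, .root c, hx, rfl⟩
  | above m y c j z h ih =>
    obtain ⟨n, C, x, hC, hx, rfl⟩ := ih
    exact ⟨n, _, x, .above m y c j hC, hx, by rw [← Finsupp.mapDomain_comp]; rfl⟩

/-- The relations of the bar construction, on the trees with given leaves. -/
noncomputable def treeRelations (R : ℕ → Set (BTensor B)) (L : List ℕ) : Submodule 𝕜 (BarTensor B) :=
  Submodule.span 𝕜 {z | IsBarRelation B R z ∧ ∀ T ∈ z.support, IsBarTree T ∧ T.leaves.Perm L}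

lemma barRelations_eq (R : ℕ → Set (BTensor B)) (r : ℕ) :
    barRelations B R r = treeRelations R (List.range r) := by
  rw [barRelations, treeRelations]
  congr 1
  ext z
  refine and_congr_right fun _ => ?_
  exact forall₂_congr fun T _ => isBarTree_iff

section Relations

variable {R : ℕ → Set (BTensor B)} {L : List ℕ} {n : ℕ} {C : BTree B → BarTree B} {x : BTensor B}

lemma IsContext.mapDomain_mem (hC : IsContext n C) (hx : x ∈ operadIdeal B R n)
    (hg : ∀ t ∈ x.support, IsBarTree (C t) ∧ (C t).leaves.Perm L) :
    Finsupp.mapDomain C x ∈ treeRelations R L := by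
  classical
  refine Submodule.subset_span ⟨hC.isBarRelation hx, fun T hT => ?_⟩
  obtain ⟨t, ht, rfl⟩ := Finset.mem_image.1 (Finsupp.mapDomain_support hT)
  exact hg t ht

lemma IsContext.sum_mem (hC : IsContext n C) (hx : x ∈ operadIdeal B R n)
    (hg : ∀ t ∈ x.support, IsBarTree (C t) ∧ (C t).leaves.Perm L) (a : 𝕜) :
    ∑ t ∈ x.support, x t • Finsupp.single (C t) a ∈ treeRelations R L := by
  have := (treeRelations R L).smul_mem a (hC.mapDomain_mem hx hg)
  rw [Finsupp.mapDomain, Finsupp.sum, Finset.smul_sum] at this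
  convert this using 2
  simp [mul_comm]

lemma treeRelations_map {m : ℕ} {y : BTree B} {c : Fin m → BarTree B} {j : Fin m} {L' : List ℕ}
    (h : ∀ T, IsBarTree T → T.leaves.Perm L' → IsBarTree (node m y (Function.update c j T)) ∧
      (node m y (Function.update c j T) : BarTree B).leaves.Perm L) {z : BarTensor B}
    (hz : z ∈ treeRelations R L') :
    Finsupp.mapDomain (fun T => node m y (Function.update c j T)) z ∈ treeRelations R L := by
  classical
  have : treeRelations R L' ≤ (treeRelations R L).comap
      (Finsupp.lmapDomain 𝕜 𝕜 fun T => node m y (Function.update c j T)) := by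
    refine Submodule.span_le.2 ?_
    rintro z ⟨hz, hg⟩
    refine Submodule.subset_span ⟨.above m y c j z hz, fun T hT => ?_⟩
    obtain ⟨t, ht, rfl⟩ := Finset.mem_image.1 (Finsupp.mapDomain_support hT)
    exact h t (hg t ht).1 (hg t ht).2
  exact this hz

end Relations

end

/-! ### Stability of the relations under the differential. -/

section
open OTree

variable {𝕜 : Type u} [Field 𝕜] {M : SigmaModule.{u, v} 𝕜} {B : HomogeneousBasis.{u, v, w} M}

lemma sgn_add (a b : ℤ) : sgn 𝕜 (a + b) = sgn 𝕜 a * sgn 𝕜 b := by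
  simp only [sgn_eq_sg, Int.cast_add, sg_add]

lemma contracts_of_mem_support {T T' : BarTree B} (hT : IsBarTree T)
    (h : T' ∈ (barDiffTree (𝕜 := 𝕜) B T).support) : Contracts T T' := by
  classical
  rw [barDiffTree_eq hT] at h
  obtain ⟨p, -, h⟩ := exists_mem_support_of_mem_support_sum h
  rw [diffTerm] at h
  split_ifs at h with hp
  · rw [Finset.mem_singleton.1 (Finsupp.support_single_subset h)]
    exact (hp.contracts hT).1
  · simp at h

section Differential

variable {R : ℕ → Set (BTensor B)} {L : List ℕ} {n : ℕ} {x : BTensor B}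

/-- Contractions of an edge above the vertex labelled by a relation. -/
lemma sum_contractRoot_label_mem (hR : ∀ r, ∀ x ∈ R r, x ∈ freeOperad B r)
    {c : Fin n → BarTree B} (hx : x ∈ operadIdeal B R n) {D : ℤ}
    (hD : ∀ t ∈ x.support, BTree.deg B t = D)
    (hg : ∀ t ∈ x.support, IsBarTree (node n t c) ∧ (node n t c : BarTree B).leaves.Perm L)
    (j : Fin n) : ∑ t ∈ x.support, x t • contractRoot B t c j ∈ treeRelations R L := by
  classical
  rcases x.support.eq_empty_or_nonempty with h0 | ⟨t₀, ht₀⟩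
  · rw [h0]; simp
  cases hcj : c j with
  | leaf i =>
    simp only [contractRoot_of_leaf hcj, smul_zero, Finset.sum_const_zero]
    exact Submodule.zero_mem _
  | node m y d =>
    have hm := (hg t₀ ht₀).1.isMergeable hcj
    obtain ⟨p, hp, hgraft⟩ := hm.exists_shuffle
    have hy := ((hg t₀ ht₀).1.child j).labels
    rw [hcj] at hy
    have hmem := InIdeal.shuffle_left hR j.2 hx hy.1 hp
    -- This part of the sign does not depend on `t`, by homogeneity. The remaining factor, with
    -- `degAfter`, is the one already present in the partial composition.
    set s : 𝕜 := sgn 𝕜 ((BTree.deg B y + 1) *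
      (∑ k ∈ Finset.univ.filter (· < j), suspendedDeg B (c k)) + D +
      koszulExponent (mergedSort B c j d)
        fun k => suspendedDeg B ((mergedEntries B c j d).get k)) with hs
    have hrel : ∀ N, N = n + m - 1 → InIdeal B R N (∑ t ∈ x.support,
        Finsupp.single (contractLabel t c j y d)
          (sgn 𝕜 (BTree.deg B y * BTree.degAfter B j t) * x t)) := by
      rintro _ rfl
      rw [Finset.sum_congr rfl fun t ht => by rw [hgraft t y (hg t ht).1.labels.1 hy.1]]
      exact hmem
    have hmap := (IsContext.root (contractEntries c j d)).mapDomain_mem (L := L)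
      (hrel _ length_mergedEntries) (by
      intro t' ht'
      obtain ⟨t, ht, h⟩ := exists_mem_support_of_mem_support_sum ht'
      have := Finset.mem_singleton.1 (Finsupp.support_single_subset h)
      rw [this, ← (hg t ht).1.contractTree_eq hcj]
      obtain ⟨h1, h2⟩ := (hg t ht).1.contract hcj
      exact ⟨h1, h2.trans (hg t ht).2⟩)
    have h := (treeRelations R L).smul_mem s hmap
    rw [Finsupp.mapDomain_finsetSum, Finset.smul_sum] at h
    convert h using 1
    refine Finset.sum_congr rfl fun t ht => ?_
    rw [contractRoot_of_node hcj, Finsupp.mapDomain_single, (hg t ht).1.contractTree_eq hcj,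
      Finsupp.smul_single, Finsupp.smul_single, smul_eq_mul, smul_eq_mul, ← mul_assoc, hs,
      ← sgn_add, contractExponent, hD t ht, mul_comm]
    congr 3
    ring

/-- With the relation at the root, an edge at the root composes the relation with a label, which
stays in the ideal; any other edge leaves the varying label untouched and has a constant sign by
`hD`. -/
lemma sum_barDiffTree_root_mem (hR : ∀ r, ∀ x ∈ R r, x ∈ freeOperad B r)
    {c : Fin n → BarTree B} (hx : x ∈ operadIdeal B R n) {D : ℤ}
    (hD : ∀ t ∈ x.support, BTree.deg B t = D)
    (hg : ∀ t ∈ x.support, IsBarTree (node n t c) ∧ (node n t c : BarTree B).leaves.Perm L) :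
    ∑ t ∈ x.support, x t • barDiffTree B (node n t c) ∈ treeRelations R L := by
  simp only [barDiffTree, smul_add, Finset.sum_add_distrib, Finset.smul_sum]
  refine add_mem ?_ ?_
  · rw [Finset.sum_comm]
    exact sum_mem fun j _ => sum_contractRoot_label_mem hR hx hD hg j
  · rw [Finset.sum_comm]
    refine sum_mem fun j _ => ?_
    rcases x.support.eq_empty_or_nonempty with h0 | ⟨t₀, ht₀⟩
    · rw [h0]; simp
    set s : 𝕜 := sgn 𝕜 (D + 1 + ∑ k ∈ Finset.univ.filter (· < j), suspendedDeg B (c k)) with hs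
    have h : ∑ T ∈ (barDiffTree B (c j)).support, s • ∑ t ∈ x.support,
        x t • Finsupp.single (node n t (Function.update c j T) : BarTree B)
          (barDiffTree B (c j) T) ∈ treeRelations R L := by
      refine sum_mem fun T hT => Submodule.smul_mem _ _ ?_
      refine (IsContext.root (Function.update c j T)).sum_mem hx (fun t ht => ?_) _
      have hT' : Contracts (c j) T := contracts_of_mem_support ((hg t ht).1.child j) hT
      obtain ⟨h1, h2, _⟩ := hT'.isBarTree ((hg t ht).1.child j)
      obtain ⟨h3, h4⟩ := (hg t ht).1.update h1 h2
      exact ⟨h3, h4.trans (hg t ht).2⟩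
    convert h using 1
    simp only [Finset.smul_sum]
    rw [Finset.sum_comm]
    refine Finset.sum_congr rfl fun t ht => ?_
    rw [hD t ht, ← hs, Finsupp.mapDomain, Finsupp.sum, Finset.smul_sum, Finset.smul_sum]
    exact Finset.sum_congr rfl fun T _ => by rw [smul_comm]

/-- Contractions of an edge where the tree that contains the relation is an entry of the
contracted vertex. -/
lemma sum_contractRoot_replace_mem {C : BTree B → BarTree B} (hC : IsContext n C)
    (hx : x ∈ operadIdeal B R n) {D : ℤ} (hD : ∀ t ∈ x.support, BTree.deg B t = D)
    {m₀ m : ℕ} {y y' : BTree B} {c : BTree B → Fin m₀ → BarTree B} {j : Fin m₀}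
    {d : BTree B → Fin m → BarTree B} (hcj : ∀ t, c t j = node m y' (d t))
    (hg : ∀ t ∈ x.support, IsBarTree (node m₀ y (c t)) ∧
      (node m₀ y (c t) : BarTree B).leaves.Perm L)
    (hc : ∀ t ∈ x.support, ∀ t' ∈ x.support, ∀ i, i ≠ j →
      (c t i ≠ C t ∧ c t' i = c t i) ∨ (c t i = C t ∧ c t' i = C t'))
    (hd : ∀ t ∈ x.support, ∀ t' ∈ x.support, ∀ l,
      (d t l ≠ C t ∧ d t' l = d t l) ∨ (d t l = C t ∧ d t' l = C t'))
    (hmem : ∀ t, C t ∈ mergedEntries B (c t) j (d t)) :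
    ∑ t ∈ x.support, x t • contractRoot B y (c t) j ∈ treeRelations R L := by
  classical
  rcases x.support.eq_empty_or_nonempty with h0 | ⟨t₀, ht₀⟩
  · rw [h0]; simp
  obtain ⟨q, hq⟩ := exists_contractEntries (hmem t₀)
  have hs : ∀ t ∈ x.support, susp (C t) = susp (C t₀) := fun t ht =>
    hC.susp_eq (by rw [hD t ht, hD t₀ ht₀])
  have hroot : ∀ t ∈ x.support, contractRoot B y (c t) j =
      Finsupp.single (node _ (contractLabel y (c t₀) j y' (d t₀))
        (Function.update (contractEntries (c t₀) j (d t₀)) q (C t)))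
        (sgn 𝕜 (contractExponent B y (c t₀) j y' (d t₀))) := by
    intro t ht
    rw [contractRoot_of_node (hcj t)]
    congr 1
    · refine (hg t₀ ht₀).1.contractTree_replace (hcj t₀) (hg t ht).1 (hcj t)
        (hC.minLeaf_eq t t₀) (fun i hi => ?_) (fun l => ?_) hq
      · rcases hc t₀ ht₀ t ht i hi with ⟨h1, h2⟩ | ⟨h1, h2⟩
        · rw [if_neg h1, h2]
        · rw [if_pos h1, h2]
      · rcases hd t₀ ht₀ t ht l with ⟨h1, h2⟩ | ⟨h1, h2⟩
        · rw [if_neg h1, h2]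
        · rw [if_pos h1, h2]
    · refine ((hg t₀ ht₀).1.isMergeable (hcj t₀)).contractExponent_congr
        ((hg t ht).1.isMergeable (hcj t)) (fun i hi => ?_) (fun l => ?_)
      · rcases hc t₀ ht₀ t ht i hi with ⟨h1, h2⟩ | ⟨h1, h2⟩
        · rw [h2]; exact ⟨rfl, rfl⟩
        · rw [h1, h2]; exact ⟨hC.minLeaf_eq t t₀, hs t ht⟩
      · rcases hd t₀ ht₀ t ht l with ⟨h1, h2⟩ | ⟨h1, h2⟩
        · rw [h2]; exact ⟨rfl, rfl⟩
        · rw [h1, h2]; exact ⟨hC.minLeaf_eq t t₀, hs t ht⟩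
  rw [Finset.sum_congr rfl fun t ht => by rw [hroot t ht]]
  refine (IsContext.above _ _ _ q hC).sum_mem hx (fun t ht => ?_) _
  have h1 := hroot t ht
  rw [contractRoot_of_node (hcj t)] at h1
  obtain ⟨h3, h4⟩ := (hg t ht).1.contract (hcj t)
  rw [Finsupp.single_eq_single_iff] at h1
  rcases h1 with h1 | h1
  · rw [← h1.1]
    exact ⟨h3, h4.trans (hg t ht).2⟩
  · rw [sgn_eq_sg] at h1
    exact absurd h1.1 (sg_ne_zero _)

/-- Contractions of the edge under the vertex labelled by a relation. -/
lemma sum_contractRoot_entry_mem (hR : ∀ r, ∀ x ∈ R r, x ∈ freeOperad B r)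
    (hx : x ∈ operadIdeal B R n) {D : ℤ} (hD : ∀ t ∈ x.support, BTree.deg B t = D)
    {m₀ : ℕ} {y : BTree B} {c : Fin m₀ → BarTree B} {j : Fin m₀} {d : Fin n → BarTree B}
    (hg : ∀ t ∈ x.support, IsBarTree (node m₀ y (Function.update c j (node n t d))) ∧
      (node m₀ y (Function.update c j (node n t d)) : BarTree B).leaves.Perm L) :
    ∑ t ∈ x.support, x t • contractRoot B y (Function.update c j (node n t d)) j ∈
      treeRelations R L := by
  classical
  rcases x.support.eq_empty_or_nonempty with h0 | ⟨t₀, ht₀⟩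
  · rw [h0]; simp
  set c₀ := Function.update c j (node n t₀ d) with hc₀
  have hcj : ∀ t, Function.update c j (node n t d) j = node n t d := fun t => by simp
  have hm := (hg t₀ ht₀).1.isMergeable (hcj t₀)
  obtain ⟨p, hp, hgraft⟩ := hm.exists_shuffle
  have hlab : ∀ t ∈ x.support, t.IsReduced n := fun t ht => by
    have := ((hg t ht).1.child j).labels
    rw [hcj t] at this
    exact this.1
  have hy := (hg t₀ ht₀).1.labels.1
  have hmem := InIdeal.shuffle_right hR j.2 hx hy hp
  have hrel : ∀ N, N = m₀ + n - 1 → InIdeal B R N (∑ t ∈ x.support,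
      Finsupp.single (contractLabel y c₀ j t d)
        (sgn 𝕜 (BTree.deg B t * BTree.degAfter B j y) * x t)) := by
    rintro _ rfl
    rw [Finset.sum_congr rfl fun t ht => by rw [hgraft y t hy (hlab t ht)]]
    exact hmem
  have htree : ∀ t ∈ x.support, contractTree B y (Function.update c j (node n t d)) j t d =
      node _ (contractLabel y c₀ j t d) (contractEntries c₀ j d) := by
    intro t ht
    rw [contractTree_update, ← contractTree_update (node n t₀ d), ← hc₀]
    exact contractTree_eq (fun i hi => hy.mem_leaves.1 hi) (fun l hl => (hlab t ht).mem_leaves.1 hl)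
  have hmap := (IsContext.root (contractEntries c₀ j d)).mapDomain_mem (L := L)
    (hrel _ length_mergedEntries) (by
    intro t' ht'
    obtain ⟨t, ht, h⟩ := exists_mem_support_of_mem_support_sum ht'
    have := Finset.mem_singleton.1 (Finsupp.support_single_subset h)
    rw [this, ← htree t ht]
    obtain ⟨h1, h2⟩ := (hg t ht).1.contract (hcj t)
    exact ⟨h1, h2.trans (hg t ht).2⟩)
  have h := (treeRelations R L).smul_mem (sgn 𝕜 (contractExponent B y c₀ j t₀ d) *
    sgn 𝕜 (BTree.deg B t₀ * BTree.degAfter B j y)) hmap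
  rw [Finsupp.mapDomain_finsetSum, Finset.smul_sum] at h
  convert h using 1
  refine Finset.sum_congr rfl fun t ht => ?_
  have hexp : sgn 𝕜 (contractExponent B y (Function.update c j (node n t d)) j t d) =
      sgn 𝕜 (contractExponent B y c₀ j t₀ d) := by
    have hm' := (hg t ht).1.isMergeable (hcj t)
    rw [sgn_eq_sg, sgn_eq_sg, hm.contractExponent_cast, hm'.contractExponent_cast, hD t ht,
      hD t₀ ht₀]
    congr 3
    · congr 2
      refine Finset.sum_congr rfl fun k hk => ?_
      rw [Function.update_of_ne (Finset.mem_filter.1 hk).2.ne,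
        Function.update_of_ne (Finset.mem_filter.1 hk).2.ne]
    · funext k
      by_cases hk : j < k
      · simp only [hk, if_true, Function.update_of_ne hk.ne']
      · simp [hk]
  rw [contractRoot_of_node (hcj t), hexp, htree t ht, Finsupp.mapDomain_single,
    Finsupp.smul_single, Finsupp.smul_single, smul_eq_mul, smul_eq_mul, hD t ht, hD t₀ ht₀]
  congr 1
  have h1 : sgn 𝕜 (D * BTree.degAfter B j y) * sgn 𝕜 (D * BTree.degAfter B j y) = 1 := by
    rw [sgn_eq_sg, sg_mul_self]
  linear_combination -(x t * sgn 𝕜 (contractExponent B y c₀ j t₀ d)) * h1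

/-- An edge either meets the vertex with the relation, where the ideal property applies, or leaves
the varying label in a new context. Edges inside the tree that contains the relation are handled by
induction on the context; homogeneity keeps the signs independent of `t`. -/
lemma sum_barDiffTree_mem (hR : ∀ r, ∀ x ∈ R r, x ∈ freeOperad B r) {C : BTree B → BarTree B}
    (hC : IsContext n C) (hx : x ∈ operadIdeal B R n) {D : ℤ}
    (hD : ∀ t ∈ x.support, BTree.deg B t = D)
    (hg : ∀ t ∈ x.support, IsBarTree (C t) ∧ (C t).leaves.Perm L) :
    ∑ t ∈ x.support, x t • barDiffTree B (C t) ∈ treeRelations R L := by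
  induction hC generalizing L with
  | root c => exact sum_barDiffTree_root_mem hR hx hD hg
  | @above C m y c j hC ih =>
    rcases x.support.eq_empty_or_nonempty with h0 | ⟨t₀, ht₀⟩
    · rw [h0]; simp
    have hCg : ∀ t ∈ x.support, IsBarTree (C t) ∧ (C t).leaves.Perm (C t₀).leaves :=
      fun t ht => by
        have := (hg t ht).1.child j
        rw [Function.update_self] at this
        exact ⟨this, by rw [hC.leaves_eq t t₀]⟩
    have hmono : ∀ t ∈ x.support, StrictMono fun k => (Function.update c j (C t) k).minLeaf :=
      fun t ht => (hg t ht).1.canonical.2.1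
    simp only [barDiffTree, smul_add, Finset.sum_add_distrib, Finset.smul_sum]
    refine add_mem ?_ ?_
    · rw [Finset.sum_comm]
      refine sum_mem fun k _ => ?_
      by_cases hk : k = j
      · subst hk
        -- The edge leads from the root vertex to the tree containing the relation: either it ends
        -- at the vertex of the relation, or this vertex is higher and is carried along in an entry
        -- of the contracted vertex.
        cases hC with
        | root d => exact sum_contractRoot_entry_mem hR hx hD hg
        | @above C m' y' d l hC =>
          refine sum_contractRoot_replace_mem hC hx hD (y' := y')
            (d := fun t => Function.update d l (C t)) (fun t => by simp) hg ?_ ?_ ?_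
          · intro t ht t' ht' i hi
            refine .inl ⟨fun e => ?_, by simp [hi]⟩
            have := ((hg t ht).1.isMergeable (Function.update_self ..)).ne hi l
            rw [Function.update_self, e] at this
            exact this rfl
          · intro t ht t' ht' l'
            by_cases hl : l' = l
            · subst hl; exact .inr (by simp)
            · refine .inl ⟨fun e => ?_, by simp [hl]⟩
              have := ((hg t ht).1.isMergeable (Function.update_self ..)).strictMono'.injective.ne hl
              rw [Function.update_self, e] at this
              exact this rfl
          · exact fun t => mem_mergedEntries.2 (.inr ⟨l, by simp⟩)
      · cases hck : c k with
        | leaf i =>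
          have : ∀ t, contractRoot (𝕜 := 𝕜) B y (Function.update c j (C t)) k = 0 := fun t =>
            contractRoot_of_leaf (i := i) (by rw [Function.update_of_ne hk, hck])
          simp only [this, smul_zero, Finset.sum_const_zero]
          exact Submodule.zero_mem _
        | node m' y' d =>
          refine sum_contractRoot_replace_mem hC hx hD (y' := y') (d := fun _ => d)
            (fun t => by simp [hk, hck]) hg ?_ ?_ ?_
          · intro t ht t' ht' i hi
            by_cases hij : i = j
            · subst hij; exact .inr (by simp)
            · refine .inl ⟨fun e => ?_, by simp [hij]⟩
              have := (hmono t ht).injective.ne hij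
              rw [Function.update_self, e] at this
              exact this rfl
          · intro t ht t' ht' l
            refine .inl ⟨fun e => ?_, rfl⟩
            have := ((hg t ht).1.isMergeable (j := k) (y := y') (d := d)
              (by rw [Function.update_of_ne hk, hck])).ne (Ne.symm hk) l
            rw [Function.update_self, ← e] at this
            exact this rfl
          · exact fun t => mem_mergedEntries.2 (.inl ⟨j, Ne.symm hk, by simp⟩)
    · rw [Finset.sum_comm]
      refine sum_mem fun k _ => ?_
      have hs : ∀ t ∈ x.support, sgn 𝕜 (BTree.deg B y + 1 +
          ∑ i ∈ Finset.univ.filter (· < k), suspendedDeg B (Function.update c j (C t) i)) =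
          sgn 𝕜 (BTree.deg B y + 1 +
          ∑ i ∈ Finset.univ.filter (· < k), suspendedDeg B (Function.update c j (C t₀) i)) := by
        intro t ht
        rw [sgn_eq_sg, sgn_eq_sg]
        congr 1
        push_cast
        congr 1
        refine Finset.sum_congr rfl fun i _ => ?_
        by_cases hij : i = j
        · subst hij
          simpa [susp] using hC.susp_eq (by rw [hD t ht, hD t₀ ht₀])
        · simp [hij]
      set s : 𝕜 := sgn 𝕜 (BTree.deg B y + 1 +
          ∑ i ∈ Finset.univ.filter (· < k), suspendedDeg B (Function.update c j (C t₀) i))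
      by_cases hk : k = j
      · subst hk
        have h1 := treeRelations_map (R := R) (L := L) (m := m) (y := y) (c := c) (j := k)
          (L' := (C t₀).leaves) (fun T hT hp => by
            have := (hg t₀ ht₀).1.update (j := k) hT (by rwa [Function.update_self])
            rw [Function.update_idem] at this
            exact ⟨this.1, this.2.trans (hg t₀ ht₀).2⟩) (ih hCg)
        have h2 := (treeRelations R L).smul_mem s h1
        rw [Finsupp.mapDomain_finsetSum, Finset.smul_sum] at h2
        convert h2 using 1
        refine Finset.sum_congr rfl fun t ht => ?_
        rw [hs t ht, Function.update_self, Finsupp.mapDomain_smul, smul_comm]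
        simp only [Function.update_idem]
      · have h : ∑ T ∈ (barDiffTree B (c k)).support, s • ∑ t ∈ x.support,
            x t • Finsupp.single
              (node m y (Function.update (Function.update c k T) j (C t)) : BarTree B)
              (barDiffTree B (c k) T) ∈ treeRelations R L := by
          refine sum_mem fun T hT => Submodule.smul_mem _ _ ?_
          refine (IsContext.above m y (Function.update c k T) j hC).sum_mem hx (fun t ht => ?_) _
          have hck := (hg t ht).1.child k
          rw [Function.update_of_ne hk] at hck
          obtain ⟨h1, h2, _⟩ := (contracts_of_mem_support hck hT).isBarTree hck
          obtain ⟨h3, h4⟩ := (hg t ht).1.update (j := k) h1 (by rwa [Function.update_of_ne hk])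
          rw [Function.update_comm hk]
          exact ⟨h3, h4.trans (hg t ht).2⟩
        convert h using 1
        simp only [Finset.smul_sum]
        rw [Finset.sum_comm]
        refine Finset.sum_congr rfl fun t ht => ?_
        rw [hs t ht, Function.update_of_ne hk, Finsupp.mapDomain, Finsupp.sum, Finset.smul_sum,
          Finset.smul_sum]
        exact Finset.sum_congr rfl fun T _ => by rw [smul_comm, Function.update_comm hk]

lemma barDiff_apply (z : BarTensor B) :
    barDiff B z = ∑ T ∈ z.support, z T • barDiffTree B T := by
  conv_lhs => rw [← Finsupp.sum_single z, Finsupp.sum, map_sum]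
  exact Finset.sum_congr rfl fun T _ => barDiff_single T _

/-- The differential of the bar construction preserves the relations. -/
theorem barDiff_mem_treeRelations (hR : IsQuadratic B R) {z : BarTensor B}
    (hz : z ∈ treeRelations R L) : barDiff B z ∈ treeRelations R L := by
  classical
  have hR' : ∀ r, ∀ x ∈ R r, x ∈ freeOperad B r := fun r x hx t ht => ((hR r x hx).1 ht).1
  have : treeRelations R L ≤ (treeRelations R L).comap (barDiff B) := by
    refine Submodule.span_le.2 ?_
    rintro z ⟨hz, hg⟩
    obtain ⟨n, C, x, hC, hx, rfl⟩ := exists_isContext hz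
    -- The element of the ideal is split into bihomogeneous components, which again lie in the
    -- ideal, because the signs depend on the degree.
    have hsum : x = ∑ k ∈ x.support.image (biweight B), x.filter fun t => biweight B t = k := by
      ext t
      rw [Finsupp.finsetSum_apply]
      simp only [Finsupp.filter_apply]
      by_cases ht : t ∈ x.support
      · rw [Finset.sum_ite_eq, if_pos (Finset.mem_image_of_mem _ ht)]
      · rw [Finsupp.notMem_support_iff.1 ht]; simp
    have hsupp : ∀ t ∈ x.support, C t ∈ (Finsupp.mapDomain C x).support := fun t ht => by
      rw [Finsupp.mapDomain_support_of_injective hC.injective]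
      exact Finset.mem_image_of_mem _ ht
    change barDiff B _ ∈ treeRelations R L
    rw [hsum, Finsupp.mapDomain_finsetSum, map_sum]
    refine sum_mem fun k _ => ?_
    have hx' := InIdeal.filter hR hx k
    have hf : ∀ t ∈ (x.filter fun t => biweight B t = k).support,
        t ∈ x.support ∧ biweight B t = k := fun t ht => by
      rw [Finsupp.support_filter, Finset.mem_filter] at ht
      exact ht
    have h := sum_barDiffTree_mem (L := L) hR' hC hx' (D := k.2)
      (fun t ht => by rw [← (hf t ht).2, biweight_eq]) (fun t ht => hg _ (hsupp t (hf t ht).1))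
    rw [Finsupp.mapDomain, Finsupp.sum, map_sum]
    simpa only [barDiff_single] using h
  exact this hz

end Differential

end

/-! ### Normal forms in the bar construction and triangularity of contractions. -/

section
open OTree

variable {𝕜 : Type u} [Field 𝕜] {M : SigmaModule.{u, v} 𝕜} {B : HomogeneousBasis.{u, v, w} M}

/-! ### Normal forms -/

/-- The maps `N r` send the elements of `F(M)(r)` to their expressions in the PBW basis `S`. -/
structure IsNormalForm (R : ℕ → Set (BTensor B)) (S : Set (BTree B))
    (N : ℕ → BTensor B →ₗ[𝕜] BTensor B) : Prop where
  mem : ∀ r, ∀ x ∈ freeOperad B r, ∀ t ∈ (N r x).support, t ∈ S ∧ t.IsReduced r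
  sub_mem : ∀ r, ∀ x ∈ freeOperad B r, x - N r x ∈ operadIdeal B R r
  ideal : ∀ r, ∀ x ∈ operadIdeal B R r, N r x = 0
  single : ∀ r, ∀ t ∈ S, t.IsReduced r → N r (Finsupp.single t 1) = Finsupp.single t 1

/-- Coordinates in the basis of `P(r)` are lifted to combinations of monomials of `S`. -/
lemma IsPBWBasis.exists_isNormalForm {R : ℕ → Set (BTensor B)}
    (hR : ∀ r, ∀ x ∈ R r, x ∈ freeOperad B r) {le : BTree B → BTree B → Prop}
    {S : Set (BTree B)} (hS : IsPBWBasis B R le S) : ∃ N, IsNormalForm R S N := by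
  suffices h : ∀ r, ∃ N : BTensor B →ₗ[𝕜] BTensor B,
      (∀ x ∈ freeOperad B r, ∀ t ∈ (N x).support, t ∈ S ∧ t.IsReduced r) ∧
      (∀ x ∈ freeOperad B r, x - N x ∈ operadIdeal B R r) ∧
      (∀ x ∈ operadIdeal B R r, N x = 0) ∧
      ∀ t ∈ S, t.IsReduced r → N (Finsupp.single t 1) = Finsupp.single t 1 by
    choose N h1 h2 h3 h4 using h
    exact ⟨N, h1, h2, h3, h4⟩
  classical
  intro r
  let b : Module.Basis {t : BTree B // t ∈ S ∧ t.IsReduced r} 𝕜 (quotientOperad B R r) :=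
    .mk (hS.linearIndependent r) (hS.span_eq_top r).ge
  have hb : ∀ t, b t = monomialClass B R t.1 t.2.2 := fun t => Module.Basis.mk_apply _ _ t
  let g : freeOperad B r →ₗ[𝕜] quotientOperad B R r :=
    ((operadIdeal B R r).mkQ.domRestrict (freeOperad B r)).codRestrict (quotientOperad B R r)
      fun x => Submodule.mem_map_of_mem x.2
  let i : ({t : BTree B // t ∈ S ∧ t.IsReduced r} →₀ 𝕜) →ₗ[𝕜] BTensor B :=
    Finsupp.lmapDomain 𝕜 𝕜 Subtype.val
  -- The extension beyond `F(M)(r)` is arbitrary and only spares the use of subtypes.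
  obtain ⟨N, hN⟩ := LinearMap.exists_extend (i ∘ₗ b.repr.toLinearMap ∘ₗ g)
  have hN' : ∀ x (hx : x ∈ freeOperad B r), N x = i (b.repr (g ⟨x, hx⟩)) := fun x hx => by
    have := LinearMap.congr_fun hN ⟨x, hx⟩
    simpa using this
  have hi : (operadIdeal B R r).mkQ ∘ₗ i =
      (quotientOperad B R r).subtype ∘ₗ b.repr.symm.toLinearMap := by
    ext t
    simp [i, hb, monomialClass]
  refine ⟨N, fun x hx t ht => ?_, fun x hx => ?_, fun x hx => ?_, fun t ht htr => ?_⟩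
  · rw [hN' x hx] at ht
    obtain ⟨t', _, rfl⟩ := Finset.mem_image.1 (Finsupp.mapDomain_support ht)
    exact t'.2
  · rw [← Submodule.Quotient.mk_eq_zero, Submodule.Quotient.mk_sub, sub_eq_zero, hN' x hx]
    have := LinearMap.congr_fun hi (b.repr (g ⟨x, hx⟩))
    simp only [LinearMap.comp_apply, LinearEquiv.coe_coe, LinearEquiv.symm_apply_apply,
      Submodule.mkQ_apply] at this
    rw [this]
    rfl
  · have hx' := InIdeal.mem_freeOperad hR hx
    have : g ⟨x, hx'⟩ = 0 := Subtype.ext ((Submodule.Quotient.mk_eq_zero _).2 hx)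
    rw [hN' x hx', this, map_zero, map_zero]
  · have hx' : Finsupp.single t (1 : 𝕜) ∈ freeOperad B r := Finsupp.single_mem_supported 𝕜 1 htr
    have : g ⟨_, hx'⟩ = b ⟨t, ht, htr⟩ := by rw [hb]; rfl
    rw [hN' _ hx', this, b.repr_self]
    simp [i]

/-- Every label of the tree belongs to `S`. -/
def AllLabels (S : Set (BTree B)) : BarTree B → Prop
  | leaf _ => True
  | node _ x c => x ∈ S ∧ ∀ k, AllLabels S (c k)

/-- The product over the vertices of the coefficients of the labels of `U` in the normal forms of
the labels of `T`. -/
noncomputable def pairing (N : ℕ → BTensor B →ₗ[𝕜] BTensor B) : BarTree B → BarTree B → 𝕜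
  | leaf i, leaf k => if k = i then 1 else 0
  | leaf _, node _ _ _ => 0
  | node _ _ _, leaf _ => 0
  | node n u c, node m x d =>
      if h : m = n then N n (Finsupp.single x 1) u * ∏ k, pairing N (c k) (d (Fin.cast h.symm k))
      else 0

section Pairing

variable {N : ℕ → BTensor B →ₗ[𝕜] BTensor B} {R : ℕ → Set (BTensor B)} {S : Set (BTree B)}

lemma pairing_node {n : ℕ} (u x : BTree B) (c d : Fin n → BarTree B) :
    pairing N (node n u c) (node n x d) =
      N n (Finsupp.single x 1) u * ∏ k, pairing N (c k) (d k) := by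
  simp [pairing]

/-- The coefficient of `U` in the normal form. -/
noncomputable def coefficient (N : ℕ → BTensor B →ₗ[𝕜] BTensor B) (U : BarTree B) :
    BarTensor B →ₗ[𝕜] 𝕜 :=
  Finsupp.lsum 𝕜 fun T => LinearMap.toSpanSingleton 𝕜 𝕜 (pairing N U T)

lemma coefficient_apply (U : BarTree B) (z : BarTensor B) :
    coefficient N U z = ∑ T ∈ z.support, z T * pairing N U T := by
  simp [coefficient, Finsupp.sum]

lemma coefficient_single (U T : BarTree B) (a : 𝕜) :
    coefficient N U (Finsupp.single T a) = a * pairing N U T := by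
  simp [coefficient]

lemma coefficient_mapDomain {α : Type*} (U : BarTree B) (f : α → BarTree B) (x : α →₀ 𝕜) :
    coefficient N U (Finsupp.mapDomain f x) = ∑ t ∈ x.support, x t * pairing N U (f t) := by
  rw [Finsupp.mapDomain, Finsupp.sum, map_sum]
  exact Finset.sum_congr rfl fun t _ => coefficient_single _ _ _

/-- The pairing is a product over vertices, and the factor at the vertex of the relation sums to a
coefficient of the normal form of an element of the ideal. So `coefficient` descends to `B(P)`. -/
lemma IsNormalForm.coefficient_relation (hN : IsNormalForm R S N) {z : BarTensor B}
    (hz : IsBarRelation B R z) (U : BarTree B) : coefficient N U z = 0 := by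
  induction hz generalizing U with
  | root n x c hx =>
    rw [coefficient_mapDomain]
    cases U with
    | leaf i => simp [pairing]
    | node m u e =>
      by_cases h : n = m
      · subst h
        have h1 : ∑ t ∈ x.support, x t * N n (Finsupp.single t 1) u = 0 := by
          have := congrArg (fun y => y u) (hN.ideal n x hx)
          rw [← Finsupp.sum_single x, Finsupp.sum, map_sum] at this
          simp only [Finsupp.finsetSum_apply, Finsupp.coe_zero, Pi.zero_apply] at this
          rw [← this]
          refine Finset.sum_congr rfl fun t _ => ?_
          have h2 : Finsupp.single t (x t) = x t • Finsupp.single t (1 : 𝕜) := by simp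
          rw [h2, map_smul, Finsupp.smul_apply, smul_eq_mul]
        simp only [pairing_node, ← mul_assoc, ← Finset.sum_mul, h1, zero_mul]
      · simp [pairing, h]
  | above n y c j z h ih =>
    classical
    rw [coefficient_mapDomain]
    cases U with
    | leaf i => simp [pairing]
    | node m u e =>
      by_cases h : n = m
      · subst h
        have h1 : ∀ T, pairing N (node n u e) (node n y (Function.update c j T)) =
            pairing N (e j) T * (N n (Finsupp.single y 1) u *
              ∏ k ∈ Finset.univ.erase j, pairing N (e k) (c k)) := by
          intro T
          rw [pairing_node, ← Finset.mul_prod_erase _ _ (Finset.mem_univ j), Function.update_self,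
            Finset.prod_congr rfl fun k hk => by
              rw [Function.update_of_ne (Finset.ne_of_mem_erase hk)]]
          ring
        have h2 := ih (e j)
        rw [coefficient_apply] at h2
        simp only [h1, ← mul_assoc (z _), ← Finset.sum_mul, h2, zero_mul]
      · simp [pairing, h]

lemma IsNormalForm.coefficient_treeRelations (hN : IsNormalForm R S N) {z : BarTensor B}
    {L : List ℕ} (hz : z ∈ treeRelations R L) (U : BarTree B) : coefficient N U z = 0 := by
  have : treeRelations R L ≤ LinearMap.ker (coefficient N U) :=
    Submodule.span_le.2 fun z hz => hN.coefficient_relation hz.1 U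
  exact this hz

open Classical in
-- Labels in `S` are their own normal forms, so on trees labelled in `S` the functionals
-- `coefficient` are coordinate forms.
lemma IsNormalForm.pairing_eq (hN : IsNormalForm R S N) {U T : BarTree B} (hT : LabelsOK B T)
    (hS : AllLabels S T) : pairing N U T = if T = U then 1 else 0 := by
  induction T generalizing U with
  | leaf i => cases U <;> simp [pairing]
  | node n x d ih =>
    cases U with
    | leaf i => simp [pairing]
    | node m u e =>
      by_cases h : n = m
      · subst h
        rw [pairing_node, hN.single n x hS.1 hT.1]
        simp only [fun k => ih k (U := e k) (hT.2.2 k) (hS.2 k)]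
        rw [Finset.prod_ite_zero, Finset.prod_const_one, Finsupp.single_apply]
        by_cases h1 : x = u
        · subst h1
          by_cases h2 : d = e
          · subst h2; simp
          · have : ¬ ∀ k, d k = e k := fun h => h2 (funext h)
            simp [h2, this]
        · simp [h1]
      · simp [pairing, h]

end Pairing

/-! ### Reduction of contractions -/

lemma numVertices_node {X : ℕ → Type*} {n : ℕ} (x : X n) (c : Fin n → OTree X) :
    (node n x c).numVertices = 1 + ∑ k, (c k).numVertices := rfl

lemma barWeight_node {n : ℕ} (x : BTree B) (c : Fin n → BarTree B) :
    barWeight B (node n x c) = x.numVertices + ∑ k, barWeight B (c k) := rfl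

/-- The condition on the treewise tensors `U` in the reduction of a contraction `T'` of `T`. -/
structure IsReduction (le : BTree B → BTree B → Prop) (S : Set (BTree B)) (T' U : BarTree B) :
    Prop where
  isBarTree : IsBarTree U
  allLabels : AllLabels S U
  leaves_perm : U.leaves.Perm T'.leaves
  numVertices_eq : U.numVertices = T'.numVertices
  barWeight_eq : barWeight B U = barWeight B T'
  eq_or_le : U = T' ∨ StdLE le (expand T') (expand U) ∧ expand U ≠ expand T'

section Reduction

variable {R : ℕ → Set (BTensor B)} {le : BTree B → BTree B → Prop} {S : Set (BTree B)}

lemma IsBarTree.stdLE_refl (hle : IsMonomialOrder B le) {T : BarTree B} (hT : IsBarTree T) :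
    StdLE le (expand T) (expand T) := .refl hle (expand_isCanonical hT) (expand_nodup hT)

lemma IsBarTree.leaves_disjoint {n : ℕ} {x : BTree B} {c : Fin n → BarTree B}
    (h : IsBarTree (node n x c)) : ∀ i < n, ∀ k < n, ∀ a, a ∈ (expand (childAt c i)).leaves →
      a ∈ (expand (childAt c k)).leaves → i = k := by
  intro i hi k hk a ha hb
  rw [(leaves_expand (h.entry i).labels).mem_iff, childAt_of_lt c hi] at ha
  rw [(leaves_expand (h.entry k).labels).mem_iff, childAt_of_lt c hk] at hb
  exact congrArg Fin.val ((nodup_leaves_node h.nodup).2 _ _ a ha hb)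

lemma IsBarTree.strictMonoOn_expand {n : ℕ} {x : BTree B} {c : Fin n → BarTree B}
    (h : IsBarTree (node n x c)) :
    StrictMonoOn (fun i => (expand (childAt c i)).minLeaf) (Set.Iio n) := by
  have := h.strictMonoOn
  simpa only [minLeaf_expand (h.entry _).labels] using this

/-- A contraction creates one new label, a composite of two elements of `S`. If it leaves `S`, the
PBW axiom rewrites it with larger monomials, and substituting the entries keeps the inequality
strict, by monotonicity (`StdLE.bind`) and injectivity of substitution. -/
lemma exists_reduction (hR : IsQuadratic B R) (hle : IsMonomialOrder B le)
    (hS : IsPBWBasis B R le S) {T T' : BarTree B} (hT : IsBarTree T) (hTS : AllLabels S T)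
    (h : Contracts T T') : ∃ y : BarTensor B,
      Finsupp.single T' 1 - y ∈ treeRelations R T'.leaves ∧
      ∀ U ∈ y.support, IsReduction le S T' U := by
  classical
  induction h with
  | @root n x c j m y d hj =>
    obtain ⟨hb, hp⟩ := hT.contract hj
    have hm := hT.isMergeable hj
    have hcS := hTS.2 j
    have hcl := (hT.child j).labels
    rw [hj] at hcS hcl
    obtain ⟨p, hp1, hp2⟩ := hm.exists_shuffle
    rw [hT.contractTree_eq hj] at hb ⊢
    set e := contractEntries c j d with he
    have heS : ∀ k, AllLabels S (e k) := fun k => by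
      rcases mem_mergedEntries.1 (mem_contractEntries (c := c) (j := j) (d := d) k) with
        ⟨i, -, h⟩ | ⟨l, h⟩
      · rw [he, h]; exact hTS.2 i
      · rw [he, h]; exact hcS.2 l
    have hlab := hp2 x y hT.labels.1 hcl.1
    rcases hS.comp n m j x y j.2 hTS.1 hT.labels.1 hcS.1 hcl.1 p hp1 with hin | ⟨w, hw1, hw2⟩
    · refine ⟨Finsupp.single _ 1, by rw [sub_self]; exact Submodule.zero_mem _, fun U hU => ?_⟩
      rw [Finset.mem_singleton.1 (Finsupp.support_single_subset hU)]
      exact ⟨hb, ⟨by rw [hlab]; exact hin, heS⟩, .refl _, rfl, rfl, .inl rfl⟩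
    · rw [← hlab] at hw1 hw2
      rw [← length_mergedEntries (c := c) (j := j) (d := d)] at hw1
      have hw2' : ∀ N, N = n + m - 1 →
          Finsupp.single (contractLabel x c j y d) 1 - w ∈ operadIdeal B R N := by
        rintro _ rfl; exact hw2
      -- The expansion given by the axiom may be inhomogeneous. Its component of the right biweight
      -- suffices, and keeps the total weight and the labels different from the unit.
      have hw3 := InIdeal.filter hR (hw2' _ (length_mergedEntries (c := c) (j := j) (d := d)))
        (biweight B (contractLabel x c j y d))
      rw [Finsupp.filter_sub, Finsupp.filter_single_of_pos _ (by rfl)] at hw3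
      set w' := w.filter fun t => biweight B t = biweight B (contractLabel x c j y d) with hw'
      have hwt : ∀ t ∈ w'.support, t ∈ w.support ∧
          t.numVertices = (contractLabel x c j y d).numVertices := fun t ht => by
        rw [hw', Finsupp.support_filter, Finset.mem_filter, biweight_eq, biweight_eq] at ht
        have h1 := congrArg Prod.fst ht.2
        dsimp only at h1
        exact ⟨ht.1, by exact_mod_cast h1⟩
      have hgood : ∀ t ∈ w'.support, IsBarTree (node _ t e) ∧ (node _ t e : BarTree B).leaves.Perm
          (node _ (contractLabel x c j y d) e : BarTree B).leaves := fun t ht => by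
        have h1 := (hw1 t (hwt t ht).1).2.1
        refine ⟨⟨hb.canonical, ⟨h1, ?_, hb.labels.2.2⟩, hb.nodup⟩, .refl _⟩
        rw [(hwt t ht).2]; exact hb.labels.2.1
      refine ⟨Finsupp.mapDomain (fun t => node _ t e) w', ?_, fun U hU => ?_⟩
      · have := (IsContext.root e).mapDomain_mem (L :=
          (node _ (contractLabel x c j y d) e : BarTree B).leaves) hw3 (fun t ht => by
          rcases Finset.mem_union.1 (Finsupp.support_sub ht) with ht | ht
          · rw [Finset.mem_singleton.1 (Finsupp.support_single_subset ht)]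
            exact ⟨hb, .refl _⟩
          · exact hgood t ht)
        have hsub : Finsupp.mapDomain (fun t => (node _ t e : BarTree B))
            (Finsupp.single (contractLabel x c j y d) (1 : 𝕜) - w') =
            Finsupp.single (node _ (contractLabel x c j y d) e) 1 -
              Finsupp.mapDomain (fun t => node _ t e) w' := by
          rw [sub_eq_add_neg, Finsupp.mapDomain_add, Finsupp.mapDomain_single, sub_eq_add_neg]
          congr 1
          exact map_neg (Finsupp.mapDomain.addMonoidHom fun t => (node _ t e : BarTree B)) w'
        rwa [hsub] at this
      · obtain ⟨t, ht, rfl⟩ := Finset.mem_image.1 (Finsupp.mapDomain_support hU)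
        obtain ⟨h1, h2⟩ := hgood t ht
        obtain ⟨h3, h4, h5, h6⟩ := hw1 t (hwt t ht).1
        refine ⟨h1, ⟨h3, heS⟩, h2, rfl, ?_, .inr ⟨?_, ?_⟩⟩
        · rw [barWeight_node, barWeight_node, (hwt t ht).2]
        · rw [expand_node, expand_node]
          exact StdLE.bind hle hb.labels.1 h4 h5
            (fun k _ => (hb.entry k).stdLE_refl hle) hb.strictMonoOn_expand hb.leaves_disjoint
        · rw [expand_node, expand_node]
          intro H
          refine h6 (bind_injective_of_disjoint (s := Set.Iio _) (fun i _ => ?_)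
            hb.leaves_disjoint (fun i hi => hb.labels.1.mem_leaves.1 hi)
            (fun i hi => h4.mem_leaves.1 hi) hb.labels.1.nodup h4.nodup hb.labels.1.1 h4.1 H.symm)
          exact (expand_isCanonical (hb.entry i)).leaves_ne_nil
  | @above n x c j T' h ih =>
    obtain ⟨y, hy1, hy2⟩ := ih (hT.child j) (hTS.2 j)
    obtain ⟨hb, hp, _⟩ := h.isBarTree (hT.child j)
    obtain ⟨hb', hp'⟩ := hT.update hb hp
    have hupd : ∀ U, IsBarTree U → U.leaves.Perm T'.leaves →
        IsBarTree (node n x (Function.update c j U)) ∧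
        (node n x (Function.update c j U) : BarTree B).leaves.Perm
          (node n x (Function.update c j T') : BarTree B).leaves := fun U hU hUp => by
      obtain ⟨h1, h2⟩ := hT.update hU (hUp.trans hp)
      exact ⟨h1, h2.trans hp'.symm⟩
    refine ⟨Finsupp.mapDomain (fun U => node n x (Function.update c j U)) y, ?_, fun U hU => ?_⟩
    · have := treeRelations_map (R := R) hupd hy1
      have hsub : Finsupp.mapDomain (fun U => (node n x (Function.update c j U) : BarTree B))
          (Finsupp.single T' (1 : 𝕜) - y) =
          Finsupp.single (node n x (Function.update c j T')) 1 -
            Finsupp.mapDomain (fun U => node n x (Function.update c j U)) y := by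
        rw [sub_eq_add_neg, Finsupp.mapDomain_add, Finsupp.mapDomain_single, sub_eq_add_neg]
        congr 1
        exact map_neg (Finsupp.mapDomain.addMonoidHom
          fun U => (node n x (Function.update c j U) : BarTree B)) y
      rwa [hsub] at this
    · obtain ⟨U, hU', rfl⟩ := Finset.mem_image.1 (Finsupp.mapDomain_support hU)
      have hr := hy2 U hU'
      obtain ⟨h1, h2⟩ := hupd U hr.isBarTree hr.leaves_perm
      refine ⟨h1, ⟨hTS.1, fun k => ?_⟩, h2, ?_, ?_, ?_⟩
      · by_cases hk : k = j
        · subst hk; simpa using hr.allLabels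
        · simpa [hk] using hTS.2 k
      · rw [numVertices_node, numVertices_node]
        congr 1
        refine Finset.sum_congr rfl fun k _ => ?_
        by_cases hk : k = j
        · subst hk; simpa using hr.numVertices_eq
        · simp [hk]
      · rw [barWeight_node, barWeight_node]
        congr 1
        refine Finset.sum_congr rfl fun k _ => ?_
        by_cases hk : k = j
        · subst hk; simpa using hr.barWeight_eq
        · simp [hk]
      · rcases hr.eq_or_le with h3 | ⟨h3, h4⟩
        · exact .inl (by rw [h3])
        · right
          rw [expand_node, expand_node]
          constructor
          · refine StdLE.bind hle hT.labels.1 hT.labels.1 (hle.refl n x hT.labels.1)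
              (fun k hk => ?_) hb'.strictMonoOn_expand hb'.leaves_disjoint
            by_cases hkj : k = j
            · subst hkj; simpa using h3
            · rw [childAt_update c j U hkj, childAt_update c j T' hkj]
              exact (hT.entry k).stdLE_refl hle
          · intro H
            have := bind_eq_iff.1 H j (hT.labels.1.mem_leaves.2 j.2)
            rw [childAt_val, childAt_val, Function.update_self, Function.update_self] at this
            exact h4 this

end Reduction

end

/-! ### Admissible edges read on words; the criterion for labels in the PBW basis. -/

section
open OTree

variable {𝕜 : Type u} [Field 𝕜] {M : SigmaModule.{u, v} 𝕜} {B : HomogeneousBasis.{u, v, w} M}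

namespace OTree

variable {X : ℕ → Type w}

/-- The two-vertex tree generated by the edge above the entry `j` of a vertex, if it is not a
leaf. -/
def entryRestrict {n : ℕ} (x : X n) (c : Fin n → OTree X) (j : Fin n) : Option (OTree X) :=
  match c j with
  | leaf _ => none
  | node m y d => some (node n x fun k =>
      if k = j then node m y fun l => leaf (subtreeRank c j d (d l).minLeaf)
      else leaf (subtreeRank c j d (c k).minLeaf))

/-- The two-vertex trees generated by the edges under the vertices of a tree, in the order of its
word; the root is given the value `o`, and the leaves the value `none`. -/
def edgeWord : Option (OTree X) → OTree X → List (Option (OTree X))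
  | _, leaf _ => [none]
  | o, node _ x c => o :: (List.ofFn fun k => edgeWord (entryRestrict x c k) (c k)).flatten

lemma length_edgeWord (o : Option (OTree X)) (t : OTree X) :
    (edgeWord o t).length = t.word.length := by
  induction t generalizing o with
  | leaf i => rfl
  | node n x c ih =>
    simp only [edgeWord, word, List.length_cons, List.length_flatten, List.map_ofFn]
    congr 3
    funext k
    exact ih k _

lemma entryRestrict_of_node {n m : ℕ} {x : X n} {c : Fin n → OTree X} {j : Fin n} {y : X m}
    {d : Fin m → OTree X} (h : c j = node m y d) : entryRestrict x c j =
      some (Edge.restrict (Edge.here (x := x) j h)) := by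
  rw [entryRestrict, h]; rfl

lemma entryRestrict_of_leaf {n : ℕ} {x : X n} {c : Fin n → OTree X} {j : Fin n} {i : ℕ}
    (h : c j = leaf i) : entryRestrict x c j = none := by
  rw [entryRestrict, h]

lemma exists_restrict_of_mem_edgeWord {o : Option (OTree X)} {t s : OTree X}
    (h : some s ∈ edgeWord o t) : o = some s ∨ ∃ e : Edge t, e.restrict = s := by
  induction t generalizing o with
  | leaf i => simp [edgeWord] at h
  | node n x c ih =>
    simp only [edgeWord, List.mem_cons, List.mem_flatten, List.mem_ofFn] at h
    rcases h with h | ⟨_, ⟨k, rfl⟩, h⟩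
    · exact .inl h.symm
    · right
      rcases ih k h with h | ⟨e, he⟩
      · cases hk : c k with
        | leaf i => rw [entryRestrict_of_leaf hk] at h; simp at h
        | node m y d =>
          rw [entryRestrict_of_node hk] at h
          exact ⟨_, Option.some_injective _ h⟩
      · exact ⟨.there k e, he⟩

lemma restrict_mem_edgeWord {t : OTree X} (e : Edge t) (o : Option (OTree X)) :
    some e.restrict ∈ (edgeWord o t).tail := by
  induction e generalizing o with
  | @here n x c j m y d h =>
    simp only [edgeWord, List.tail_cons, List.mem_flatten, List.mem_ofFn]
    refine ⟨_, ⟨j, rfl⟩, ?_⟩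
    rw [entryRestrict_of_node h, h, edgeWord]
    exact List.mem_cons_self
  | @there n x c j e ih =>
    simp only [edgeWord, List.tail_cons, List.mem_flatten, List.mem_ofFn]
    exact ⟨_, ⟨j, rfl⟩, List.mem_of_mem_tail (ih _)⟩

lemma forall_edge_node {n : ℕ} {x : X n} {c : Fin n → OTree X} {P : OTree X → Prop} :
    (∀ e : Edge (node n x c), P e.restrict) ↔ ∀ k,
      (∀ s, entryRestrict x c k = some s → P s) ∧ ∀ e : Edge (c k), P e.restrict := by
  constructor
  · refine fun h k => ⟨fun s hs => ?_, fun e => h (.there k e)⟩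
    cases hk : c k with
    | leaf i => rw [entryRestrict_of_leaf hk] at hs; simp at hs
    | node m y d =>
      rw [entryRestrict_of_node hk, Option.some.injEq] at hs
      rw [← hs]; exact h _
  · intro h e
    cases e with
    | here j hj => exact (h j).1 _ (entryRestrict_of_node hj)
    | there j e => exact (h j).2 e

/-- Substituting trees for the leaves does not change the two-vertex subtrees. -/
lemma entryRestrict_bind {n m : ℕ} {x : X n} {c : Fin n → OTree X} {j : Fin n} {y : X m}
    {d : Fin m → OTree X} (hj : c j = node m y d) {g : ℕ → OTree X}
    (hc : (node n x c).IsCanonical)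
    (hg : StrictMonoOn (fun i => (g i).minLeaf) {i | i ∈ (node n x c).leaves})
    (hne : ∀ i ∈ (node n x c).leaves, (g i).leaves ≠ []) :
    entryRestrict x (fun k => (c k).bind g) j = entryRestrict x c j := by
  have hcl : ∀ k i, i ∈ (c k).leaves → i ∈ (node n x c).leaves := fun k i hi =>
    mem_leaves_node.2 ⟨k, hi⟩
  have hdl : ∀ l i, i ∈ (d l).leaves → i ∈ (node n x c).leaves := fun l i hi =>
    hcl j i (by rw [hj]; exact mem_leaves_node.2 ⟨l, hi⟩)
  have hdc : ∀ l, (d l).IsCanonical := fun l => by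
    have := hc.2.2 j
    rw [hj] at this
    exact this.2.2 l
  have hmc : ∀ k, ((c k).bind g).minLeaf = (g (c k).minLeaf).minLeaf ∧
      (c k).minLeaf ∈ (node n x c).leaves := fun k =>
    ⟨minLeaf_bind (hc.2.2 k).leaves_ne_nil (fun i hi => hne i (hcl k i hi))
      (hg.mono fun i hi => hcl k i hi).monotoneOn,
      hcl k _ (minLeaf_mem (hc.2.2 k).leaves_ne_nil)⟩
  have hmd : ∀ l, ((d l).bind g).minLeaf = (g (d l).minLeaf).minLeaf ∧
      (d l).minLeaf ∈ (node n x c).leaves := fun l =>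
    ⟨minLeaf_bind (hdc l).leaves_ne_nil (fun i hi => hne i (hdl l i hi))
      (hg.mono fun i hi => hdl l i hi).monotoneOn,
      hdl l _ (minLeaf_mem (hdc l).leaves_ne_nil)⟩
  have hrank : ∀ a ∈ (node n x c).leaves,
      subtreeRank (fun k => (c k).bind g) j (fun l => (d l).bind g) (g a).minLeaf =
        subtreeRank c j d a := by
    intro a ha
    rw [subtreeRank, subtreeRank]
    congr 2
    · refine Finset.filter_congr fun k _ => ?_
      rw [(hmc k).1, hg.lt_iff_lt (hmc k).2 ha]
    · refine Finset.filter_congr fun l _ => ?_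
      rw [(hmd l).1, hg.lt_iff_lt (hmd l).2 ha]
  have hj' : (c j).bind g = node m y fun l => (d l).bind g := by rw [hj]; rfl
  rw [entryRestrict_of_node (c := fun k => (c k).bind g) hj', entryRestrict_of_node hj]
  simp only [Edge.restrict]
  congr 2
  funext k
  by_cases hk : k = j
  · simp only [hk, if_true]
    congr 1
    funext l
    rw [(hmd l).1, hrank _ (hmd l).2]
  · simp only [hk, if_false]
    rw [(hmc k).1, hrank _ (hmc k).2]

end OTree

lemma forall₂_append_iff {α β : Type*} {P : α → β → Prop} {l₁ l₂ : List α} {m₁ m₂ : List β}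
    (h : l₁.length = m₁.length) : List.Forall₂ P (l₁ ++ l₂) (m₁ ++ m₂) ↔
      List.Forall₂ P l₁ m₁ ∧ List.Forall₂ P l₂ m₂ := by
  induction l₁ generalizing m₁ with
  | nil =>
    cases m₁ with
    | nil => simp
    | cons b m => simp at h
  | cons a l ih =>
    cases m₁ with
    | nil => simp at h
    | cons b m => simp [ih (by simpa using h), and_assoc]

lemma forall₂_flatten_ofFn {α β : Type*} {P : α → β → Prop} {n : ℕ} {F : Fin n → List α}
    {G : Fin n → List β} (h : ∀ k, (F k).length = (G k).length) :
    List.Forall₂ P (List.ofFn F).flatten (List.ofFn G).flatten ↔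
      ∀ k, List.Forall₂ P (F k) (G k) := by
  induction n with
  | zero => simp
  | succ n ih =>
    rw [List.ofFn_succ, List.ofFn_succ, List.flatten_cons, List.flatten_cons,
      forall₂_append_iff (h 0), ih fun k => h k.succ, Fin.forall_fin_succ]

section Criterion

variable (S : Set (BTree B))

/-- The edge under a marked vertex is admissible. -/
def MarkAdmissible (a : ((Σ n, B.ι n) × Bool) ⊕ ℕ) (o : Option (BTree B)) : Prop :=
  ∀ v, a = .inl (v, true) → ∃ t ∈ S, o = some t

variable {S}

lemma length_markedWord (T : BarTree B) (o : Option (BTree B)) :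
    (markedWord T).length = (edgeWord o (expand T)).length := by
  rw [length_edgeWord, word_expand, forgetMarks, List.length_map]

/-- The first letter of a marked word is not marked, so the value attached to the root is
irrelevant. -/
lemma forall₂_edgeWord_root {T : BarTree B} (hT : LabelsOK B T) (o o' : Option (BTree B)) :
    List.Forall₂ (MarkAdmissible S) (markedWord T) (edgeWord o (expand T)) ↔
      List.Forall₂ (MarkAdmissible S) (markedWord T) (edgeWord o' (expand T)) := by
  cases hT' : expand T with
  | leaf i => rfl
  | node n b c =>
    rcases markedWord_head hT with ⟨i, h⟩ | ⟨u, l, h⟩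
    · rw [h]; simp [edgeWord, MarkAdmissible]
    · rw [h]; simp [edgeWord, MarkAdmissible]

/-- The marked vertices of a label are the upper ends of its internal edges, and substituting the
entries does not alter their two-vertex subtrees (`entryRestrict_bind`). The value `o` stands for
the edge below the root of `t`, which is marked here as well. -/
lemma forall₂_markWord_iff {t : BTree B} {h : ℕ → BarTree B} (ht : t.IsCanonical)
    (hn : t.leaves.Nodup) (hh : ∀ i ∈ t.leaves, IsBarTree (h i))
    (hm : StrictMonoOn (fun i => (h i).minLeaf) {i | i ∈ t.leaves}) (o : Option (BTree B)) :
    List.Forall₂ (MarkAdmissible S) (markWord (fun i => markedWord (h i)) t.word)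
      (edgeWord o (t.bind fun i => expand (h i))) ↔
      (0 < t.numVertices → ∃ s ∈ S, o = some s) ∧ (∀ e : Edge t, e.restrict ∈ S) ∧
      ∀ i ∈ t.leaves, List.Forall₂ (MarkAdmissible S) (markedWord (h i))
        (edgeWord none (expand (h i))) := by
  induction t generalizing o with
  | leaf i =>
    have hE : ∀ e : Edge (leaf i : BTree B), e.restrict ∈ S := fun e => nomatch e
    simp only [word, markWord_inr, markWord_nil, List.append_nil, OTree.bind, leaves, List.mem_singleton,
      forall_eq, hE, implies_true, true_and]
    rw [forall₂_edgeWord_root (hh i (by simp [leaves])).labels o none]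
    simp [numVertices, vertexSum]
  | node n b c ih =>
    have hsub : ∀ k i, i ∈ (c k).leaves → i ∈ (node n b c).leaves := fun k i hi =>
      mem_leaves_node.2 ⟨k, hi⟩
    have hne : ∀ i ∈ (node n b c).leaves, (expand (h i)).leaves ≠ [] := fun i hi =>
      (expand_isCanonical (hh i hi)).leaves_ne_nil
    have hmE : StrictMonoOn (fun i => (expand (h i)).minLeaf) {i | i ∈ (node n b c).leaves} := by
      intro i hi k hk hik
      dsimp only
      rw [minLeaf_expand (hh i hi).labels, minLeaf_expand (hh k hk).labels]
      exact hm hi hk hik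
    have ih' := fun k => ih k (ht.2.2 k) ((nodup_leaves_node hn).1 k)
      (fun i hi => hh i (hsub k i hi)) (hm.mono fun i hi => hsub k i hi)
    have hlen : ∀ (t : BTree B) (o : Option (BTree B)),
        (markWord (fun i => markedWord (h i)) t.word).length =
          (edgeWord o (t.bind fun i => expand (h i))).length := by
      intro t o
      rw [length_edgeWord, word_bind]
      induction t.word with
      | nil => rfl
      | cons a r ih =>
        rcases a with a | a
        · simp [ih]
        · simp [ih, ← length_edgeWord none, ← length_markedWord]
    simp only [word, markWord_inl, markWord_flatten, List.map_ofFn, OTree.bind, edgeWord,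
      List.forall₂_cons]
    rw [forall₂_flatten_ofFn (by exact fun k => hlen (c k) _)]
    simp only [Function.comp_apply, ih', forall_edge_node]
    have h1 : MarkAdmissible S (.inl ((⟨n, b⟩ : Σ n, B.ι n), true)) o ↔
        (0 < (node n b c).numVertices → ∃ s ∈ S, o = some s) := by
      have : 0 < (node n b c).numVertices := by rw [numVertices_node]; omega
      simp [MarkAdmissible, this]
    rw [h1]
    refine and_congr_right fun _ => ?_
    have h2 : ∀ k, (0 < (c k).numVertices → ∃ s ∈ S,
        entryRestrict b (fun k => (c k).bind fun i => expand (h i)) k = some s) ↔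
        ∀ s, entryRestrict b c k = some s → s ∈ S := by
      intro k
      cases hk : c k with
      | leaf i => simp [numVertices, vertexSum, entryRestrict_of_leaf hk]
      | node m y d =>
        rw [entryRestrict_bind hk ht hmE hne, entryRestrict_of_node hk]
        have : 0 < (node m y d).numVertices := by rw [numVertices_node]; omega
        simp [this]
    simp only [h2, mem_leaves_node]
    constructor
    · exact fun H => ⟨fun k => ⟨(H k).1, (H k).2.1⟩, fun i ⟨k, hk⟩ => (H k).2.2 i hk⟩
    · exact fun H k => ⟨(H.1 k).1, (H.1 k).2, fun i hi => H.2 i ⟨k, hi⟩⟩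

/-- The labels of a tree belong to `S` if and only if the edges under the marked vertices of its
word are admissible. -/
theorem allLabels_iff_forall₂ {R : ℕ → Set (BTensor B)} {le : BTree B → BTree B → Prop}
    (hS : IsPBWBasis B R le S) {T : BarTree B} (hT : IsBarTree T) : AllLabels S T ↔
      List.Forall₂ (MarkAdmissible S) (markedWord T) (edgeWord none (expand T)) := by
  induction T with
  | leaf i => simp [AllLabels, markedWord, expand, edgeWord, MarkAdmissible]
  | node n x c ih =>
    obtain ⟨v, l, e1, e2⟩ := markedWord_node_label (c := c) hT.labels.2.1
    -- `markWord` marks the root of the label too. A fictitious admissible edge `s₀` below it makes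
    -- the condition there vacuous.
    obtain ⟨s₀, hs₀⟩ : ∃ s, s ∈ S := ⟨_, hS.one_mem⟩
    have hE := forall₂_markWord_iff (S := S) (t := x) (h := childAt c) hT.labels.1.1
      hT.labels.1.nodup (fun i _ => hT.entry i)
      (hT.strictMonoOn.mono fun i hi => hT.labels.1.mem_leaves.1 hi) (some s₀)
    have h1 : List.Forall₂ (MarkAdmissible S) (markedWord (node n x c))
        (edgeWord none (expand (node n x c))) ↔
        List.Forall₂ (MarkAdmissible S) (markWord (fun i => markedWord (childAt c i)) x.word)
        (edgeWord (some s₀) (x.bind fun i => expand (childAt c i))) := by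
      rw [forall₂_edgeWord_root hT.labels none (some s₀), e1, e2, expand_node]
      obtain ⟨m, b, d, rfl⟩ := exists_node_of_pos hT.labels.2.1
      simp [OTree.bind, edgeWord, MarkAdmissible, hs₀]
    rw [h1, hE, AllLabels, hS.mem_iff n x hT.labels.1]
    have h2 : ∃ s ∈ S, some s₀ = some s := ⟨s₀, hs₀, rfl⟩
    simp only [h2, implies_true, true_and]
    refine and_congr_right fun _ => ?_
    constructor
    · intro H i hi
      have := hT.labels.1.mem_leaves.1 hi
      rw [childAt_of_lt c this]
      exact (ih _ (hT.child _)).1 (H _)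
    · intro H k
      have := H k (hT.labels.1.mem_leaves.2 k.2)
      rw [childAt_val] at this
      exact (ih k (hT.child k)).2 this

/-- The vertex at the position `p` of the word of `t` is at the end of an admissible edge. -/
def IsAdmissibleAt (S : Set (BTree B)) (t : BTree B) (p : ℕ) : Prop :=
  ∃ s ∈ S, (edgeWord none t)[p]? = some (some s)

/-- Positional form of condition (ii): the labels lie in `S` exactly when only admissible edges of
the expansion have been contracted. -/
theorem allLabels_iff {R : ℕ → Set (BTensor B)} {le : BTree B → BTree B → Prop}
    (hS : IsPBWBasis B R le S) {T : BarTree B} (hT : IsBarTree T) : AllLabels S T ↔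
      ∀ p v, (markedWord T)[p]? = some (.inl (v, true)) → IsAdmissibleAt S (expand T) p := by
  rw [allLabels_iff_forall₂ hS hT, List.forall₂_iff_get]
  have hl := length_markedWord T none
  constructor
  · rintro ⟨-, H⟩ p v h
    obtain ⟨hp, h⟩ := List.getElem?_eq_some_iff.1 h
    obtain ⟨s, hs, h'⟩ := H p hp (hl ▸ hp) v h
    exact ⟨s, hs, List.getElem?_eq_some_iff.2 ⟨hl ▸ hp, h'⟩⟩
  · refine fun H => ⟨hl, fun p hp hp' v h => ?_⟩
    obtain ⟨s, hs, h'⟩ := H p v (List.getElem?_eq_some_iff.2 ⟨hp, h⟩)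
    exact ⟨s, hs, (List.getElem?_eq_some_iff.1 h').2⟩

end Criterion

end

/-! ### Monomials as treewise tensors of generators, and their contractions. -/

section
open OTree

variable {𝕜 : Type u} [Field 𝕜] {M : SigmaModule.{u, v} 𝕜} {B : HomogeneousBasis.{u, v, w} M}

/-! ### Treewise tensors of generators -/

lemma isReduced_corolla {X : ℕ → Type*} {n : ℕ} (hn : 0 < n) (x : X n) :
    (corolla n x).IsReduced n := by
  refine ⟨⟨hn, fun i j h => ?_, fun _ => trivial⟩, ?_⟩
  · simpa [minLeaf_leaf] using h
  · rw [corolla, leaves_node]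
    have : (List.ofFn fun k : Fin n => (leaf (k : ℕ) : OTree X)).flatMap leaves = List.range n := by
      rw [List.ofFn_eq_map, List.flatMap_map, ← List.map_coe_finRange_eq_range,
        List.map_eq_flatMap]
      rfl
    rw [this]

lemma leaves_toBar (t : BTree B) : (toBar B t).leaves = t.leaves := by
  induction t with
  | leaf i => rfl
  | node n b c ih => simp [toBar, leaves, ih]

lemma numVertices_toBar (t : BTree B) : (toBar B t).numVertices = t.numVertices := by
  induction t with
  | leaf i => rfl
  | node n b c ih => simp [toBar, numVertices_node, ih]

lemma isCanonical_toBar {t : BTree B} (ht : t.IsCanonical) : (toBar B t).IsCanonical := by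
  induction t with
  | leaf i => trivial
  | node n b c ih =>
    refine ⟨ht.1, fun i j h => ?_, fun k => ih k (ht.2.2 k)⟩
    have := ht.2.1 h
    simpa only [minLeaf, leaves_toBar] using this

lemma labelsOK_toBar {t : BTree B} (ht : t.IsCanonical) : LabelsOK B (toBar B t) := by
  induction t with
  | leaf i => trivial
  | node n b c ih =>
    refine ⟨isReduced_corolla ht.1 b, ?_, fun k => ih k (ht.2.2 k)⟩
    rw [corolla, numVertices_node]; omega

lemma isBarTree_toBar {t : BTree B} (ht : t.IsCanonical) (hn : t.leaves.Nodup) :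
    IsBarTree (toBar B t) :=
  ⟨isCanonical_toBar ht, labelsOK_toBar ht, by rwa [leaves_toBar]⟩

lemma allLabels_toBar {R : ℕ → Set (BTensor B)} {le : BTree B → BTree B → Prop}
    {S : Set (BTree B)} (hS : IsPBWBasis B R le S) (t : BTree B) : AllLabels S (toBar B t) := by
  induction t with
  | leaf i => trivial
  | node n b c ih => exact ⟨hS.generator_mem n b, ih⟩

/-- The word with no marked vertex. -/
def unmarked (l : List ((Σ n, B.ι n) ⊕ ℕ)) : MarkedWord B := l.map (Sum.map (fun v => (v, false)) id)

lemma markedWord_toBar (t : BTree B) : markedWord (toBar B t) = unmarked t.word := by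
  induction t with
  | leaf i => rfl
  | node n b c ih =>
    have h1 : (corolla n b).word =
        .inl ⟨n, b⟩ :: (List.ofFn fun k : Fin n => [(.inr (k : ℕ) : (Σ n, B.ι n) ⊕ ℕ)]).flatten := rfl
    rw [toBar, markedWord_node, h1, markWord_inl, markWord_flatten, List.map_ofFn]
    simp [word, unmarked, unmarkHead, List.map_flatten, List.map_ofFn, Function.comp_def, ih]

lemma expand_toBar (t : BTree B) : expand (toBar B t) = t := by
  apply word_injective
  rw [word_expand, markedWord_toBar, forgetMarks, unmarked, List.map_map]
  conv_rhs => rw [← List.map_id t.word]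
  refine List.map_congr_left fun a _ => ?_
  rcases a with a | a <;> rfl

/-- The number of marked vertices. -/
def markCount (l : MarkedWord B) : ℕ :=
  (l.map (Sum.elim (fun v => if v.2 then 1 else 0) fun _ => 0)).sum

lemma markCount_append (l l' : MarkedWord B) :
    markCount (l ++ l') = markCount l + markCount l' := by simp [markCount]

lemma markCount_markWord (h : ℕ → MarkedWord B) (r : List ((Σ n, B.ι n) ⊕ ℕ)) :
    markCount (markWord h r) = (r.map (Sum.elim (fun _ => 1) fun _ => 0)).sum +
      ((wordLeaves r).map fun i => markCount (h i)).sum := by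
  induction r with
  | nil => simp [markCount]
  | cons a r ih =>
    rcases a with a | a
    · have : markCount (markWord h (.inl a :: r)) = 1 + markCount (markWord h r) := by
        simp [markCount]
      rw [this, ih]
      simp [add_assoc]
    · rw [markWord_inr, markCount_append, ih]
      simp
      ring

/-- In a label of weight `k` all vertices but the root are marked, that is, `k - 1` of them. -/
lemma markCount_markedWord {T : BarTree B} (hT : LabelsOK B T) :
    markCount (markedWord T) + T.numVertices = barWeight B T := by
  induction T with
  | leaf i => simp [markCount, markedWord, numVertices, barWeight, vertexSum]
  | node n x c ih =>
    obtain ⟨v, l, e1, e2⟩ := markedWord_node_label (c := c) hT.2.1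
    have h1 : markCount (markedWord (node n x c)) + 1 =
        markCount (markWord (fun i => markedWord (childAt c i)) x.word) := by
      rw [e1, e2]; simp [markCount, add_comm]
    have h2 : (x.word.map (Sum.elim (fun _ => 1) fun _ => 0)).sum = x.numVertices := by
      rw [numVertices, vertexSum_eq]
    have h3 : (x.leaves.map fun i => markCount (markedWord (childAt c i))).sum =
        ∑ k, markCount (markedWord (c k)) := by
      rw [(hT.1.2.map _).sum_eq, ← List.map_coe_finRange_eq_range, List.map_map, Fin.sum_univ_def]
      simp [Function.comp_def]
    rw [markCount_markWord, h2, wordLeaves_word, h3] at h1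
    have h4 : ∑ k, barWeight B (c k) = ∑ k, markCount (markedWord (c k)) +
        ∑ k, (c k).numVertices := by
      rw [← Finset.sum_add_distrib]
      exact Finset.sum_congr rfl fun k _ => (ih k (hT.2.2 k)).symm
    rw [barWeight_node, numVertices_node, h4]
    omega

lemma barWeight_eq {T : BarTree B} (hT : LabelsOK B T) :
    barWeight B T = (expand T).numVertices := by
  induction T with
  | leaf i => rfl
  | node n x c ih =>
    rw [barWeight_node, expand_node, numVertices, numVertices, vertexSum_bind]
    congr 1
    rw [(hT.1.2.map _).sum_eq, ← List.map_coe_finRange_eq_range, List.map_map, Fin.sum_univ_def]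
    congr 1
    refine List.map_congr_left fun k _ => ?_
    simp [ih k (hT.2.2 k), numVertices]

lemma markCount_eq_zero {l : MarkedWord B} (h : markCount l = 0) :
    unmarked (forgetMarks l) = l := by
  induction l with
  | nil => rfl
  | cons a l ih =>
    have h1 : markCount l = 0 := by
      rcases a with a | a <;> simp [markCount] at h ⊢
      · exact h.2
      · exact h
    have h2 := ih h1
    simp only [unmarked, forgetMarks, List.map_cons] at h2 ⊢
    rw [h2]
    congr 1
    rcases a with ⟨u, b⟩ | a
    · simp [markCount] at h
      simp [h.1]
    · rfl

lemma exists_split_of_markCount {l : MarkedWord B} (h : markCount l = 1) :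
    ∃ l₁ v l₂, l = l₁ ++ .inl (v, true) :: l₂ ∧ markCount l₁ = 0 ∧ markCount l₂ = 0 := by
  induction l with
  | nil => simp [markCount] at h
  | cons a l ih =>
    have hc : markCount (a :: l) = markCount [a] + markCount l := markCount_append [a] l
    by_cases ha : markCount [a] = 0
    · obtain ⟨l₁, v, l₂, h1, h2, h3⟩ := ih (by omega)
      refine ⟨a :: l₁, v, l₂, by rw [h1]; rfl, ?_, h3⟩
      have : markCount (a :: l₁) = markCount [a] + markCount l₁ := markCount_append [a] l₁
      omega
    · rcases a with ⟨u, b⟩ | a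
      · cases b
        · simp [markCount] at ha
        · refine ⟨[], u, l, rfl, rfl, ?_⟩
          have : markCount [(.inl (u, true) : ((Σ n, B.ι n) × Bool) ⊕ ℕ)] = 1 := by simp [markCount]
          omega
      · simp [markCount] at ha

/-- Equality of weight and number of vertices means that no vertex is marked, and the marked word
determines the tree. -/
lemma IsBarTree.eq_toBar {T : BarTree B} (hT : IsBarTree T)
    (h : barWeight B T = T.numVertices) : T = toBar B (expand T) := by
  refine markedWord_inj hT (isBarTree_toBar (expand_isCanonical hT) (expand_nodup hT)) ?_
  have := markCount_markedWord hT.labels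
  rw [markedWord_toBar, word_expand, markCount_eq_zero (by omega)]

/-- An excess of one means exactly one mark; removing it gives the word of the underlying monomial.
These are the tensors `λ/q` in which `δ` of a chain of generators is expressed. -/
lemma IsBarTree.exists_eq_contractAt {T : BarTree B} (hT : IsBarTree T)
    (h : barWeight B T = T.numVertices + 1) :
    ∃ p, IsContractible (markedWord (toBar B (expand T))) p ∧
      T = contractAt (toBar B (expand T)) p := by
  have hc := markCount_markedWord hT.labels
  obtain ⟨l₁, v, l₂, h1, h2, h3⟩ := exists_split_of_markCount (l := markedWord T) (by omega)
  have h0 : l₁ ≠ [] := by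
    rintro rfl
    rcases markedWord_head hT.labels with ⟨i, e⟩ | ⟨u, l, e⟩ <;> rw [e] at h1 <;> simp at h1
  have h4 : markedWord (toBar B (expand T)) = l₁ ++ .inl (v, false) :: l₂ := by
    rw [markedWord_toBar, word_expand, h1]
    have e1 := markCount_eq_zero h2
    have e2 := markCount_eq_zero h3
    simp only [unmarked, forgetMarks, List.map_append, List.map_cons] at e1 e2 ⊢
    rw [e1, e2]
    rfl
  exact ⟨l₁.length, isContractible_iff.2 ⟨l₁, v, l₂, h0, h4, rfl⟩, (contractAt_eq hT h4 h1).symm⟩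

/-- A contraction alters marks only, and the expansion forgets them. -/
lemma Contracts.expand_eq {T T' : BarTree B} (h : Contracts T T') (hT : IsBarTree T) :
    expand T' = expand T := by
  obtain ⟨_, _, l₁, v, l₂, _, h4, h5⟩ := h.isBarTree hT
  refine expand_eq_of_forgetMarks ?_
  rw [h4, h5]
  simp [forgetMarks]

lemma Contracts.barWeight_eq {T T' : BarTree B} (h : Contracts T T') (hT : IsBarTree T) :
    barWeight B T' = barWeight B T := by
  rw [OperadPBW.barWeight_eq (h.isBarTree hT).1.labels, OperadPBW.barWeight_eq hT.labels,
    h.expand_eq hT]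

lemma Contracts.numVertices_eq {T T' : BarTree B} (h : Contracts T T') (hT : IsBarTree T) :
    T'.numVertices + 1 = T.numVertices := by
  have h1 := markCount_markedWord (h.isBarTree hT).1.labels
  have h2 := markCount_markedWord hT.labels
  have h3 := h.barWeight_eq hT
  obtain ⟨_, _, l₁, v, l₂, _, h4, h5⟩ := h.isBarTree hT
  have h6 : markCount (markedWord T') = markCount (markedWord T) + 1 := by
    rw [h4, h5, markCount_append, markCount_append]
    simp [markCount]
    ring
  omega

/-- A position of the word of a monomial is contractible if and only if it is the one of a vertex
different from the root. -/
lemma isContractible_toBar {t : BTree B} {p : ℕ} : IsContractible (markedWord (toBar B t)) p ↔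
    0 < p ∧ ∃ v, t.word[p]? = some (.inl v) := by
  rw [IsContractible, markedWord_toBar, unmarked]
  refine and_congr_right fun _ => ?_
  simp only [List.getElem?_map]
  constructor
  · rintro ⟨v, h⟩
    rcases h' : t.word[p]? with _ | a
    · rw [h'] at h; simp at h
    · rcases a with a | a
      · exact ⟨a, rfl⟩
      · rw [h'] at h; simp at h
  · rintro ⟨v, h⟩
    exact ⟨v, by rw [h]; rfl⟩

lemma IsAdmissibleAt.isContractible {S : Set (BTree B)} {t : BTree B} {p : ℕ}
    (h : IsAdmissibleAt S t p) : IsContractible (markedWord (toBar B t)) p := by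
  -- The value `o` at the root is kept arbitrary for the induction, because an entry receives the
  -- two-vertex tree of the edge below it.
  have aux : ∀ (o : Option (BTree B)) (p : ℕ) (s : BTree B),
      (edgeWord o t)[p]? = some (some s) → (0 < p ∨ o = some s) ∧ ∃ v, t.word[p]? = some (Sum.inl v) := by
    clear h p
    induction t with
    | leaf i =>
      intro o p s h
      rcases p with _ | p <;> simp [edgeWord] at h
    | node n b c ih =>
      intro o p s h
      rcases p with _ | p
      · simp [edgeWord] at h
        exact ⟨.inr h, ⟨n, b⟩, rfl⟩
      · refine ⟨.inl (Nat.succ_pos _), ?_⟩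
        simp only [edgeWord, word, List.getElem?_cons_succ] at h ⊢
        have aux2 : ∀ {N : ℕ} (F : Fin N → List (Option (BTree B)))
            (G : Fin N → List ((Σ n, B.ι n) ⊕ ℕ)),
            (∀ k : Fin N, (F k).length = (G k).length) → (∀ (k : Fin N) (p : ℕ), (F k)[p]? = some (some s) →
              ∃ v, (G k)[p]? = some (Sum.inl v)) → ∀ p : ℕ, (List.ofFn F).flatten[p]? = some (some s) →
            ∃ v, (List.ofFn G).flatten[p]? = some (Sum.inl v) := by
          intro N F G hl hFG p hp
          induction N generalizing p with
          | zero => simp at hp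
          | succ N ihN =>
            rw [List.ofFn_succ, List.flatten_cons] at hp ⊢
            rw [List.getElem?_append] at hp ⊢
            rw [← hl 0]
            split_ifs at hp ⊢ with hlt
            · exact hFG 0 p hp
            · exact ihN _ _ (fun k => hl k.succ) (fun k => hFG k.succ) _ hp
        exact aux2 _ _ (fun k => length_edgeWord _ _) (fun k p hp => (ih k _ p s hp).2) p h
  obtain ⟨s, hs, h⟩ := h
  obtain ⟨h1, h2⟩ := aux none p s h
  exact isContractible_toBar.2 ⟨by simpa using h1, h2⟩

lemma exists_isAdmissibleAt_iff {S : Set (BTree B)} {t : BTree B} :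
    (∃ p, IsAdmissibleAt S t p) ↔ (admissibleEdges B S t).Nonempty := by
  constructor
  · rintro ⟨p, s, hs, h⟩
    rcases exists_restrict_of_mem_edgeWord (List.mem_of_getElem? h) with h | ⟨e, he⟩
    · simp at h
    · exact ⟨e, by rw [← he] at hs; exact hs⟩
  · rintro ⟨e, he⟩
    obtain ⟨p, hp⟩ := List.mem_iff_getElem?.1 (List.mem_of_mem_tail (restrict_mem_edgeWord e none))
    exact ⟨p, _, he, hp⟩

end

/-! ### Triangularity of the differential and the two kernel arguments. -/

section
open OTree

variable {𝕜 : Type u} [Field 𝕜] {M : SigmaModule.{u, v} 𝕜} {B : HomogeneousBasis.{u, v, w} M}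

lemma getElem?_markAt_ne (l : MarkedWord B) {p q : ℕ} (h : p ≠ q) :
    (markAt l p)[q]? = l[q]? := by
  rw [markAt, List.getElem?_modify_ne _ _ h]

lemma getElem?_markAt_self {l : MarkedWord B} {p : ℕ} {v b} (h : l[p]? = some (.inl (v, b))) :
    (markAt l p)[p]? = some (.inl (v, true)) := by
  rw [markAt, List.getElem?_modify_eq, h]
  rfl

/-- The smallest leaves of the entries of a vertex are distinct numbers below `r`, which bounds the
arities by `r`; each arity has finitely many labels. -/
lemma finite_setOf_isReduced (hB : ∀ n, Finite (B.ι n)) (s r : ℕ) :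
    {t : BTree B | t.IsReduced r ∧ t.numVertices = s}.Finite := by
  -- Subtrees of reduced trees need not be reduced, so the induction on the number of vertices only
  -- asks for canonical form and leaves below `r`.
  have key : ∀ k, {t : BTree B | t.numVertices ≤ k ∧ t.IsCanonical ∧ ∀ i ∈ t.leaves, i < r}.Finite := by
    intro k
    induction k with
    | zero =>
      refine ((Set.finite_Iio r).image leaf).subset ?_
      rintro t ⟨h1, h2, h3⟩
      cases t with
      | leaf i => exact ⟨i, h3 i (by simp [leaves]), rfl⟩
      | node n b c => rw [numVertices_node] at h1; omega
    | succ k ih =>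
      refine (((Set.finite_Iio r).image leaf).union (Set.finite_iUnion fun n : Fin (r + 1) =>
        Set.finite_iUnion fun b : B.ι n => ((Set.Finite.pi' fun _ : Fin n => ih).image
          fun c => (node (n : ℕ) b c : BTree B)))).subset ?_
      rintro t ⟨h1, h2, h3⟩
      cases t with
      | leaf i => exact .inl ⟨i, h3 i (by simp [leaves]), rfl⟩
      | node n b c =>
        have hn : n ≤ r := by
          have hlt : ∀ k, (c k).minLeaf < r := fun k =>
            h3 _ (mem_leaves_node.2 ⟨k, minLeaf_mem (h2.2.2 k).leaves_ne_nil⟩)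
          have := Fintype.card_le_of_injective (fun k => (⟨_, hlt k⟩ : Fin r)) fun i j hij =>
            h2.2.1.injective (congrArg Fin.val hij)
          simpa using this
        right
        simp only [Set.mem_iUnion]
        refine ⟨⟨n, by omega⟩, b, c, fun j => ⟨?_, h2.2.2 j, fun i hi =>
          h3 i (mem_leaves_node.2 ⟨j, hi⟩)⟩, rfl⟩
        rw [numVertices_node] at h1
        have := Finset.single_le_sum (f := fun j => (c j).numVertices) (fun _ _ => Nat.zero_le _)
          (Finset.mem_univ j)
        dsimp only at this
        omega
  refine (key s).subset ?_
  rintro t ⟨h1, rfl⟩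
  exact ⟨le_rfl, h1.1, fun i hi => h1.mem_leaves.1 hi⟩

section Main

variable {N : ℕ → BTensor B →ₗ[𝕜] BTensor B} {R : ℕ → Set (BTensor B)}
  {le : BTree B → BTree B → Prop} {S : Set (BTree B)}

lemma IsNormalForm.coefficient_eq (hN : IsNormalForm R S N) {y : BarTensor B}
    (hy : ∀ T ∈ y.support, LabelsOK B T ∧ AllLabels S T) (U : BarTree B) :
    coefficient N U y = y U := by
  classical
  rw [coefficient_apply]
  rw [Finset.sum_congr rfl fun T hT => by rw [hN.pairing_eq (hy T hT).1 (hy T hT).2]]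
  simp only [mul_ite, mul_one, mul_zero, Finset.sum_ite_eq']
  split_ifs with h
  · rfl
  · exact (Finsupp.notMem_support_iff.1 h).symm

/-- The functional `coefficient N U` vanishes on relations, so its value on `T'` is the coordinate
at `U` of the reduction of `T'`. -/
lemma isReduction_of_pairing (hR : IsQuadratic B R) (hle : IsMonomialOrder B le)
    (hS : IsPBWBasis B R le S) (hN : IsNormalForm R S N) {T T' U : BarTree B} (hT : IsBarTree T)
    (hTS : AllLabels S T) (h : Contracts T T') (hU : pairing N U T' ≠ 0) :
    IsReduction le S T' U := by
  obtain ⟨y, hy1, hy2⟩ := exists_reduction hR hle hS hT hTS h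
  refine hy2 U ?_
  have h1 := hN.coefficient_treeRelations hy1 U
  rw [map_sub, coefficient_single, one_mul, hN.coefficient_eq
    (fun V hV => ⟨(hy2 V hV).isBarTree.labels, (hy2 V hV).allLabels⟩), sub_eq_zero] at h1
  rw [h1] at hU
  exact Finsupp.mem_support_iff.2 hU

lemma exists_isReduction (hR : IsQuadratic B R) (hle : IsMonomialOrder B le)
    (hS : IsPBWBasis B R le S) (hN : IsNormalForm R S N) {T U : BarTree B} (hT : IsBarTree T)
    (hTS : AllLabels S T) (hU : coefficient N U (barDiffTree B T) ≠ 0) :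
    ∃ p, IsContractible (markedWord T) p ∧ IsReduction le S (contractAt T p) U := by
  rw [barDiffTree_eq hT, map_sum] at hU
  obtain ⟨p, -, hp⟩ := Finset.exists_ne_zero_of_sum_ne_zero hU
  rw [diffTerm] at hp
  split_ifs at hp with hc
  · rw [coefficient_single] at hp
    exact ⟨p, hc, isReduction_of_pairing hR hle hS hN hT hTS (hc.contracts hT).1
      (right_ne_zero_of_mul hp)⟩
  · simp at hp

/-- All contractions of `T` have the same expansion, whereas the reductions that are not trivial
have a strictly larger one. So only the contraction at `p` itself contributes, with a sign. -/
lemma coefficient_contractAt_ne_zero (hR : IsQuadratic B R) (hle : IsMonomialOrder B le)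
    (hS : IsPBWBasis B R le S) (hN : IsNormalForm R S N) {T : BarTree B} (hT : IsBarTree T)
    (hTS : AllLabels S T) {p : ℕ} (hp : IsContractible (markedWord T) p)
    (hpS : AllLabels S (contractAt T p)) :
    coefficient N (contractAt T p) (barDiffTree B T) ≠ 0 := by
  classical
  obtain ⟨hc, hmw⟩ := hp.contracts hT
  rw [barDiffTree_eq hT, map_sum, Finset.sum_eq_single p]
  · rw [diffTerm, if_pos hp, coefficient_single, hN.pairing_eq (hc.isBarTree hT).1.labels hpS,
      if_pos rfl, mul_one]
    exact sg_ne_zero _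
  · intro q _ hqp
    by_contra h
    rw [diffTerm] at h
    split_ifs at h with hq
    · rw [coefficient_single] at h
      obtain ⟨hc', hmw'⟩ := hq.contracts hT
      rcases (isReduction_of_pairing hR hle hS hN hT hTS hc'
        (right_ne_zero_of_mul h)).eq_or_le with h1 | h1
      -- If the contractions at `p` and `q` coincided, the position `q` would be contractible in the
      -- one and not in the other.
      · have h2 := isContractible_markAt (q := q) hp
        rw [← hmw, h1, hmw', isContractible_markAt hq] at h2
        exact (h2.2 ⟨hqp, hq⟩).1 rfl
      · exact h1.2 (by rw [hc.expand_eq hT, hc'.expand_eq hT])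
    · simp at h
  · intro h
    exact absurd (Finset.mem_range.2 hp.lt) h

lemma mem_barChains_support {s r : ℕ} {z : BarTensor B} (hz : z ∈ barChains B s s r)
    {T : BarTree B} (hT : T ∈ z.support) :
    ∃ t : BTree B, t.IsReduced r ∧ t.numVertices = s ∧ T = toBar B t := by
  obtain ⟨h1, h2, h3⟩ := hz hT
  have hT' := (isBarTree_iff.1 h1).1
  refine ⟨expand T, ⟨expand_isCanonical hT', (leaves_expand hT'.labels).trans h1.1.2⟩, ?_,
    hT'.eq_toBar (by rw [h2, h3])⟩
  rw [← barWeight_eq hT'.labels, h3]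

lemma isBarTree_toBar' {r : ℕ} {t : BTree B} (ht : t.IsReduced r) : IsBarTree (toBar B t) :=
  isBarTree_toBar ht.1 ht.nodup

/-- The position `p` is the only one that is marked. -/
lemma allLabels_contractAt (hS : IsPBWBasis B R le S) {r : ℕ} {t : BTree B} (ht : t.IsReduced r)
    {p : ℕ} (hp : IsAdmissibleAt S t p) : AllLabels S (contractAt (toBar B t) p) := by
  have hc := hp.isContractible
  obtain ⟨h1, h2⟩ := hc.contracts (isBarTree_toBar' ht)
  rw [allLabels_iff hS (h1.isBarTree (isBarTree_toBar' ht)).1, h1.expand_eq (isBarTree_toBar' ht),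
    expand_toBar, h2]
  intro q v hq
  by_cases hqp : q = p
  · rw [hqp]; exact hp
  · rw [getElem?_markAt_ne _ (Ne.symm hqp), markedWord_toBar, unmarked] at hq
    simp only [List.getElem?_map] at hq
    rcases h : t.word[q]? with _ | a
    · rw [h] at hq; simp at hq
    · rw [h] at hq
      rcases a with a | a <;> simp at hq

lemma wellFounded_le (hB : ∀ n, Finite (B.ι n)) (hle : IsMonomialOrder B le) (s r : ℕ) :
    WellFounded fun t t' : {t : BTree B // t.IsReduced r ∧ t.numVertices = s} =>
      le t.1 t'.1 ∧ t.1 ≠ t'.1 := by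
  have : Finite {t : BTree B // t.IsReduced r ∧ t.numVertices = s} :=
    (finite_setOf_isReduced hB s r).to_subtype
  let rel : {t : BTree B // t.IsReduced r ∧ t.numVertices = s} →
    {t : BTree B // t.IsReduced r ∧ t.numVertices = s} → Prop := fun t t' => le t.1 t'.1 ∧ t.1 ≠ t'.1
  have h1 : IsTrans _ rel := ⟨fun a b c h h' => by
    refine ⟨hle.trans r _ _ _ a.2.1 b.2.1 c.2.1 h.1 h'.1, fun e => ?_⟩
    have h2 := h'.1
    rw [← e] at h2
    exact h.2 (hle.antisymm r _ _ a.2.1 b.2.1 h.1 h2)⟩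
  have h2 : Std.Irrefl rel := ⟨fun a h => h.2 rfl⟩
  exact Finite.wellFounded_of_trans_of_irrefl rel

/-- A chain of generators is determined by the coordinates with no admissible edge and by the
coefficients of its differential on the contractions of admissible edges. -/
lemma eq_zero_of_coefficient (hB : ∀ n, Finite (B.ι n)) (hR : IsQuadratic B R)
    (hle : IsMonomialOrder B le) (hS : IsPBWBasis B R le S) (hN : IsNormalForm R S N) {s r : ℕ}
    {z : BarTensor B} (hz : z ∈ barChains B s s r)
    (h0 : ∀ t : BTree B, t.IsReduced r → t.numVertices = s → z (toBar B t) ≠ 0 →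
      ∃ p, IsAdmissibleAt S t p ∧ coefficient N (contractAt (toBar B t) p) (barDiff B z) = 0) :
    z = 0 := by
  classical
  by_contra hne
  obtain ⟨T, hT⟩ := Finsupp.support_nonempty_iff.2 hne
  obtain ⟨t₁, ht₁, hs₁, rfl⟩ := mem_barChains_support hz hT
  -- Minimality is the right choice: reductions only go up, so the coefficient at a contraction of
  -- `t` receives contributions from `t` and from smaller monomials.
  obtain ⟨⟨t, ht, hs⟩, hmem, hmin⟩ := (wellFounded_le hB hle s r).has_min
    {t | z (toBar B t.1) ≠ 0} ⟨⟨t₁, ht₁, hs₁⟩, Finsupp.mem_support_iff.1 hT⟩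
  obtain ⟨p, hp, hcoef⟩ := h0 t ht hs hmem
  have hbt := isBarTree_toBar' ht
  have hexp : expand (contractAt (toBar B t) p) = t := by
    rw [(hp.isContractible.contracts hbt).1.expand_eq hbt, expand_toBar]
  rw [barDiff_apply, map_sum, Finset.sum_eq_single (toBar B t)] at hcoef
  · rw [map_smul, smul_eq_mul] at hcoef
    exact mul_ne_zero hmem (coefficient_contractAt_ne_zero hR hle hS hN hbt
      (allLabels_toBar hS t) hp.isContractible (allLabels_contractAt hS ht hp)) hcoef
  · intro T hT hTt
    obtain ⟨t', ht', hs', rfl⟩ := mem_barChains_support hz hT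
    have hbt' := isBarTree_toBar' ht'
    rw [map_smul, smul_eq_mul]
    by_contra h
    obtain ⟨q, hq, hred⟩ := exists_isReduction hR hle hS hN hbt' (allLabels_toBar hS t')
      (right_ne_zero_of_mul h)
    have hexp' : expand (contractAt (toBar B t') q) = t' := by
      rw [(hq.contracts hbt').1.expand_eq hbt', expand_toBar]
    -- Equality of the contractions forces `t' = t` by expansion; otherwise `t' < t`, against
    -- minimality.
    rcases hred.eq_or_le with h1 | ⟨h1, h2⟩
    · rw [← h1, hexp] at hexp'
      exact hTt (by rw [hexp'])
    · rw [hexp, hexp'] at h1 h2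
      exact hmin ⟨t', ht', hs'⟩ (Finsupp.mem_support_iff.1 hT)
        ⟨h1.le_of_isReduced ht' ht, h2.symm⟩
  · intro h
    exact absurd (Finsupp.mem_support_iff.2 hmem) h

lemma treeRelations_perm {L L' : List ℕ} (h : L.Perm L') :
    treeRelations R L = treeRelations R L' := by
  have : ∀ T : BarTree B, T.leaves.Perm L ↔ T.leaves.Perm L' := fun T =>
    ⟨fun h' => h'.trans h, fun h' => h'.trans h.symm⟩
  simp only [treeRelations, this]

lemma exists_normalForm_barDiff (hR : IsQuadratic B R) (hle : IsMonomialOrder B le)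
    (hS : IsPBWBasis B R le S) {s r : ℕ} {z : BarTensor B} (hz : z ∈ barChains B s s r) :
    ∃ y : BarTensor B, barDiff B z - y ∈ treeRelations R (List.range r) ∧
      ∀ U ∈ y.support, IsBarTree U ∧ AllLabels S U ∧ U.leaves.Perm (List.range r) ∧
        barWeight B U = s ∧ U.numVertices + 1 = s := by
  classical
  have h1 : ∀ T' ∈ (barDiff B z).support, ∃ y : BarTensor B,
      Finsupp.single T' 1 - y ∈ treeRelations R (List.range r) ∧
      ∀ U ∈ y.support, IsBarTree U ∧ AllLabels S U ∧ U.leaves.Perm (List.range r) ∧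
        barWeight B U = s ∧ U.numVertices + 1 = s := by
    intro T' hT'
    rw [barDiff_apply] at hT'
    obtain ⟨T, hT, hT'⟩ := exists_mem_support_of_mem_support_sum hT'
    obtain ⟨t, ht, hs, rfl⟩ := mem_barChains_support hz hT
    have hbt := isBarTree_toBar' ht
    have hc := contracts_of_mem_support hbt (Finsupp.support_smul hT')
    obtain ⟨h1, h2, -⟩ := hc.isBarTree hbt
    obtain ⟨y, hy1, hy2⟩ := exists_reduction hR hle hS hbt (allLabels_toBar hS t) hc
    have hp : T'.leaves.Perm (List.range r) := h2.trans (by rw [leaves_toBar]; exact ht.2)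
    rw [treeRelations_perm hp] at hy1
    refine ⟨y, hy1, fun U hU => ?_⟩
    have hred := hy2 U hU
    refine ⟨hred.isBarTree, hred.allLabels, hred.leaves_perm.trans hp, ?_, ?_⟩
    · rw [hred.barWeight_eq, hc.barWeight_eq hbt, barWeight_eq hbt.labels, expand_toBar, hs]
    · rw [hred.numVertices_eq, hc.numVertices_eq hbt, numVertices_toBar, hs]
  choose! y hy1 hy2 using h1
  refine ⟨∑ T ∈ (barDiff B z).support, barDiff B z T • y T, ?_, fun U hU => ?_⟩
  · have : barDiff B z = ∑ T ∈ (barDiff B z).support,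
        barDiff B z T • Finsupp.single T (1 : 𝕜) := by
      conv_lhs => rw [← Finsupp.sum_single (barDiff B z), Finsupp.sum]
      exact Finset.sum_congr rfl fun T _ => by simp
    nth_rw 1 [this]
    rw [← Finset.sum_sub_distrib]
    refine sum_mem fun T hT => ?_
    rw [← smul_sub]
    exact Submodule.smul_mem _ _ (hy1 T hT)
  · obtain ⟨T, hT, hU⟩ := exists_mem_support_of_mem_support_sum hU
    exact hy2 T hT U (Finsupp.support_smul hU)

lemma barDiff_barDiff {s r : ℕ} {z : BarTensor B} (hz : z ∈ barChains B s s r) :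
    barDiff B (barDiff B z) = 0 := by
  rw [barDiff_apply z, map_sum]
  refine Finset.sum_eq_zero fun T hT => ?_
  rw [map_smul, barDiff_barDiffTree (isBarTree_iff.1 (hz hT).1).1, smul_zero]

/-- If the coefficients of the differential of a chain of generators vanish on the contraction of one
admissible edge of every monomial that has any, then this differential is a relation. -/
lemma barDiff_mem_of_coefficient (hB : ∀ n, Finite (B.ι n)) (hR : IsQuadratic B R)
    (hle : IsMonomialOrder B le) (hS : IsPBWBasis B R le S) (hN : IsNormalForm R S N) {s r : ℕ}
    {z : BarTensor B} (hz : z ∈ barChains B s s r)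
    (h0 : ∀ t : BTree B, t.IsReduced r → t.numVertices = s → (∃ p, IsAdmissibleAt S t p) →
      ∃ p, IsAdmissibleAt S t p ∧ coefficient N (contractAt (toBar B t) p) (barDiff B z) = 0) :
    barDiff B z ∈ treeRelations R (List.range r) := by
  classical
  obtain ⟨y, hy1, hy2⟩ := exists_normalForm_barDiff hR hle hS hz
  have hcoef : ∀ U, coefficient N U (barDiff B z) = y U := fun U => by
    have h1 := hN.coefficient_treeRelations hy1 U
    rwa [map_sub, hN.coefficient_eq (fun V hV => ⟨(hy2 V hV).1.labels, (hy2 V hV).2.1⟩),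
      sub_eq_zero] at h1
  -- `y` is a normal form of `δz`; since `δδz = 0` and `δ` preserves the relations, `δy` is a
  -- relation.
  have hdy : barDiff B y ∈ treeRelations R (List.range r) := by
    have := barDiff_mem_treeRelations hR hy1
    rw [map_sub, barDiff_barDiff hz, zero_sub] at this
    exact neg_mem_iff.1 this
  suffices hy : y = 0 by rwa [hy, sub_zero] at hy1
  by_contra hne
  have hred : ∀ U ∈ y.support, (expand U).IsReduced r ∧ (expand U).numVertices = s := fun U hU => by
    obtain ⟨h1, h2, h3, h4, h5⟩ := hy2 U hU
    exact ⟨⟨expand_isCanonical h1, (leaves_expand h1.labels).trans h3⟩,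
      by rw [← barWeight_eq h1.labels, h4]⟩
  obtain ⟨U₁, hU₁⟩ := Finsupp.support_nonempty_iff.2 hne
  -- The monomial underlying a term of `y` is taken minimal. Each term above it is the contraction
  -- of a single admissible edge of `t` (`hone`).
  obtain ⟨⟨t, ht, hs⟩, ⟨U, hU, hUt⟩, hmin⟩ := (wellFounded_le hB hle s r).has_min
    {t | ∃ U ∈ y.support, expand U = t.1} ⟨⟨expand U₁, hred U₁ hU₁⟩, U₁, hU₁, rfl⟩
  dsimp only at hUt
  have hbt := isBarTree_toBar' ht
  have hone : ∀ U ∈ y.support, expand U = t → ∃ q, IsContractible (markedWord (toBar B t)) q ∧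
      U = contractAt (toBar B t) q ∧ markedWord U = markAt (markedWord (toBar B t)) q ∧
      IsAdmissibleAt S t q := by
    intro U hU hUt
    obtain ⟨h1, h2, h3, h4, h5⟩ := hy2 U hU
    obtain ⟨q, hq1, hq2⟩ := h1.exists_eq_contractAt (by omega)
    rw [hUt] at hq1 hq2
    have hmw := (hq1.contracts hbt).2
    rw [← hq2] at hmw
    refine ⟨q, hq1, hq2, hmw, ?_⟩
    obtain ⟨_, v, hv⟩ := hq1
    rw [← hUt]
    refine (allLabels_iff hS h1).1 h2 q v ?_
    rw [hmw, getElem?_markAt_self hv]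
  obtain ⟨q, hq, hUq, hUw, hqS⟩ := hone U hU hUt
  obtain ⟨p, hp, hp0⟩ := h0 t ht hs ⟨q, hqS⟩
  rw [hcoef] at hp0
  -- The chosen edge `p` has coefficient zero in `y`, while `q` comes from a term that does occur.
  have hpq : p ≠ q := by
    rintro rfl
    rw [← hUq] at hp0
    exact Finsupp.mem_support_iff.1 hU hp0
  have hbU := (hy2 U hU).1
  have hpU : IsContractible (markedWord U) p := by
    rw [hUw, isContractible_markAt hq]
    exact ⟨hpq, hp.isContractible⟩
  obtain ⟨hc, hWw⟩ := hpU.contracts hbU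
  have hbW := (hc.isBarTree hbU).1
  have hWt : expand (contractAt U p) = t := by rw [hc.expand_eq hbU, hUt]
  have hmarked : ∀ k v, (markedWord (contractAt U p))[k]? = some (.inl (v, true)) →
      k = p ∨ k = q := by
    intro k v hk
    by_contra! h
    rw [hWw, hUw, getElem?_markAt_ne _ h.1.symm, getElem?_markAt_ne _ h.2.symm, markedWord_toBar, unmarked] at hk
    simp only [List.getElem?_map] at hk
    rcases h' : t.word[k]? with _ | a
    · rw [h'] at hk; simp at hk
    · rw [h'] at hk
      rcases a with a | a <;> simp at hk
  -- Both contracted edges are admissible, so `t/{p, q}` is labelled in `S` and its coefficient in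
  -- `δy` is meaningful.
  have hWS : AllLabels S (contractAt U p) := by
    rw [allLabels_iff hS hbW, hWt]
    intro k v hk
    rcases hmarked k v hk with rfl | rfl
    · exact hp
    · exact hqS
  -- The coefficient of `t/{p, q}` in `δy` is zero because `δy` is a relation, but `U` turns out to
  -- be the only term of `y` that contributes to it.
  have hsum := hN.coefficient_treeRelations hdy (contractAt U p)
  rw [barDiff_apply, map_sum, Finset.sum_eq_single U] at hsum
  · rw [map_smul, smul_eq_mul] at hsum
    exact mul_ne_zero (Finsupp.mem_support_iff.1 hU) (coefficient_contractAt_ne_zero hR hle hS hN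
      hbU (hy2 U hU).2.1 hpU hWS) hsum
  · intro U' hU' hne'
    rw [map_smul, smul_eq_mul]
    by_contra h
    have hbU' := (hy2 U' hU').1
    obtain ⟨k, hk, hred'⟩ := exists_isReduction hR hle hS hN hbU' (hy2 U' hU').2.1
      (right_ne_zero_of_mul h)
    obtain ⟨hc', hmw'⟩ := hk.contracts hbU'
    have hexp' := hc'.expand_eq hbU'
    rcases hred'.eq_or_le with h1 | ⟨h1, h2⟩
    · have hU't : expand U' = t := by rw [← hexp', ← h1, hWt]
      obtain ⟨q', hq', hUq', hUw', -⟩ := hone U' hU' hU't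
      obtain ⟨_, v, hv⟩ := hq'
      have hmk : (markedWord (contractAt U p))[q']? = some (.inl (v, true)) := by
        have h2 := getElem?_markAt_self hv
        rw [← hUw'] at h2
        rw [h1, hmw']
        by_cases hkq : k = q'
        · rw [hkq, getElem?_markAt_self h2]
        · rw [getElem?_markAt_ne _ hkq, h2]
      -- Another term with the same underlying monomial is `t/p` or `t/q`: the former is excluded by
      -- the vanishing of its coefficient, the latter is `U`.
      rcases hmarked q' v hmk with rfl | rfl
      · rw [← hUq'] at hp0
        exact Finsupp.mem_support_iff.1 hU' hp0
      · exact hne' (by rw [hUq', hUq])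
    -- A term that contributes through a proper reduction has a smaller underlying monomial.
    · rw [hexp', hWt] at h1 h2
      exact hmin ⟨expand U', hred U' hU'⟩ ⟨U', hU', rfl⟩
        ⟨h1.le_of_isReduced (hred U' hU').1 ht, h2.symm⟩
  · intro h
    exact absurd hU h

end Main

end

/-! ### Coordinates on the Koszul construction. -/

section
open OTree

variable {𝕜 : Type u} [Field 𝕜] {M : SigmaModule.{u, v} 𝕜} {B : HomogeneousBasis.{u, v, w} M}

lemma toBar_injective : Function.Injective (toBar B) := fun t t' h => by
  rw [← expand_toBar t, h, expand_toBar]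

lemma single_toBar_mem_barChains {s r : ℕ} {t : BTree B} (h : t.IsReduced r ∧ t.numVertices = s) :
    Finsupp.single (toBar B t) (1 : 𝕜) ∈ barChains B s s r := by
  obtain ⟨ht, hs⟩ := h
  have hb := isBarTree_toBar' ht
  refine Finsupp.single_mem_supported 𝕜 1 ⟨⟨⟨hb.canonical, ?_⟩, hb.labels⟩, ?_, ?_⟩
  · rw [leaves_toBar]; exact ht.2
  · rw [numVertices_toBar, hs]
  · rw [barWeight_eq hb.labels, expand_toBar, hs]

/-- The combination of the treewise tensors of `F^c(ΣM)` on a finite family of monomials. -/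
noncomputable def toBarCombination {σ : Type*} [Fintype σ] (m : σ → BTree B) : (σ → 𝕜) →ₗ[𝕜] BarTensor B :=
  Fintype.linearCombination 𝕜 fun i => Finsupp.single (toBar B (m i)) (1 : 𝕜)

section Combination

variable {σ : Type*} [Fintype σ] {m : σ → BTree B}

lemma toBarCombination_eq (f : σ → 𝕜) :
    toBarCombination m f = ∑ i, Finsupp.single (toBar B (m i)) (f i) := by
  simp [toBarCombination, Fintype.linearCombination_apply]

lemma toBarCombination_apply (hm : Function.Injective m) (f : σ → 𝕜) (i : σ) :
    toBarCombination m f (toBar B (m i)) = f i := by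
  classical
  rw [toBarCombination_eq, Finsupp.finsetSum_apply, Finset.sum_eq_single i]
  · simp
  · intro j _ hj
    exact Finsupp.single_eq_of_ne fun h => hj (hm (toBar_injective h)).symm
  · simp

lemma toBarCombination_apply_of_notMem (f : σ → 𝕜) {t : BTree B} (ht : ∀ i, m i ≠ t) :
    toBarCombination m f (toBar B t) = 0 := by
  classical
  rw [toBarCombination_eq, Finsupp.finsetSum_apply]
  exact Finset.sum_eq_zero fun j _ =>
    Finsupp.single_eq_of_ne fun h => ht j (toBar_injective h).symm

lemma toBarCombination_mem {s r : ℕ} (hm : ∀ i, (m i).IsReduced r ∧ (m i).numVertices = s)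
    (f : σ → 𝕜) : toBarCombination m f ∈ barChains B s s r := by
  rw [toBarCombination, Fintype.linearCombination_apply]
  exact sum_mem fun i _ => Submodule.smul_mem _ _ (single_toBar_mem_barChains (hm i))

end Combination

lemma mem_koszulConstruction {R : ℕ → Set (BTensor B)} {s r : ℕ} {z : BarTensor B} :
    z ∈ koszulConstruction B R s r ↔
      z ∈ barChains B s s r ∧ barDiff B z ∈ treeRelations R (List.range r) := by
  rw [koszulConstruction, Submodule.mem_inf, LinearMap.mem_ker, LinearMap.comp_apply,
    Submodule.mkQ_apply, Submodule.Quotient.mk_eq_zero, barRelations_eq]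

/-- The coordinates of the elements of the Koszul construction on the monomials without admissible
edges. -/
noncomputable def koszulCoordinates (R : ℕ → Set (BTensor B)) (S : Set (BTree B)) (s r : ℕ) :
    koszulConstruction B R s r →ₗ[𝕜]
      ({t : BTree B // (t.IsReduced r ∧ t.numVertices = s) ∧ admissibleEdges B S t = ∅} → 𝕜) :=
  LinearMap.pi fun t => dualMonomial B R s r t.1

section Bijective

variable {R : ℕ → Set (BTensor B)} {le : BTree B → BTree B → Prop} {S : Set (BTree B)}

/-- The support of an element of the kernel consists of monomials with an admissible edge, and all
coefficients of its differential vanish since this differential is a relation. -/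
lemma koszulCoordinates_injective (hB : ∀ n, Finite (B.ι n)) (hR : IsQuadratic B R)
    (hle : IsMonomialOrder B le) (hS : IsPBWBasis B R le S)
    {N : ℕ → BTensor B →ₗ[𝕜] BTensor B} (hN : IsNormalForm R S N) (s r : ℕ) :
    Function.Injective (koszulCoordinates R S s r) := by
  refine (injective_iff_map_eq_zero _).2 ?_
  rintro ⟨z, hz⟩ h
  obtain ⟨hz1, hz2⟩ := mem_koszulConstruction.1 hz
  refine Subtype.ext (eq_zero_of_coefficient hB hR hle hS hN hz1 fun t ht hs hzt => ?_)
  obtain ⟨p, hp⟩ : ∃ p, IsAdmissibleAt S t p := by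
    rw [exists_isAdmissibleAt_iff, Set.nonempty_iff_ne_empty]
    exact fun he => hzt (congrFun h ⟨t, ⟨ht, hs⟩, he⟩)
  exact ⟨p, hp, hN.coefficient_treeRelations hz2 _⟩

/-- Prescribed coordinates on the monomials without admissible edge are completed on the others so
that `δ` vanishes on one chosen contraction of each; this already puts the chain in the Koszul
construction. -/
lemma koszulCoordinates_surjective (hB : ∀ n, Finite (B.ι n)) (hR : IsQuadratic B R)
    (hle : IsMonomialOrder B le) (hS : IsPBWBasis B R le S)
    {N : ℕ → BTensor B →ₗ[𝕜] BTensor B} (hN : IsNormalForm R S N) (s r : ℕ) :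
    Function.Surjective (koszulCoordinates R S s r) := by
  classical
  let σ := {t : BTree B // (t.IsReduced r ∧ t.numVertices = s) ∧ ∃ p, IsAdmissibleAt S t p}
  let ι := {t : BTree B // (t.IsReduced r ∧ t.numVertices = s) ∧ admissibleEdges B S t = ∅}
  have hσ : Finite σ := ((finite_setOf_isReduced hB s r).subset fun t ht => ht.1).to_subtype
  have hι : Finite ι := ((finite_setOf_isReduced hB s r).subset fun t ht => ht.1).to_subtype
  have := Fintype.ofFinite σ
  have := Fintype.ofFinite ι
  let m : σ → BTree B := Subtype.val
  let m' : ι → BTree B := Subtype.val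
  let p : σ → ℕ := fun t => t.2.2.choose
  have hp : ∀ t : σ, IsAdmissibleAt S t.1 (p t) := fun t => t.2.2.choose_spec
  -- There is one equation for each monomial with an admissible edge, hence as many equations as
  -- unknowns; injectivity therefore gives solvability.
  let Φ : BarTensor B →ₗ[𝕜] (σ → 𝕜) := LinearMap.pi fun t =>
    coefficient N (contractAt (toBar B t.1) (p t)) ∘ₗ barDiff B
  have hinj : Function.Injective (Φ ∘ₗ toBarCombination m) := by
    rw [← LinearMap.ker_eq_bot, LinearMap.ker_eq_bot']
    intro f hf
    have h0 : toBarCombination m f = 0 :=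
      eq_zero_of_coefficient hB hR hle hS hN (toBarCombination_mem (fun t => t.2.1) f)
        fun t ht hs hzt => by
          have hA : ∃ q, IsAdmissibleAt S t q := by
            by_contra h
            refine hzt (toBarCombination_apply_of_notMem f ?_)
            rintro ⟨t', h', hA⟩ rfl
            exact h hA
          exact ⟨_, hp ⟨t, ⟨ht, hs⟩, hA⟩, congrFun hf ⟨t, ⟨ht, hs⟩, hA⟩⟩
    funext t
    rw [← toBarCombination_apply (m := m) Subtype.val_injective f t, h0]
    rfl
  intro g
  -- The completion `f` cancels the coefficients produced by the prescribed part `g`.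
  obtain ⟨f, hf⟩ := LinearMap.injective_iff_surjective.1 hinj (-Φ (toBarCombination m' g))
  have hz : toBarCombination m f + toBarCombination m' g ∈ barChains B s s r :=
    add_mem (toBarCombination_mem (fun t => t.2.1) f) (toBarCombination_mem (fun t => t.2.1) g)
  have hΦ : Φ (toBarCombination m f + toBarCombination m' g) = 0 := by
    rw [map_add, ← LinearMap.comp_apply, hf, neg_add_cancel]
  refine ⟨⟨_, mem_koszulConstruction.2 ⟨hz, barDiff_mem_of_coefficient hB hR hle hS hN hz
    fun t ht hs hA => ⟨_, hp ⟨t, ⟨ht, hs⟩, hA⟩, congrFun hΦ ⟨t, ⟨ht, hs⟩, hA⟩⟩⟩⟩, ?_⟩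
  funext t
  change (toBarCombination m f + toBarCombination m' g) (toBar B (m' t)) = g t
  rw [Finsupp.add_apply, toBarCombination_apply Subtype.val_injective,
    toBarCombination_apply_of_notMem, zero_add]
  rintro ⟨t', h', hA⟩ h
  have hA' : ∃ q, IsAdmissibleAt S t.1 q := (show t' = t.1 from h) ▸ hA
  rw [exists_isAdmissibleAt_iff, t.2.2] at hA'
  exact Set.not_nonempty_empty hA'

end Bijective

end

end OperadPBW

/-! ### The basis of the dual of the Koszul construction. -/

open OperadPBW OperadPBW.OTree in
theorem mainTheorem6 {𝕜 : Type*} [Field 𝕜] (M : SigmaModule 𝕜) (B : HomogeneousBasis M)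
    (hM0 : Subsingleton (M.carrier 0)) (hMfin : ∀ n, Module.Finite 𝕜 (M.carrier n))
    (R : ℕ → Set (BTensor B)) (hR : IsQuadratic B R)
    (le : BTree B → BTree B → Prop) (hle : IsMonomialOrder B le)
    (S : Set (BTree B)) (hS : IsPBWBasis B R le S) :
    (∀ s r : ℕ,
      ∃ b : Module.Basis
          {t : BTree B // (t.IsReduced r ∧ t.numVertices = s) ∧ admissibleEdges B S t = ∅}
          𝕜 (Module.Dual 𝕜 (koszulConstruction B R s r)),
        ∀ t, b t = dualMonomial B R s r t.1) ∧
    (∀ t : BTree B, admissibleEdges B S t = ∅ ↔ ∀ e : Edge t, e.restrict ∉ S) := by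
  classical
  have hB : ∀ n, Finite (B.ι n) := fun n => Module.Finite.finite_basis (B.basis n)
  obtain ⟨N, hN⟩ := hS.exists_isNormalForm fun r x hx t ht => ((hR r x hx).1 ht).1
  refine ⟨fun s r => ?_, fun t => Set.eq_empty_iff_forall_notMem⟩
  have : Finite {t : BTree B // (t.IsReduced r ∧ t.numVertices = s) ∧ admissibleEdges B S t = ∅} :=
    ((finite_setOf_isReduced hB s r).subset fun t ht => ht.1).to_subtype
  have := Fintype.ofFinite
    {t : BTree B // (t.IsReduced r ∧ t.numVertices = s) ∧ admissibleEdges B S t = ∅}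
  -- Bijectivity of the coordinates gives a basis `b` of the Koszul construction, whose dual basis
  -- consists of the coordinate forms, that is, of the classes `λ^#`.
  let b := Module.Basis.ofEquivFun (LinearEquiv.ofBijective (koszulCoordinates R S s r)
    ⟨koszulCoordinates_injective hB hR hle hS hN s r,
      koszulCoordinates_surjective hB hR hle hS hN s r⟩)
  refine ⟨b.dualBasis, fun t => LinearMap.ext fun z => ?_⟩
  rw [b.dualBasis_apply, Module.Basis.ofEquivFun_repr_apply]
  rfl
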